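/- Graphs are finite, simple and undirected. A graph is \emph{outerplanar} if it has a planar combinatorial embedding with all the vertices on the boundary of a single face; an outerplanar graph $G$ is \emph{maximal} if $G\cup vw$ is not outerplanar for every pair of non-adjacent vertices $v,w$. A \emph{drawing} of a graph places its vertices at distinct points of the plane and represents each edge by the closed line segment between its endpoints, such that the only vertices that an edge meets are its own endpoints; edges may cross. The drawing is \emph{plane} if no two edges meet at a point other than a common endpoint. It is \emph{outerplanar} if it is plane and all the vertices are on the boundary of the outer (unbounded) face. A \emph{segment} of a drawing is a maximal set of edges whose union is a line segment. A drawing is \emph{star-shaped} if there is a point $p$ in some internal (bounded) face such that every ray from $p$ meets the boundary of the outer face in exactly one point. \textbf{Theorem.} (1) Every $n$-vertex maximal outerplanar graph has an outerplanar drawing with at most $n$ segments; if $n\ge 3$, this drawing can moreover be taken star-shaped. (2) For every $n\ge 3$ there is an $n$-vertex maximal outerplanar graph, with maximum degree at most $4$ and with an outerplanar embedding whose weak dual (the dual graph without the outer face) is a path, such that every drawing of it (even with crossings) has at least $n$ segments. -/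

import Mathlib

/-- The Euclidean plane. -/
abbrev Plane : Type := EuclideanSpace ℝ (Fin 2)

/-! ### Combinatorial embeddings, outerplanar graphs -/

/-- A combinatorial embedding (rotation system) of `G`: a permutation of the darts (oriented
edges) of `G` whose cycles are exactly the sets of darts leaving a common vertex, that is, a
cyclic order of the edges around each vertex. -/
structure RotationSystem {V : Type*} (G : SimpleGraph V) where
  rot : Equiv.Perm G.Dart
  fst_rot : ∀ d : G.Dart, (rot d).fst = d.fst
  sameCycle_of_fst_eq : ∀ d e : G.Dart, d.fst = e.fst → rot.SameCycle d e

namespace RotationSystem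

variable {V : Type*} {G : SimpleGraph V}

/-- The face permutation: traverse the dart `d`, then leave its head by the dart that follows
the reversal of `d` in the rotation. Its cycles are the facial walks. -/
def facePerm (M : RotationSystem G) : Equiv.Perm G.Dart :=
  (SimpleGraph.Dart.symm_involutive (G := G)).toPerm.trans M.rot

/-- The facial walks of a combinatorial embedding. A component that consists of a single vertex
has no dart; its trivial facial walk is accounted for separately in `IsPlanar`. -/
def Face (M : RotationSystem G) : Type _ :=
  Quotient (Equiv.Perm.SameCycle.setoid M.facePerm)

/-- The facial walk through a dart. -/
def faceOf (M : RotationSystem G) (d : G.Dart) : M.Face :=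
  Quotient.mk (Equiv.Perm.SameCycle.setoid M.facePerm) d

/-- The embedding is planar: Euler's formula `|V| - |E| + |F| = 2 c`, where `c` is the number of
components and `F` is the set of facial walks, one trivial walk for each isolated vertex
included. As each component has Euler characteristic at most `2`, this says that every component
is embedded in the sphere. -/
def IsPlanar (M : RotationSystem G) : Prop :=
  Nat.card V + (Nat.card M.Face + Nat.card {v : V // ∀ w, ¬ G.Adj v w}) =
    Nat.card G.edgeSet + 2 * Nat.card G.ConnectedComponent

/-- The facial walks in `O` bound a common face that has all the vertices on its boundary. The
boundary of a face of a plane embedding consists of at most one facial walk of each component,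
and any such choice of facial walks bounds a common face when the components are placed suitably.
An isolated vertex is on the boundary through its trivial facial walk. -/
def IsOuter (M : RotationSystem G) (O : Set M.Face) : Prop :=
  (∀ d e : G.Dart, M.faceOf d ∈ O → M.faceOf e ∈ O → G.Reachable d.fst e.fst →
    M.faceOf d = M.faceOf e) ∧
  (∀ v w : V, G.Adj v w → ∃ d : G.Dart, d.fst = v ∧ M.faceOf d ∈ O)

/-- The weak dual with respect to the outer face `O`: its vertices are the faces other than the
outer face, two of them being adjacent if they share an edge. -/
def weakDual (M : RotationSystem G) (O : Set M.Face) : SimpleGraph {f : M.Face // f ∉ O} where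
  Adj f g := f ≠ g ∧ ∃ d : G.Dart, M.faceOf d = f.1 ∧ M.faceOf d.symm = g.1
  symm := ⟨fun _ _ ⟨hne, d, h₁, h₂⟩ => ⟨hne.symm, d.symm, h₂, by rw [d.symm_symm]; exact h₁⟩⟩
  loopless := ⟨fun _ h => h.1 rfl⟩

end RotationSystem

/-- `G` is outerplanar: it has a planar combinatorial embedding with all the vertices on the
boundary of a single face. -/
def IsOuterplanar {V : Type*} (G : SimpleGraph V) : Prop :=
  ∃ (M : RotationSystem G) (O : Set M.Face), M.IsPlanar ∧ M.IsOuter O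

/-- `G` is a maximal outerplanar graph: joining any two non-adjacent vertices by an edge destroys
outerplanarity. -/
def IsMaximalOuterplanar {V : Type*} (G : SimpleGraph V) : Prop :=
  IsOuterplanar G ∧
    ∀ v w : V, v ≠ w → ¬ G.Adj v w → ¬ IsOuterplanar (G ⊔ SimpleGraph.edge v w)

/-- `G` has an outerplanar embedding whose weak dual is a (nonempty) path. -/
def HasPathWeakDual {V : Type*} (G : SimpleGraph V) : Prop :=
  ∃ (M : RotationSystem G) (O : Set M.Face), M.IsPlanar ∧ M.IsOuter O ∧
    ∃ k : ℕ, Nonempty (M.weakDual O ≃g SimpleGraph.pathGraph (k + 1))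

/-! ### Straight-line drawings -/

/-- A straight-line drawing of `G`: the vertices are distinct points of the plane, and the only
vertices met by (the closed line segment representing) an edge are its own endpoints. Edges may
cross. -/
structure Drawing {V : Type*} (G : SimpleGraph V) where
  pos : V → Plane
  pos_injective : Function.Injective pos
  eq_or_eq_of_mem : ∀ u v w : V, G.Adj v w → pos u ∈ segment ℝ (pos v) (pos w) → u = v ∨ u = w

namespace Drawing

variable {V : Type*} {G : SimpleGraph V}

/-- The closed line segment that represents an edge. -/
def edgeLine (D : Drawing G) : Sym2 V → Set Plane :=
  Sym2.lift ⟨fun v w => segment ℝ (D.pos v) (D.pos w), fun _ _ => segment_symm ℝ _ _⟩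

/-- A set of edges forms a line segment: the union of the edges is a line segment. -/
def FormsSegment (D : Drawing G) (S : Set (Sym2 V)) : Prop :=
  S ⊆ G.edgeSet ∧ ∃ a b : Plane, a ≠ b ∧ ⋃ e ∈ S, D.edgeLine e = segment ℝ a b

/-- The segments of a drawing: the maximal sets of edges that form a line segment. -/
def segments (D : Drawing G) : Set (Set (Sym2 V)) :=
  {S | Maximal D.FormsSegment S}

/-- The number of segments of a drawing (of a finite graph). -/
noncomputable def numSegments (D : Drawing G) : ℕ :=
  D.segments.ncard

/-- A drawing is plane if no two edges meet at a point other than a common endpoint. -/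
def IsPlane (D : Drawing G) : Prop :=
  ∀ e ∈ G.edgeSet, ∀ f ∈ G.edgeSet, e ≠ f → ∀ x ∈ D.edgeLine e ∩ D.edgeLine f,
    ∃ v : V, v ∈ e ∧ v ∈ f ∧ x = D.pos v

/-- The points of the plane covered by the drawing. -/
def carrier (D : Drawing G) : Set Plane :=
  Set.range D.pos ∪ ⋃ e ∈ G.edgeSet, D.edgeLine e

/-- The outer face: the points of the unbounded connected component of the complement of the
drawing. -/
def outerFace (D : Drawing G) : Set Plane :=
  {x | x ∈ D.carrierᶜ ∧ ¬ Bornology.IsBounded (connectedComponentIn D.carrierᶜ x)}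

/-- The points of the internal faces, that is, of the bounded connected components of the
complement of the drawing. -/
def internalFaces (D : Drawing G) : Set Plane :=
  {x | x ∈ D.carrierᶜ ∧ Bornology.IsBounded (connectedComponentIn D.carrierᶜ x)}

/-- An outerplanar drawing: a plane drawing with all the vertices on the boundary of the outer
face. -/
def IsOuterplanar (D : Drawing G) : Prop :=
  D.IsPlane ∧ ∀ v : V, D.pos v ∈ frontier D.outerFace

/-- A drawing is star-shaped if there is a point `p` in some internal face such that every ray
from `p` meets the boundary of the outer face in exactly one point. -/
def IsStarShaped (D : Drawing G) : Prop :=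
  ∃ p ∈ D.internalFaces, ∀ u : Plane, u ≠ 0 →
    ∃! x : Plane, (∃ t : ℝ, 0 ≤ t ∧ x = p + t • u) ∧ x ∈ frontier D.outerFace

end Drawing

/-! Upper bound. A maximal outerplanar graph with at least three vertices is a triangulated polygon,
so it arises from a triangle by gluing triangles to boundary edges (`Ear`). The drawing is built
along this decomposition, star-shaped around the origin, with the following invariant for each
boundary edge `x y`: at one of its ends, say `x`, some edge `z x` prolonged beyond `x` enters the
cone spanned by `x` and `y` outside the polygon. The apex `v` of the next triangle goes on that
prolongation, close to `x`. Then `x v` continues the segment of `z x` and only `y v` starts a new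
segment, while at `v` the two new sides provide the invariant for each other. Three segments for the
triangle and one for every further vertex make `n` (`StarPolygon.glue`, `Ear.exists_starPolygon`).
The polygon is recorded by its gauge `g`: its boundary is `g = 1`, the outer face is `1 < g`, and
every ray from the origin meets the level set `g = 1` once.

That maximality forces a triangulated polygon is proved combinatorially. In an abstract map whose
outer face visits all vertices, a face that is too long, or a vertex that the outer face repeats,
leaves room for one more edge (`OuterMap.exists_insert`). Euler's formula bounds the number of edges
by `2n - 3`, so repeated insertion ends in a full map, with triangular internal faces and no
repetition on the outer face. Growing a set of triangles one by one, Euler's formula again forces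
each new triangle to bring a new vertex (`IsFull.apex_notMem`); hence full maps are ear
decompositions and are simple, and so is every map that can be completed to one. If the map of a
maximal outerplanar graph were not full, the inserted edge would contradict maximality.
Connectedness of that graph holds because an edge between two components never destroys
outerplanarity (`isOuterplanar_sup_edge`).

Lower bound. The witness is the square of a path, a strip of triangles with `2n - 3` edges. Direct
all edges upwards along a generic linear functional. A segment contains at most one edge into whose
tail no other edge runs straight, so the number of segments is at least the number of such initial
edges (`Drawing.ncard_initialEdge_le`). Every other edge yields a vertex at which two edges continue
each other, a straight pass; the ends of a pass are not adjacent, so their indices differ by three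
or four. An induction along the path shows that there are at most `n - 3` passes (`sum_isPass_le`):
two can be added in one step, but a tight count so far excludes this. Hence at least `(2n - 3) - (n
- 3) = n` edges are initial. -/

open Equiv

/-! ### Counting the cycles of a permutation -/

section Cycles

variable {X Y : Type*}

/-- The number of cycles of a permutation, fixed points included. -/
noncomputable def numCycles (σ : Perm X) : ℕ :=
  Nat.card (Quotient (Perm.SameCycle.setoid σ))

/-- `SameCycle` is the least equivalence relation relating every point to its image. All transports
of cycles from one permutation to another go through this. -/
theorem sameCycle_le_setoid {σ : Perm X} (s : Setoid X) (h : ∀ x, s x (σ x)) {x y : X}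
    (hxy : σ.SameCycle x y) : s x y := by
  have key : ∀ (n : ℕ) (x : X), s x ((σ ^ n) x) := by
    intro n
    induction n with
    | zero => intro x; exact s.refl x
    | succ n ih =>
      intro x
      rw [pow_succ', Perm.mul_apply]
      exact s.trans (ih x) (h _)
  obtain ⟨i, rfl⟩ := hxy
  rcases i with n | n
  · exact key n x
  -- A negative power is undone by walking forward from its value back to `x`.
  · have := key (n + 1) ((σ ^ (Int.negSucc n)) x)
    rw [zpow_negSucc, ← Perm.mul_apply, mul_inv_cancel, Perm.one_apply] at this
    rw [zpow_negSucc]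
    exact s.symm this

theorem sameCycle_mono {σ τ : Perm X} (h : ∀ x, τ.SameCycle x (σ x)) {x y : X}
    (hxy : σ.SameCycle x y) : τ.SameCycle x y :=
  sameCycle_le_setoid (Perm.SameCycle.setoid τ) h hxy

theorem sameCycle_map {σ : Perm X} {τ : Perm Y} (f : X → Y) (h : ∀ x, τ.SameCycle (f x) (f (σ x)))
    {x y : X} (hxy : σ.SameCycle x y) : τ.SameCycle (f x) (f y) :=
  sameCycle_le_setoid ((Perm.SameCycle.setoid τ).comap f) h hxy

theorem apply_eq_of_sameCycle {σ : Perm X} (f : X → Y) (h : ∀ x, f (σ x) = f x) {x y : X}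
    (hxy : σ.SameCycle x y) : f x = f y :=
  sameCycle_le_setoid (Setoid.ker f) (fun x => (h x).symm) hxy

/-- On a finite set nonnegative powers exhaust a cycle, so forward invariance is enough. This
replaces inductions along facial walks and rotations. -/
theorem mem_of_sameCycle [Finite X] {σ : Perm X} {S : Set X} (h : ∀ x ∈ S, σ x ∈ S) {x y : X}
    (hx : x ∈ S) (hxy : σ.SameCycle x y) : y ∈ S := by
  obtain ⟨n, -, rfl⟩ := hxy.exists_pow_eq'
  induction n with
  | zero => exact hx
  | succ n ih =>
    rw [pow_succ', Perm.mul_apply]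
    exact h _ (ih ⟨n, by simp⟩)

theorem numCycles_eq_card {σ : Perm X} (f : X → Y) (hf : Function.Surjective f)
    (h : ∀ x, f (σ x) = f x) (h' : ∀ x y, f x = f y → σ.SameCycle x y) :
    numCycles σ = Nat.card Y := by
  refine Nat.card_eq_of_bijective
    (Quotient.lift (s := Perm.SameCycle.setoid σ) f fun _ _ => apply_eq_of_sameCycle f h) ⟨?_, ?_⟩
  · intro p q
    induction p using Quotient.inductionOn
    induction q using Quotient.inductionOn
    intro hpq
    exact Quotient.sound (h' _ _ hpq)
  · intro y
    obtain ⟨x, rfl⟩ := hf y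
    exact ⟨Quotient.mk _ x, rfl⟩

theorem numCycles_sumCongr_one [Finite X] [Finite Y] (σ : Perm X) :
    numCycles (Perm.sumCongr σ (1 : Perm Y)) = numCycles σ + Nat.card Y := by
  rw [numCycles_eq_card (Y := Quotient (Perm.SameCycle.setoid σ) ⊕ Y)
    (Sum.map (Quotient.mk _) id), Nat.card_sum]
  · rfl
  · exact Function.Surjective.sumMap Quotient.mk_surjective Function.surjective_id
  · rintro (x | y)
    · exact congrArg Sum.inl (Quotient.sound (Perm.SameCycle.symm ⟨1, rfl⟩))
    · rfl
  · rintro (x | x) (y | y) h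
    · have : σ.SameCycle x y := Quotient.exact (Sum.inl.inj h)
      exact sameCycle_map Sum.inl (fun x => ⟨1, rfl⟩) this
    · cases h
    · cases h
    · cases h; exact Perm.SameCycle.refl _ _

theorem numCycles_conj {σ : Perm X} {τ : Perm Y} (e : X ≃ Y) (h : ∀ x, e (σ x) = τ (e x)) :
    numCycles σ = numCycles τ := by
  refine numCycles_eq_card (fun x => Quotient.mk (Perm.SameCycle.setoid τ) (e x)) ?_ ?_ ?_
  · exact Quotient.mk_surjective.comp e.surjective
  · intro x
    rw [h]
    exact Quotient.sound (Perm.SameCycle.symm ⟨1, rfl⟩)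
  · intro x y hxy
    have : τ.SameCycle (e x) (e y) := Quotient.exact hxy
    have := sameCycle_map (τ := σ) e.symm (fun y => ⟨1, by
      apply e.injective; simp [h]⟩) this
    simpa using this

/-- The equivalence relation obtained from `r` by merging the classes of `a` and `b`. -/
def mergeSetoid (r : Setoid X) (a b : X) : Setoid X where
  r x y := r x y ∨ ((r x a ∨ r x b) ∧ (r y a ∨ r y b))
  iseqv := by
    refine ⟨fun x => Or.inl (r.refl x), ?_, ?_⟩
    · rintro x y (h | ⟨h, h'⟩)
      · exact Or.inl (r.symm h)
      · exact Or.inr ⟨h', h⟩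
    · rintro x y z (h | ⟨h, h'⟩) (k | ⟨k, k'⟩)
      · exact Or.inl (r.trans h k)
      · exact Or.inr ⟨k.imp (r.trans h) (r.trans h), k'⟩
      · exact Or.inr ⟨h, h'.imp (r.trans (r.symm k)) (r.trans (r.symm k))⟩
      · exact Or.inr ⟨h, k'⟩

/-- The classes of `r` other than that of `b` are in bijection with the classes of `s`, the class of
`a` standing for the merged one. -/
theorem card_quotient_merge [Finite X] {r s : Setoid X} {a b : X} (hab : ¬ r a b)
    (h : ∀ x y, s x y ↔ r x y ∨ ((r x a ∨ r x b) ∧ (r y a ∨ r y b))) :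
    Nat.card (Quotient r) = Nat.card (Quotient s) + 1 := by
  classical
  have hle : ∀ x y, r x y → s x y := fun x y hxy => (h x y).2 (Or.inl hxy)
  have hbij : Function.Bijective (fun q : {q : Quotient r // q ≠ Quotient.mk r b} =>
      Quotient.map' (s₂ := s) id hle q.1) := by
    constructor
    · rintro ⟨p, hp⟩ ⟨q, hq⟩
      induction p using Quotient.inductionOn with | _ x
      induction q using Quotient.inductionOn with | _ y
      intro hpq
      have hx : ¬ r x b := fun hx => hp (Quotient.sound hx)
      have hy : ¬ r y b := fun hy => hq (Quotient.sound hy)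
      have hs : s x y := Quotient.exact hpq
      refine Subtype.ext (Quotient.sound ?_)
      change r x y
      rcases (h x y).1 hs with h1 | ⟨h1, h2⟩
      · exact h1
      · exact r.trans (h1.resolve_right hx) (r.symm (h2.resolve_right hy))
    · intro q
      induction q using Quotient.inductionOn with | _ x
      by_cases hx : r x b
      · exact ⟨⟨Quotient.mk r a, fun hq => hab (Quotient.exact hq)⟩,
          Quotient.sound ((h a x).2 (Or.inr ⟨Or.inl (r.refl a), Or.inr hx⟩))⟩
      · exact ⟨⟨Quotient.mk r x, fun hq => hx (Quotient.exact hq)⟩, rfl⟩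
  rw [← Nat.card_eq_of_bijective _ hbij]
  have := Fintype.ofFinite (Quotient r)
  rw [Nat.card_eq_fintype_card, Nat.card_eq_fintype_card, Fintype.card_subtype_compl,
    Fintype.card_subtype_eq]
  have : 0 < Fintype.card (Quotient r) := Fintype.card_pos_iff.2 ⟨Quotient.mk r b⟩
  omega

theorem not_sameCycle_of_fixed [Finite X] {σ : Perm X} {a b : X} (hb : σ b = b) (hne : a ≠ b) :
    ¬ σ.SameCycle a b := by
  intro h
  exact hne (mem_of_sameCycle (S := {b}) (by rintro x rfl; exact hb) rfl h.symm)

variable [DecidableEq X]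

/-- The new permutation sends `a` to `σ b` and from there follows `σ` along the cycle of `b`, which
avoids `a`, until it reaches `b`. -/
theorem sameCycle_mul_swap_self [Finite X] {σ : Perm X} {a b : X} (hab : ¬ σ.SameCycle a b) :
    (σ * swap a b).SameCycle a b := by
  by_contra hcon
  have ha : ∀ x, σ.SameCycle b x → x ≠ a := by
    rintro x hx rfl; exact hab hx.symm
  have hb : b ∈ {x | σ.SameCycle b x ∧ (σ * swap a b).SameCycle a x} := by
    refine mem_of_sameCycle (σ := σ) (x := σ b) ?_ ?_ (Perm.SameCycle.symm ⟨1, rfl⟩)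
    · rintro x ⟨h1, h2⟩
      refine ⟨h1.trans ⟨1, rfl⟩, h2.trans ⟨1, ?_⟩⟩
      rw [zpow_one, Perm.mul_apply, swap_apply_of_ne_of_ne (ha x h1)]
      rintro rfl
      exact hcon h2
    · exact ⟨⟨1, rfl⟩, ⟨1, by simp⟩⟩
  exact hcon hb.2

theorem sameCycle_mul_swap_iff [Finite X] {σ : Perm X} {a b : X} (hab : ¬ σ.SameCycle a b)
    (x y : X) : (σ * swap a b).SameCycle x y ↔ σ.SameCycle x y ∨
      ((σ.SameCycle x a ∨ σ.SameCycle x b) ∧ (σ.SameCycle y a ∨ σ.SameCycle y b)) := by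
  have key := sameCycle_mul_swap_self hab
  have hstep : ∀ x, (σ * swap a b).SameCycle x (σ x) := by
    intro x
    by_cases hxa : x = a
    · subst hxa
      exact key.trans ⟨1, by simp⟩
    · by_cases hxb : x = b
      · subst hxb
        exact key.symm.trans ⟨1, by simp⟩
      · exact ⟨1, by simp [swap_apply_of_ne_of_ne hxa hxb]⟩
  constructor
  · intro h
    refine sameCycle_le_setoid (mergeSetoid (Perm.SameCycle.setoid σ) a b) ?_ h
    intro x
    by_cases hxa : x = a
    · subst hxa
      exact Or.inr ⟨Or.inl (Perm.SameCycle.refl _ _), Or.inr (by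
        rw [Perm.mul_apply, swap_apply_left]; exact Perm.SameCycle.symm ⟨1, rfl⟩)⟩
    · by_cases hxb : x = b
      · subst hxb
        exact Or.inr ⟨Or.inr (Perm.SameCycle.refl _ _), Or.inl (by
          rw [Perm.mul_apply, swap_apply_right]; exact Perm.SameCycle.symm ⟨1, rfl⟩)⟩
      · exact Or.inl ⟨1, by simp [swap_apply_of_ne_of_ne hxa hxb]⟩
  · rintro (h | ⟨h, h'⟩)
    · exact sameCycle_mono hstep h
    · have h1 : (σ * swap a b).SameCycle x a :=
        h.elim (sameCycle_mono hstep) fun h => (sameCycle_mono hstep h).trans key.symm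
      have h2 : (σ * swap a b).SameCycle y a :=
        h'.elim (sameCycle_mono hstep) fun h => (sameCycle_mono hstep h).trans key.symm
      exact h1.trans h2.symm

theorem numCycles_merge [Finite X] {σ : Perm X} {a b : X} (hab : ¬ σ.SameCycle a b) :
    numCycles σ = numCycles (σ * swap a b) + 1 :=
  card_quotient_merge (r := Perm.SameCycle.setoid σ) (s := Perm.SameCycle.setoid (σ * swap a b))
    (a := a) (b := b) hab (sameCycle_mul_swap_iff hab)

/-- With `k` minimal such that `σ ^ k` takes `b` to `a`, the arc from `σ b` to `a` is closed under
the new permutation, which sends `a` to `σ b`; this arc misses `b`. -/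
theorem not_sameCycle_mul_swap [Finite X] {σ : Perm X} {a b : X} (hne : a ≠ b)
    (hab : σ.SameCycle b a) : ¬ (σ * swap a b).SameCycle a b := by
  obtain ⟨n, -, hn⟩ := hab.exists_pow_eq'
  have hex : ∃ n, (σ ^ n) b = a := ⟨n, hn⟩
  classical
  let k := Nat.find hex
  have hk : (σ ^ k) b = a := Nat.find_spec hex
  have hmin : ∀ j < k, (σ ^ j) b ≠ a := fun j hj => Nat.find_min hex hj
  have hk0 : 0 < k := by
    rcases Nat.eq_zero_or_pos k with h | h
    · rw [h] at hk; exact absurd hk.symm hne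
    · exact h
  have hnb : ∀ j, 0 < j → j ≤ k → (σ ^ j) b ≠ b := by
    intro j hj hjk hb
    refine hmin (k - j) (by omega) ?_
    have : (σ ^ (k - j)) ((σ ^ j) b) = a := by
      rw [← Perm.mul_apply, ← pow_add, Nat.sub_add_cancel hjk, hk]
    rwa [hb] at this
  intro hcon
  obtain ⟨j, hj, hjk, h⟩ : b ∈ {x | ∃ j, 0 < j ∧ j ≤ k ∧ (σ ^ j) b = x} := by
    refine mem_of_sameCycle ?_ ⟨k, hk0, le_rfl, hk⟩ hcon
    rintro x ⟨j, hj, hjk, rfl⟩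
    rcases hjk.eq_or_lt with rfl | hlt
    · exact ⟨1, one_pos, hk0, by rw [hk]; simp⟩
    · refine ⟨j + 1, by omega, hlt, ?_⟩
      rw [Perm.mul_apply, swap_apply_of_ne_of_ne (hmin j hlt) (hnb j hj hjk), pow_succ',
        Perm.mul_apply]
  exact hnb j hj hjk h

theorem numCycles_split [Finite X] {σ : Perm X} {a b : X} (hne : a ≠ b)
    (hab : σ.SameCycle a b) : numCycles (σ * swap a b) = numCycles σ + 1 := by
  have := numCycles_merge (not_sameCycle_mul_swap hne hab.symm)
  rwa [mul_assoc, swap_mul_self, mul_one] at this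

end Cycles

/-! ### Outerplanar maps on an abstract set of darts -/

/-- A connected planar map with vertex set `V` and dart set `X`, loops and parallel edges allowed,
given by its face permutation `φ`, the reversal `α` of darts and the tail `vt` of each dart; the
face through the dart `o` visits all the vertices, and every face has length at least three. -/
structure OuterMap (V X : Type*) where
  φ : Perm X
  α : Perm X
  vt : X → V
  o : X
  α_α : ∀ x, α (α x) = x
  α_ne : ∀ x, α x ≠ x
  vt_rot : ∀ x, vt (φ (α x)) = vt x
  rot_trans : ∀ x y, vt x = vt y → (φ * α).SameCycle x y
  conn : ∀ A : Set V, A.Nonempty → (∀ x, vt x ∈ A → vt (α x) ∈ A) → A = Set.univ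
  outer : ∀ v, ∃ x, φ.SameCycle o x ∧ vt x = v
  euler : 2 * (Nat.card V + numCycles φ) = Nat.card X + 4
  face1 : ∀ x, φ x ≠ x
  face2 : ∀ x, φ (φ x) ≠ x

namespace OuterMap

variable {V X : Type*} (M : OuterMap V X)

/-- The dart `x` is on the outer face. -/
def Outer (x : X) : Prop := M.φ.SameCycle M.o x

theorem vt_φ (x : X) : M.vt (M.φ x) = M.vt (M.α x) := by
  have := M.vt_rot (M.α x)
  rwa [M.α_α] at this

theorem outer_φ {x : X} : M.Outer (M.φ x) ↔ M.Outer x :=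
  Perm.sameCycle_apply_right

/-- All the internal faces are triangles, and the outer face visits every vertex once. -/
structure IsFull : Prop where
  tri : ∀ x, ¬ M.Outer x → M.φ (M.φ (M.φ x)) = x
  inj : ∀ x y, M.Outer x → M.Outer y → M.vt x = M.vt y → x = y

/-- No loops and no parallel edges. -/
structure IsSimple : Prop where
  ne : ∀ x, M.vt x ≠ M.vt (M.α x)
  inj : ∀ x y, M.vt x = M.vt y → M.vt (M.α x) = M.vt (M.α y) → x = y

/-- The face through a dart. -/
def face (x : X) : Quotient (Perm.SameCycle.setoid M.φ) := Quotient.mk _ x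

theorem face_eq {x y : X} : M.face x = M.face y ↔ M.φ.SameCycle x y :=
  ⟨fun h => Quotient.exact h, fun h => Quotient.sound h⟩

theorem face_φ (x : X) : M.face (M.φ x) = M.face x :=
  M.face_eq.2 (Perm.SameCycle.symm ⟨1, rfl⟩)

theorem face_eq_outer {x : X} : M.face x = M.face M.o ↔ M.Outer x := by
  rw [face_eq, Perm.sameCycle_comm]; rfl

section Card

variable [Fintype X]

open Classical in
theorem card_outer_ge [Fintype V] : Fintype.card V ≤ (Finset.univ.filter fun x => M.face x = M.face M.o).card := by
  rw [← Finset.card_univ]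
  refine (Finset.card_le_card ?_).trans
    (Finset.card_image_le (s := Finset.univ.filter fun x => M.face x = M.face M.o) (f := M.vt))
  intro v _
  obtain ⟨x, hx, rfl⟩ := M.outer v
  exact Finset.mem_image_of_mem _ (by simpa [face_eq_outer, Outer] using hx)

open Classical in
theorem card_face_ge (q : Quotient (Perm.SameCycle.setoid M.φ)) :
    3 ≤ (Finset.univ.filter fun x => M.face x = q).card := by
  induction q using Quotient.inductionOn with | _ x
  have h : ({x, M.φ x, M.φ (M.φ x)} : Finset X) ⊆ Finset.univ.filter fun y => M.face y = M.face x := by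
    intro y hy
    simp only [Finset.mem_insert, Finset.mem_singleton] at hy
    rcases hy with rfl | rfl | rfl <;> simp [face_φ]
  refine le_trans ?_ (Finset.card_le_card h)
  rw [Finset.card_insert_of_notMem, Finset.card_insert_of_notMem, Finset.card_singleton]
  · simpa using (M.face1 (M.φ x)).symm
  · simpa using ⟨(M.face1 x).symm, (M.face2 x).symm⟩

open Classical in
theorem numCycles_eq : numCycles M.φ = Fintype.card (Quotient (Perm.SameCycle.setoid M.φ)) :=
  Nat.card_eq_fintype_card

open Classical in
theorem card_darts : Fintype.card X = (Finset.univ.filter fun x => M.face x = M.face M.o).card +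
    ∑ q ∈ Finset.univ.erase (M.face M.o), (Finset.univ.filter fun x => M.face x = q).card := by
  rw [Finset.add_sum_erase _ (fun q => (Finset.univ.filter fun x => M.face x = q).card)
    (Finset.mem_univ _), ← Finset.card_univ]
  exact Finset.card_eq_sum_card_fiberwise fun x _ => Finset.mem_univ _

/-- The outer face has length at least `|V|` and every other face at least three; Euler's formula
turns this into the bound `2|V| - 3` on the number of edges. `X` counts darts, two for each edge. -/
theorem card_le [Fintype V] (M : OuterMap V X) : Fintype.card X + 6 ≤ 4 * Fintype.card V := by
  classical
  have h1 := M.card_darts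
  have h2 := M.card_outer_ge
  have h3 : (Finset.univ.erase (M.face M.o)).card * 3 ≤ ∑ q ∈ Finset.univ.erase (M.face M.o),
      (Finset.univ.filter fun x => M.face x = q).card :=
    Finset.card_nsmul_le_sum _ _ _ fun q _ => M.card_face_ge q
  rw [Finset.card_erase_of_mem (Finset.mem_univ _), Finset.card_univ] at h3
  have h4 := M.euler
  rw [numCycles_eq, Nat.card_eq_fintype_card, Nat.card_eq_fintype_card] at h4
  omega

variable {M}

/-- For a full map the estimates behind `card_le` are equalities, so Euler's formula determines the
number of faces. -/
theorem IsFull.numCycles [Fintype V] (h : M.IsFull) : numCycles M.φ + 1 = Fintype.card V := by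
  classical
  have h1 := M.card_darts
  have h2 : (Finset.univ.filter fun x => M.face x = M.face M.o).card ≤ Fintype.card V := by
    rw [← Finset.card_univ (α := V)]
    refine Finset.card_le_card_of_injOn M.vt (fun _ _ => Finset.mem_univ _) ?_
    intro x hx y hy hxy
    simp only [Finset.coe_filter, Finset.mem_univ, true_and, Set.mem_ofPred_eq,
      face_eq_outer] at hx hy
    exact h.inj x y hx hy hxy
  have h3 : ∑ q ∈ Finset.univ.erase (M.face M.o), (Finset.univ.filter fun x => M.face x = q).card
      ≤ (Finset.univ.erase (M.face M.o)).card * 3 := by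
    refine Finset.sum_le_card_nsmul _ _ _ fun q hq => ?_
    induction q using Quotient.inductionOn with | _ x
    have hx : ¬ M.Outer x := fun hx => (Finset.mem_erase.1 hq).1 (M.face_eq_outer.2 hx)
    have : (Finset.univ.filter fun y => M.face y = M.face x) ⊆ {x, M.φ x, M.φ (M.φ x)} := by
      intro y hy
      have hy : M.φ.SameCycle x y := (M.face_eq.1 (Finset.mem_filter.1 hy).2).symm
      refine mem_of_sameCycle (S := {z | z ∈ ({x, M.φ x, M.φ (M.φ x)} : Finset X)}) ?_ (by simp) hy
      intro z hz
      simp only [Finset.mem_insert, Finset.mem_singleton, Set.mem_ofPred_eq] at hz ⊢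
      rcases hz with rfl | rfl | rfl
      · simp
      · simp
      · exact Or.inl (h.tri _ hx)
    exact (Finset.card_le_card this).trans Finset.card_le_three
  rw [Finset.card_erase_of_mem (Finset.mem_univ _), Finset.card_univ] at h3
  have h4 := M.euler
  have h5 : 0 < Fintype.card (Quotient (Perm.SameCycle.setoid M.φ)) :=
    Fintype.card_pos_iff.2 ⟨M.face M.o⟩
  have h6 := M.card_outer_ge
  have h7 : (Finset.univ.erase (M.face M.o)).card * 3 ≤ ∑ q ∈ Finset.univ.erase (M.face M.o),
      (Finset.univ.filter fun x => M.face x = q).card :=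
    Finset.card_nsmul_le_sum _ _ _ fun q _ => M.card_face_ge q
  rw [Finset.card_erase_of_mem (Finset.mem_univ _), Finset.card_univ] at h7
  rw [numCycles_eq] at h4 ⊢
  rw [Nat.card_eq_fintype_card, Nat.card_eq_fintype_card] at h4
  omega

end Card

end OuterMap

/-! ### Inserting an edge into a map -/

section InsertEdge

variable {V X : Type*}

theorem sameCycle_sumCongr_one_iff {Y : Type*} {φ : Perm X} {x y : X} :
    (Perm.sumCongr φ (1 : Perm Y)).SameCycle (.inl x) (.inl y) ↔ φ.SameCycle x y := by
  refine ⟨fun h => ?_, sameCycle_map Sum.inl fun x => ⟨1, rfl⟩⟩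
  have := sameCycle_map (τ := φ) (Sum.elim id fun _ => x) (by
    rintro (z | z)
    · exact ⟨1, rfl⟩
    · exact Perm.SameCycle.refl _ _) h
  exact this

/-- The reversal of darts after the insertion of the two darts of a new edge. -/
def insertRev (α : Perm X) : Perm (X ⊕ Bool) := Perm.sumCongr α (swap true false)

@[simp] theorem insertRev_inl (α : Perm X) (x : X) : insertRev α (.inl x) = .inl (α x) := rfl
@[simp] theorem insertRev_inr (α : Perm X) (t : Bool) : insertRev α (.inr t) = .inr (!t) := by
  cases t <;> rfl

/-- The tail of each dart after the insertion of an edge from `v` to `w`. -/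
def insertTail (vt : X → V) (v w : V) : X ⊕ Bool → V := Sum.elim vt fun t => if t then v else w

@[simp] theorem insertTail_inl (vt : X → V) (v w : V) (x : X) :
    insertTail vt v w (.inl x) = vt x := rfl
@[simp] theorem insertTail_true (vt : X → V) (v w : V) :
    insertTail vt v w (.inr true) = v := rfl
@[simp] theorem insertTail_false (vt : X → V) (v w : V) :
    insertTail vt v w (.inr false) = w := rfl

variable [DecidableEq X]

/-- The face permutation after the insertion of an edge that joins the corner that follows the
dart `a` to the corner that follows the dart `b`. -/
def insertFace (φ : Perm X) (a b : X) : Perm (X ⊕ Bool) :=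
  Perm.sumCongr φ 1 * swap (.inl a) (.inl b) * swap (.inl a) (.inr true) *
    swap (.inl b) (.inr false)

variable {φ α : Perm X} {a b : X}

theorem insertFace_left (hab : a ≠ b) : insertFace φ a b (.inl a) = .inr true := by
  simp [insertFace, swap_apply_def, hab]

theorem insertFace_right : insertFace φ a b (.inl b) = .inr false := by
  simp [insertFace, swap_apply_def]

theorem insertFace_true : insertFace φ a b (.inr true) = .inl (φ b) := by
  simp [insertFace, swap_apply_def]

theorem insertFace_false (hab : a ≠ b) : insertFace φ a b (.inr false) = .inl (φ a) := by
  simp [insertFace, swap_apply_def, hab.symm]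

theorem insertFace_inl {x : X} (ha : x ≠ a) (hb : x ≠ b) :
    insertFace φ a b (.inl x) = .inl (φ x) := by
  simp [insertFace, swap_apply_def, ha, hb]

/-- Seen from the vertices, each new dart is threaded into an existing rotation: `true` directly
after `α a` and `false` directly after `α b`. So the rotation cycles still correspond to the
vertices. -/
theorem insertFace_mul_insertRev (hα : ∀ x, α (α x) = x) (hab : a ≠ b) :
    insertFace φ a b * insertRev α = Perm.sumCongr (φ * α) (1 : Perm Bool) *
      swap (.inl (α a)) (.inr true) * swap (.inl (α b)) (.inr false) := by
  have hab' : α a ≠ α b := fun h => hab (α.injective h)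
  ext1 x
  rw [Perm.mul_apply]
  rcases x with x | t
  · rw [insertRev_inl]
    by_cases hb : x = α b
    · subst hb
      rw [hα, insertFace_right]
      simp [swap_apply_def]
    · have hb' : α x ≠ b := by rintro rfl; exact hb (hα x).symm
      by_cases ha : x = α a
      · subst ha
        rw [hα, insertFace_left hab]
        simp [swap_apply_def, hab']
      · have ha' : α x ≠ a := by rintro rfl; exact ha (hα x).symm
        rw [insertFace_inl ha' hb']
        simp [swap_apply_def, ha, hb]
  · rw [insertRev_inr]
    cases t
    · rw [Bool.not_false, insertFace_true]
      simp [swap_apply_def, hab'.symm, hα]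
    · rw [Bool.not_true, insertFace_false hab]
      simp [swap_apply_def, hα]

theorem vt_insert {vt : X → V} (hα : ∀ x, α (α x) = x) (hab : a ≠ b)
    (hvt : ∀ x, vt (φ (α x)) = vt x) (z : X ⊕ Bool) :
    insertTail vt (vt (α a)) (vt (α b)) (insertFace φ a b (insertRev α z)) =
      insertTail vt (vt (α a)) (vt (α b)) z := by
  have hvt' : ∀ x, vt (φ x) = vt (α x) := fun x => by rw [← hvt (α x), hα]
  rcases z with x | t
  · rw [insertRev_inl]
    by_cases ha : α x = a
    · rw [ha, insertFace_left hab, insertTail_true, ← ha, hα]; rfl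
    · by_cases hb : α x = b
      · rw [hb, insertFace_right, insertTail_false, ← hb, hα]; rfl
      · rw [insertFace_inl ha hb]
        exact hvt x
  · cases t
    · rw [insertRev_inr, Bool.not_false, insertFace_true]
      exact hvt' b
    · rw [insertRev_inr, Bool.not_true, insertFace_false hab]
      exact hvt' a

variable [Finite X]

theorem sameCycle_insert_fixed {Z : Type*} [Finite Z] [DecidableEq Z] {σ : Perm Z} {a z : Z}
    (hz : σ z = z) (haz : a ≠ z) {x y : Z} (h : σ.SameCycle x y) :
    (σ * swap a z).SameCycle x y :=
  (sameCycle_mul_swap_iff (not_sameCycle_of_fixed hz haz) x y).2 (Or.inl h)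

theorem numCycles_insert_fixed {Z : Type*} [Finite Z] [DecidableEq Z] {σ : Perm Z} {a z : Z}
    (hz : σ z = z) (haz : a ≠ z) : numCycles σ = numCycles (σ * swap a z) + 1 :=
  numCycles_merge (not_sameCycle_of_fixed hz haz)

theorem sameCycle_two_insert (σ : Perm X) (a b : X) {x y : X} (h : σ.SameCycle x y) :
    (Perm.sumCongr σ (1 : Perm Bool) * swap (.inl a) (.inr true) *
      swap (.inl b) (.inr false) : Perm (X ⊕ Bool)).SameCycle (.inl x) (.inl y) := by
  refine sameCycle_insert_fixed ?_ (by simp) (sameCycle_insert_fixed rfl (by simp) ?_)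
  · rw [Perm.mul_apply, swap_apply_of_ne_of_ne (by simp) (by simp)]
    rfl
  · exact sameCycle_map Sum.inl (fun x => ⟨1, rfl⟩) h

theorem numCycles_two_insert {σ : Perm (X ⊕ Bool)} (h : ∀ t, σ (.inr t) = .inr t) (a b : X) :
    numCycles σ = numCycles (σ * swap (.inl a) (.inr true) * swap (.inl b) (.inr false)) + 2 := by
  have h1 := numCycles_insert_fixed (h true) (a := .inl a) (by simp)
  have h2 := numCycles_insert_fixed (σ := σ * swap (.inl a) (.inr true)) (a := .inl b)
    (z := .inr false) (by rw [Perm.mul_apply, swap_apply_of_ne_of_ne (by simp) (by simp), h])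
    (by simp)
  omega

/-- The factor `swap (.inl a) (.inl b)` of `insertFace` cuts the common face in two; the other two
swaps only absorb the new darts, which were fixed points. -/
theorem numCycles_insertFace_of_sameCycle (hab : a ≠ b) (h : φ.SameCycle a b) :
    numCycles (insertFace φ a b) = numCycles φ + 1 := by
  have h1 := numCycles_two_insert
    (σ := Perm.sumCongr φ (1 : Perm Bool) * swap (.inl a) (.inl b)) (by
      intro t
      rw [Perm.mul_apply, swap_apply_of_ne_of_ne (by simp) (by simp)]
      rfl) a b
  have h2 := numCycles_split (σ := Perm.sumCongr φ (1 : Perm Bool)) (a := .inl a) (b := .inl b)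
    (by simpa using hab) (sameCycle_map Sum.inl (fun x => ⟨1, rfl⟩) h)
  have h3 := numCycles_sumCongr_one (Y := Bool) φ
  rw [Nat.card_eq_fintype_card, Fintype.card_bool] at h3
  have h4 : numCycles (insertFace φ a b) = numCycles (Perm.sumCongr φ (1 : Perm Bool) *
    swap (.inl a) (.inl b) * swap (.inl a) (.inr true) * swap (.inl b) (.inr false)) := rfl
  omega

theorem numCycles_insertFace_of_not_sameCycle (h : ¬ φ.SameCycle a b) :
    numCycles (insertFace φ a b) + 1 = numCycles φ := by
  have h1 := numCycles_two_insert
    (σ := Perm.sumCongr φ (1 : Perm Bool) * swap (.inl a) (.inl b)) (by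
      intro t
      rw [Perm.mul_apply, swap_apply_of_ne_of_ne (by simp) (by simp)]
      rfl) a b
  have h2 := numCycles_merge (σ := Perm.sumCongr φ (1 : Perm Bool)) (a := .inl a) (b := .inl b)
    (by rwa [sameCycle_sumCongr_one_iff])
  have h3 := numCycles_sumCongr_one (Y := Bool) φ
  rw [Nat.card_eq_fintype_card, Fintype.card_bool] at h3
  have h4 : numCycles (insertFace φ a b) = numCycles (Perm.sumCongr φ (1 : Perm Bool) *
    swap (.inl a) (.inl b) * swap (.inl a) (.inr true) * swap (.inl b) (.inr false)) := rfl
  omega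

theorem sameCycle_insertFace (hab : ¬ φ.SameCycle a b) {x y : X} (h : φ.SameCycle x y) :
    (insertFace φ a b).SameCycle (.inl x) (.inl y) := by
  have h' : ¬ (Perm.sumCongr φ (1 : Perm Bool)).SameCycle (.inl a) (.inl b) := by
    rwa [sameCycle_sumCongr_one_iff]
  refine sameCycle_insert_fixed ?_ (by simp) (sameCycle_insert_fixed ?_ (by simp) ?_)
  · rw [Perm.mul_apply, swap_apply_of_ne_of_ne (by simp) (by simp), Perm.mul_apply,
      swap_apply_of_ne_of_ne (by simp) (by simp)]
    rfl
  · rw [Perm.mul_apply, swap_apply_of_ne_of_ne (by simp) (by simp)]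
    rfl
  · exact (sameCycle_mul_swap_iff h' _ _).2 (Or.inl (sameCycle_sumCongr_one_iff.2 h))

theorem rot_insert_trans {vt : X → V} (hα : ∀ x, α (α x) = x) (hab : a ≠ b)
    (hrot : ∀ x y, vt x = vt y → (φ * α).SameCycle x y) (z z' : X ⊕ Bool)
    (h : insertTail vt (vt (α a)) (vt (α b)) z = insertTail vt (vt (α a)) (vt (α b)) z') :
    (insertFace φ a b * insertRev α).SameCycle z z' := by
  have hstep : ∀ x y, vt x = vt y →
      (insertFace φ a b * insertRev α).SameCycle (.inl x) (.inl y) := by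
    intro x y hxy
    rw [insertFace_mul_insertRev hα hab]
    exact sameCycle_two_insert _ _ _ (hrot x y hxy)
  have hnew : ∀ z : X ⊕ Bool, ∃ x, insertTail vt (vt (α a)) (vt (α b)) z = vt x ∧
      (insertFace φ a b * insertRev α).SameCycle z (.inl x) := by
    rintro (x | t)
    · exact ⟨x, rfl, Perm.SameCycle.refl _ _⟩
    · cases t
      · refine ⟨α b, rfl, Perm.SameCycle.symm ⟨1, ?_⟩⟩
        rw [zpow_one, Perm.mul_apply, insertRev_inl, hα, insertFace_right]
      · refine ⟨α a, rfl, Perm.SameCycle.symm ⟨1, ?_⟩⟩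
        rw [zpow_one, Perm.mul_apply, insertRev_inl, hα, insertFace_left hab]
  obtain ⟨x, hx, hzx⟩ := hnew z
  obtain ⟨y, hy, hzy⟩ := hnew z'
  exact (hzx.trans (hstep x y (by rw [← hx, h, hy]))).trans hzy.symm

end InsertEdge

/-! ### Completing a map by edges that cut off triangles -/

namespace OuterMap

variable {V X : Type*}

/-- The edge to be inserted cuts off a triangle consisting of `φ y`, `φ (φ y)` and a new dart. This
hides the tail of `φ (φ y)` from the rest of the face, so on the outer face that vertex must be
visited a second time. If no `y` qualifies, the internal faces are triangles and the outer face
repeats no vertex. -/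
theorem exists_insert_place (M : OuterMap V X) [Fintype V] [Finite X] (hV : 3 ≤ Fintype.card V)
    (h : ¬ M.IsFull) : ∃ y, M.φ (M.φ (M.φ y)) ≠ y ∧
      (M.Outer y → ∃ z, M.Outer z ∧ z ≠ M.φ (M.φ y) ∧ M.vt z = M.vt (M.φ (M.φ y))) := by
  by_contra! hcon
  -- An outer face of length three that reaches at least three vertices reaches each of them once.
  have hout : ∀ y, M.Outer y → M.φ (M.φ (M.φ y)) = y → ∀ z z', M.Outer z → M.Outer z' →
      M.vt z = M.vt z' → z = z' := by
    classical
    intro y hy hy3 z z' hz hz' hzz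
    by_contra hne
    have hmem : ∀ z, M.Outer z → z ∈ ({y, M.φ y, M.φ (M.φ y)} : Finset X) := by
      intro z hz
      refine mem_of_sameCycle (S := {z | z ∈ ({y, M.φ y, M.φ (M.φ y)} : Finset X)}) ?_ (by simp)
        (Perm.SameCycle.trans (Perm.SameCycle.symm hy) hz)
      intro z hz
      simp only [Finset.mem_insert, Finset.mem_singleton, Set.mem_ofPred_eq] at hz ⊢
      rcases hz with rfl | rfl | rfl
      · simp
      · simp
      · exact Or.inl hy3
    have hsub : (Finset.univ : Finset V) ⊆
        ((({y, M.φ y, M.φ (M.φ y)} : Finset X)).erase z).image M.vt := by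
      intro v _
      obtain ⟨x, hx, rfl⟩ := M.outer v
      by_cases hxz : x = z
      · subst hxz
        rw [hzz]
        exact Finset.mem_image_of_mem _ (Finset.mem_erase.2 ⟨fun h => hne h.symm, hmem _ hz'⟩)
      · exact Finset.mem_image_of_mem _ (Finset.mem_erase.2 ⟨hxz, hmem _ hx⟩)
    have h1 := (Finset.card_le_card hsub).trans Finset.card_image_le
    rw [Finset.card_erase_of_mem (hmem _ hz), Finset.card_univ] at h1
    have h2 : (({y, M.φ y, M.φ (M.φ y)} : Finset X)).card ≤ 3 := Finset.card_le_three
    omega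
  refine h ⟨fun x hx => ?_, fun x z hx hz hxz => ?_⟩
  · by_contra hne
    exact hx (hcon x hne).1
  · let y := M.φ.symm (M.φ.symm z)
    have hyz : M.φ (M.φ y) = z := by simp [y]
    have hy : M.Outer y := by rwa [← hyz, outer_φ, outer_φ] at hz
    by_cases h3 : M.φ (M.φ (M.φ y)) = y
    · exact hout y hy h3 x z hx hz hxz
    · by_contra hne
      refine (hcon y h3).2 x hx ?_ ?_
      · rwa [hyz]
      · rwa [hyz]

-- If the face of `y` is outer, what remains after cutting off the triangle becomes the outer face,
-- through `.inr false`. It loses only the darts `φ y` and `φ (φ y)`: the tail of the first is the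
-- tail of `.inr false`, and that of the second is still visited through `z`. Otherwise the outer
-- face does not change.
open Classical in
theorem outer_insert (M : OuterMap V X) [Finite X] {y : X} (h3 : M.φ (M.φ (M.φ y)) ≠ y)
    (hy : M.Outer y → ∃ z, M.Outer z ∧ z ≠ M.φ (M.φ y) ∧ M.vt z = M.vt (M.φ (M.φ y))) :
    ∃ o, ∀ v, ∃ x, (insertFace M.φ (M.φ (M.φ y)) y).SameCycle o x ∧
      insertTail M.vt (M.vt (M.α (M.φ (M.φ y)))) (M.vt (M.α y)) x = v := by
  set a := M.φ (M.φ y) with ha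
  have hay : a ≠ y := M.face2 y
  by_cases hout : M.Outer y
  · obtain ⟨z, hz, hza, hvt⟩ := hy hout
    refine ⟨.inr false, fun v => ?_⟩
    have key : ∀ x, M.Outer x → x ≠ a → x ≠ M.φ y →
        (insertFace M.φ a y).SameCycle (.inr false) (.inl x) := by
      intro x hx
      have hx' : x = a ∨ x = M.φ y ∨ (insertFace M.φ a y).SameCycle (.inr false) (.inl x) := by
        refine mem_of_sameCycle (σ := M.φ) (S := {x | x = a ∨ x = M.φ y ∨
          (insertFace M.φ a y).SameCycle (.inr false) (.inl x)}) ?_ (x := M.φ a) ?_ ?_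
        · rintro x (rfl | rfl | h)
          · exact Or.inr (Or.inr ⟨1, insertFace_false hay⟩)
          · exact Or.inl rfl
          · by_cases hxa : x = a
            · subst hxa
              exact Or.inr (Or.inr ⟨1, insertFace_false hay⟩)
            · by_cases hxy : x = y
              · subst hxy
                exact Or.inr (Or.inl rfl)
              · exact Or.inr (Or.inr (h.trans ⟨1, insertFace_inl hxa hxy⟩))
        · exact Or.inr (Or.inr ⟨1, insertFace_false hay⟩)
        · refine Perm.SameCycle.trans (Perm.SameCycle.symm ?_) hx
          rw [ha]
          exact M.outer_φ.2 (M.outer_φ.2 (M.outer_φ.2 hout))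
      intro h1 h2
      exact (hx'.resolve_left h1).resolve_left h2
    have main : ∀ x, M.Outer x → x ≠ a → ∃ z, (insertFace M.φ a y).SameCycle (.inr false) z ∧
        insertTail M.vt (M.vt (M.α a)) (M.vt (M.α y)) z = M.vt x := by
      intro x hx hxa
      by_cases hxy : x = M.φ y
      · exact ⟨.inr false, Perm.SameCycle.refl _ _, by rw [hxy, vt_φ]; rfl⟩
      · exact ⟨.inl x, key x hx hxa hxy, rfl⟩
    obtain ⟨x, hx, rfl⟩ := M.outer v
    by_cases hxa : x = a
    · rw [hxa, ← hvt]
      exact main z hz hza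
    · exact main x hx hxa
  · refine ⟨.inl M.o, fun v => ?_⟩
    obtain ⟨x, hx, rfl⟩ := M.outer v
    refine ⟨.inl x, ?_, rfl⟩
    have : x ∈ {x | M.Outer x ∧ (insertFace M.φ a y).SameCycle (.inl M.o) (.inl x)} := by
      refine mem_of_sameCycle (σ := M.φ) ?_ (x := M.o)
        ⟨Perm.SameCycle.refl _ _, Perm.SameCycle.refl _ _⟩ hx
      rintro x ⟨h1, h2⟩
      refine ⟨M.outer_φ.2 h1, h2.trans ⟨1, insertFace_inl ?_ ?_⟩⟩
      · rintro rfl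
        exact hout (M.outer_φ.1 (M.outer_φ.1 h1))
      · rintro rfl
        exact hout h1
    exact this.2

/-- A map that is not full can be extended by an edge. -/
theorem exists_insert (M : OuterMap V X) [Fintype V] [Finite X] (hV : 3 ≤ Fintype.card V)
    (h : ¬ M.IsFull) : ∃ (M' : OuterMap V (X ⊕ Bool)) (v w : V),
      M'.α = insertRev M.α ∧ M'.vt = insertTail M.vt v w := by
  classical
  obtain ⟨y, h3, hy⟩ := M.exists_insert_place hV h
  have hay : M.φ (M.φ y) ≠ y := M.face2 y
  obtain ⟨o, ho⟩ := M.outer_insert h3 hy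
  refine ⟨⟨insertFace M.φ (M.φ (M.φ y)) y, insertRev M.α,
    insertTail M.vt (M.vt (M.α (M.φ (M.φ y)))) (M.vt (M.α y)), o, ?_, ?_, ?_, ?_, ?_, ho, ?_, ?_,
    ?_⟩, _, _, rfl, rfl⟩
  · rintro (x | t)
    · simp [M.α_α]
    · simp
  · rintro (x | t)
    · simpa using M.α_ne x
    · simp
  · exact vt_insert M.α_α hay M.vt_rot
  · exact rot_insert_trans M.α_α hay M.rot_trans
  · intro A hA hcl
    exact M.conn A hA fun x hx => hcl (.inl x) hx
  · have h1 := M.euler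
    have h2 := numCycles_insertFace_of_sameCycle hay
      (Perm.SameCycle.symm ⟨2, by simp [pow_two]⟩ : M.φ.SameCycle (M.φ (M.φ y)) y)
    rw [Nat.card_sum, Nat.card_eq_fintype_card (α := Bool), Fintype.card_bool]
    omega
  · rintro (x | t)
    · by_cases hxa : x = M.φ (M.φ y)
      · rw [hxa, insertFace_left hay]; simp
      · by_cases hxy : x = y
        · rw [hxy, insertFace_right]; simp
        · rw [insertFace_inl hxa hxy]
          simpa using M.face1 x
    · cases t
      · rw [insertFace_false hay]; simp
      · rw [insertFace_true]; simp
  -- Only `y` leads to `false` and only `φ (φ y)` leads to `true`. The cut-off face has three darts,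
  -- and `h3` keeps the remainder longer than two.
  · have hinl : ∀ x t, x ≠ y ∨ t ≠ false → x ≠ M.φ (M.φ y) ∨ t ≠ true →
        insertFace M.φ (M.φ (M.φ y)) y (.inl x) ≠ .inr t := by
      intro x t h1 h2
      by_cases hxa : x = M.φ (M.φ y)
      · rw [hxa, insertFace_left hay]
        intro heq
        exact h2.elim (fun h => h hxa) fun h' => h' (Sum.inr.inj heq).symm
      · by_cases hxy : x = y
        · rw [hxy, insertFace_right]
          intro heq
          exact h1.elim (fun h => h hxy) fun h' => h' (Sum.inr.inj heq).symm
        · rw [insertFace_inl hxa hxy]; simp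
    rintro (x | t)
    · by_cases hxa : x = M.φ (M.φ y)
      · rw [hxa, insertFace_left hay, insertFace_true]
        simpa using (M.face1 (M.φ y)).symm
      · by_cases hxy : x = y
        · rw [hxy, insertFace_right, insertFace_false hay]
          simpa using h3
        · rw [insertFace_inl hxa hxy]
          by_cases h4 : M.φ x = M.φ (M.φ y)
          · rw [h4, insertFace_left hay]; simp
          · by_cases h5 : M.φ x = y
            · rw [h5, insertFace_right]; simp
            · rw [insertFace_inl h4 h5]
              simpa using M.face2 x
    · cases t
      · rw [insertFace_false hay]
        exact hinl _ _ (Or.inl h3) (Or.inr (by simp))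
      · rw [insertFace_true]
        exact hinl _ _ (Or.inr (by simp)) (Or.inl (M.face1 (M.φ y)).symm)

end OuterMap

/-- `Ear U A B`: a triangulated polygon with vertices `U`, edges `A` and boundary edges `B`,
oriented in cyclic order, can be built from a triangle by gluing triangles to boundary edges. -/
inductive Ear {V : Type*} : Set V → Set (Sym2 V) → Set (V × V) → Prop
  | tri (a b c : V) : a ≠ b → b ≠ c → c ≠ a →
      Ear {a, b, c} {s(a, b), s(b, c), s(c, a)} {(a, b), (b, c), (c, a)}
  | glue (U : Set V) (A : Set (Sym2 V)) (B : Set (V × V)) (x y v : V) : Ear U A B → (x, y) ∈ B →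
      v ∉ U → Ear (insert v U) (A ∪ {s(x, v), s(v, y)}) (B \ {(x, y)} ∪ {(x, v), (v, y)})

/-! ### Growing sets of triangles in a full map -/

namespace OuterMap

variable {V X : Type*}

/-- The faces of a map. -/
abbrev Faces (M : OuterMap V X) : Type _ := Quotient (Perm.SameCycle.setoid M.φ)

open Classical in
/-- The sets of internal faces that are obtained from a single face by adding adjacent faces. -/
inductive Glued (M : OuterMap V X) : Finset M.Faces → Prop
  | base (x : X) : ¬ M.Outer x → M.Glued {M.face x}
  | step (T : Finset M.Faces) (x : X) : M.Glued T → M.face x ∈ T → M.face (M.α x) ∉ T →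
      ¬ M.Outer (M.α x) → M.Glued (insert (M.face (M.α x)) T)

/-- The vertices of a set of faces. -/
def verts (M : OuterMap V X) (T : Finset M.Faces) : Set V := {v | ∃ x, M.face x ∈ T ∧ M.vt x = v}

/-- The edges of a set of faces. -/
def edges (M : OuterMap V X) (T : Finset M.Faces) : Set (Sym2 V) :=
  {e | ∃ x, M.face x ∈ T ∧ s(M.vt x, M.vt (M.α x)) = e}

/-- The boundary edges of a set of faces. -/
def bdry (M : OuterMap V X) (T : Finset M.Faces) : Set (V × V) :=
  {e | ∃ x, M.face x ∈ T ∧ M.face (M.α x) ∉ T ∧ (M.vt x, M.vt (M.α x)) = e}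

variable {M : OuterMap V X}

theorem vt_mem_verts {T : Finset M.Faces} {x : X} (hx : M.face x ∈ T) : M.vt x ∈ M.verts T :=
  ⟨x, hx, rfl⟩

theorem vt_α_mem_verts {T : Finset M.Faces} {x : X} (hx : M.face x ∈ T) :
    M.vt (M.α x) ∈ M.verts T :=
  ⟨M.φ x, by rwa [face_φ], M.vt_φ x⟩

theorem Glued.not_outer {T : Finset M.Faces} (hT : M.Glued T) {x : X} (hx : M.face x ∈ T) :
    ¬ M.Outer x := by
  induction hT with
  | base y hy =>
    rw [← face_eq_outer, Finset.mem_singleton.1 hx, face_eq_outer]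
    exact hy
  | step T y _ _ _ hy ih =>
    classical
    rcases Finset.mem_insert.1 hx with h | h
    · rw [← face_eq_outer, h, face_eq_outer]
      exact hy
    · exact ih h

theorem Glued.nonempty {T : Finset M.Faces} (hT : M.Glued T) : ∃ x, M.face x ∈ T := by
  cases hT with
  | base y hy => exact ⟨y, by simp⟩
  | step T y => classical exact ⟨M.α y, Finset.mem_insert_self _ _⟩

namespace IsFull

theorem eq_of_face_eq [Finite X] (h : M.IsFull) {x y : X} (hy : ¬ M.Outer y)
    (hxy : M.face x = M.face y) : x = y ∨ x = M.φ y ∨ x = M.φ (M.φ y) := by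
  refine mem_of_sameCycle (S := {x | x = y ∨ x = M.φ y ∨ x = M.φ (M.φ y)}) ?_ (Or.inl rfl)
    (M.face_eq.1 hxy.symm)
  rintro x (rfl | rfl | rfl)
  · exact Or.inr (Or.inl rfl)
  · exact Or.inr (Or.inr rfl)
  · exact Or.inl (h.tri _ hy)

open Classical in
theorem verts_step_subset [Finite X] (h : M.IsFull) {T : Finset M.Faces} {x : X}
    (hx : M.face x ∈ T) (hout : ¬ M.Outer (M.α x)) :
    M.verts (insert (M.face (M.α x)) T) ⊆ insert (M.vt (M.φ (M.φ (M.α x)))) (M.verts T) := by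
  rintro v ⟨y, hy, rfl⟩
  rcases Finset.mem_insert.1 hy with hy | hy
  · rcases h.eq_of_face_eq hout hy with rfl | rfl | rfl
    · exact Or.inr (vt_α_mem_verts hx)
    · rw [M.vt_rot]
      exact Or.inr (vt_mem_verts hx)
    · exact Or.inl rfl
  · exact Or.inr (vt_mem_verts hy)

/-- A set of internal faces that is closed under adjacency contains all the internal faces. -/
theorem mem_of_closed [Finite X] (h : M.IsFull) {T : Finset M.Faces} (hT : M.Glued T)
    (hcl : ∀ x, M.face x ∈ T → M.face (M.α x) ∈ T ∨ M.Outer (M.α x)) :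
    (∀ v, v ∈ M.verts T) ∧ ∀ x, M.face x ∈ T ∨ M.Outer x := by
  have hrot : ∀ x, M.face (M.φ (M.α x)) = M.face (M.α x) := fun x => M.face_φ _
  -- around a vertex, membership in `T` is inherited from a dart to the next one and conversely
  have hfwd : ∀ x, M.face x ∈ T → M.face ((M.φ * M.α) x) ∈ T ∨ M.Outer ((M.φ * M.α) x) := by
    intro x hx
    rw [Perm.mul_apply, hrot, outer_φ]
    exact hcl x hx
  have hbwd : ∀ x, M.face ((M.φ * M.α) x) ∈ T → M.face x ∈ T ∨ M.Outer x := by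
    intro x hx
    rw [Perm.mul_apply, hrot] at hx
    simpa [M.α_α] using hcl _ hx
  have hvt : ∀ (n : ℕ) x, M.vt (((M.φ * M.α) ^ n) x) = M.vt x := by
    intro n x
    induction n with
    | zero => rfl
    | succ n ih => rw [pow_succ', Perm.mul_apply, Perm.mul_apply, M.vt_rot, ih]
  have hfwd' : ∀ (n : ℕ) x, M.face x ∈ T → (∀ j, j ≤ n → ¬ M.Outer (((M.φ * M.α) ^ j) x)) →
      M.face (((M.φ * M.α) ^ n) x) ∈ T := by
    intro n x hx
    induction n with
    | zero => intro _; exact hx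
    | succ n ih =>
      intro hj
      have := hfwd _ (ih fun j hjn => hj j (by omega))
      rw [← Perm.mul_apply, ← pow_succ'] at this
      exact this.resolve_right (hj (n + 1) le_rfl)
  have hbwd' : ∀ (n : ℕ) x, M.face (((M.φ * M.α) ^ n) x) ∈ T →
      (∀ j, j ≤ n → ¬ M.Outer (((M.φ * M.α) ^ j) x)) → M.face x ∈ T := by
    intro n
    induction n with
    | zero => intro x hx _; exact hx
    | succ n ih =>
      intro x hx hj
      have h1 : M.face ((M.φ * M.α) x) ∈ T := by
        refine ih _ ?_ fun j hjn => ?_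
        · rwa [← Perm.mul_apply, ← pow_succ]
        · rw [← Perm.mul_apply, ← pow_succ]
          exact hj (j + 1) (by omega)
      exact (hbwd x h1).resolve_right (hj 0 (by omega))
  -- Exactly one outer dart `d` leaves each vertex. Ordered by the number of rotation steps to `d`,
  -- the darts at the vertex form a chain ending in `d`, along which membership in `T` spreads both
  -- ways without crossing `d`.
  have hvertex : ∀ x y, M.face x ∈ T → M.vt x = M.vt y → M.face y ∈ T ∨ M.Outer y := by
    intro x y hx hxy
    classical
    obtain ⟨d, hd, hdx⟩ := M.outer (M.vt x)
    have huniq : ∀ (n : ℕ) z, M.vt z = M.vt x → M.Outer (((M.φ * M.α) ^ n) z) →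
        ((M.φ * M.α) ^ n) z = d := fun n z hz ho =>
      h.inj _ _ ho hd ((hvt n z).trans (hz.trans hdx.symm))
    have hex : ∀ z, M.vt z = M.vt x → ∃ n : ℕ, ((M.φ * M.α) ^ n) z = d := by
      intro z hz
      obtain ⟨n, -, hn⟩ := (M.rot_trans z d (hz.trans hdx.symm)).exists_pow_eq'
      exact ⟨n, hn⟩
    have hk := Nat.find_spec (hex y hxy.symm)
    have hl := Nat.find_spec (hex x rfl)
    have hk' := fun m => Nat.find_min (m := m) (hex y hxy.symm)
    have hl' := fun m => Nat.find_min (m := m) (hex x rfl)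
    generalize Nat.find (hex y hxy.symm) = k at hk hk'
    generalize Nat.find (hex x rfl) = l at hl hl'
    have hinj : ∀ (a b : ℕ) z z', ((M.φ * M.α) ^ a) z = d → ((M.φ * M.α) ^ b) z' = d → a ≤ b →
        ((M.φ * M.α) ^ (b - a)) z' = z := by
      intro a b z z' hz hz' hab
      apply ((M.φ * M.α) ^ a).injective
      rw [← Perm.mul_apply, ← pow_add, Nat.add_sub_cancel' hab, hz, hz']
    by_cases hkl : k ≤ l
    · rcases Nat.eq_zero_or_pos k with rfl | hk0
      · right
        have : y = d := hk
        rwa [this]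
      · left
        rw [← hinj k l y x hk hl hkl]
        exact hfwd' _ x hx fun j hj ho => hl' j (by omega) (huniq j x rfl ho)
    · rcases Nat.eq_zero_or_pos l with rfl | hl0
      · have : x = d := hl
        exact absurd (this ▸ hd) (hT.not_outer hx)
      · left
        refine hbwd' (k - l) y ?_ fun j hj ho => hk' j (by omega) (huniq j y hxy.symm ho)
        rwa [hinj l k x y hl hk (by omega)]
  have hverts : M.verts T = Set.univ := by
    obtain ⟨x, hx⟩ := hT.nonempty
    refine M.conn _ ⟨_, vt_mem_verts hx⟩ ?_
    rintro y ⟨x, hx, hxy⟩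
    rcases hvertex x y hx hxy with hy | hy
    · exact vt_α_mem_verts hy
    -- For an outer `y`, the next dart in the rotation lies on the face of `α y`. It is not outer,
    -- as `y` is the only outer dart at the vertex; so the face of `α y` is in `T`, and the head of
    -- `y` is a vertex of `T`.
    · have hne : M.φ (M.α y) ≠ y := by
        intro hfix
        have : x = y := mem_of_sameCycle (S := {z | z = y}) (by
          rintro z rfl; exact hfix) rfl (M.rot_trans y x hxy.symm)
        rw [this] at hx
        exact hT.not_outer hx hy
      have h1 : M.face (M.φ (M.α y)) ∈ T := by
        refine (hvertex x _ hx (by rw [M.vt_rot, hxy])).resolve_right fun ho => hne ?_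
        exact h.inj _ _ ho hy (M.vt_rot y)
      rw [hrot] at h1
      exact vt_mem_verts h1
  refine ⟨fun v => hverts ▸ Set.mem_univ v, fun y => ?_⟩
  obtain ⟨x, hx, hxy⟩ : M.vt y ∈ M.verts T := hverts ▸ Set.mem_univ _
  exact hvertex x y hx hxy

theorem ncard_verts_le [Finite X] [Finite V] (h : M.IsFull) {T : Finset M.Faces}
    (hT : M.Glued T) : (M.verts T).ncard ≤ T.card + 2 := by
  classical
  induction hT with
  | base x hx =>
    have : M.verts {M.face x} ⊆ (({M.vt x, M.vt (M.φ x), M.vt (M.φ (M.φ x))} : Finset V) : Set V) := by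
      rintro v ⟨y, hy, rfl⟩
      rcases h.eq_of_face_eq hx (Finset.mem_singleton.1 hy) with rfl | rfl | rfl <;> simp
    refine (Set.ncard_le_ncard this).trans ?_
    rw [Set.ncard_coe_finset, Finset.card_singleton]
    exact Finset.card_le_three
  | step T x hT hx hx' hout ih =>
    refine (Set.ncard_le_ncard (verts_step_subset h hx hout)).trans ?_
    rw [Finset.card_insert_of_notMem hx']
    have := Set.ncard_insert_le (M.vt (M.φ (M.φ (M.α x)))) (M.verts T)
    omega

/-- Gluing on a triangle always adds a new vertex, as the numbers of vertices and faces show. -/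
theorem card_le_ncard_verts [Finite X] [Fintype V] (h : M.IsFull) {T : Finset M.Faces}
    (hT : M.Glued T) : T.card + 2 ≤ (M.verts T).ncard := by
  classical
  have : Fintype X := Fintype.ofFinite X
  have hcard : T.card + 1 ≤ _root_.numCycles M.φ := by
    rw [numCycles_eq, ← Finset.card_univ, Nat.add_one_le_iff]
    refine Finset.card_lt_card ((Finset.ssubset_univ_iff).2 fun hT' => ?_)
    exact hT.not_outer (x := M.o) (hT' ▸ Finset.mem_univ _) (Perm.SameCycle.refl _ _)
  have hn := h.numCycles
  -- Induction from large sets to small ones. A set closed under adjacency has all the vertices, and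
  -- `IsFull.numCycles` compares; any other set can be enlarged by a triangle, which adds at most
  -- one vertex.
  induction k : _root_.numCycles M.φ - T.card generalizing T with
  | zero => omega
  | succ k ih =>
    by_cases hcl : ∀ x, M.face x ∈ T → M.face (M.α x) ∈ T ∨ M.Outer (M.α x)
    · obtain ⟨h1, h2⟩ := h.mem_of_closed hT hcl
      have hv : M.verts T = Set.univ := Set.eq_univ_of_forall h1
      rw [hv, Set.ncard_univ, Nat.card_eq_fintype_card]
      omega
    · push Not at hcl
      obtain ⟨x, hx, hx', hout⟩ := hcl
      have hT' := Glued.step T x hT hx hx' hout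
      have hc := Finset.card_insert_of_notMem hx'
      have hcard' : (insert (M.face (M.α x)) T).card + 1 ≤ _root_.numCycles M.φ := by
        rw [numCycles_eq, ← Finset.card_univ, Nat.add_one_le_iff]
        refine Finset.card_lt_card ((Finset.ssubset_univ_iff).2 fun hT2 => ?_)
        exact hT'.not_outer (x := M.o) (hT2 ▸ Finset.mem_univ _) (Perm.SameCycle.refl _ _)
      have := ih hT' hcard' (by omega)
      have h3 := Set.ncard_le_ncard (verts_step_subset h hx hout)
      have h4 := Set.ncard_insert_le (M.vt (M.φ (M.φ (M.α x)))) (M.verts T)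
      omega

/-- With the apex already present, the enlarged set would have at most `T.card + 2` vertices, one
fewer than `card_le_ncard_verts` demands. -/
theorem apex_notMem [Finite X] [Fintype V] (h : M.IsFull) {T : Finset M.Faces} {x : X}
    (hT : M.Glued T) (hx : M.face x ∈ T) (hx' : M.face (M.α x) ∉ T) (hout : ¬ M.Outer (M.α x)) :
    M.vt (M.φ (M.φ (M.α x))) ∉ M.verts T := by
  classical
  intro hmem
  have h1 := h.card_le_ncard_verts (Glued.step T x hT hx hx' hout)
  have h2 := Set.ncard_le_ncard (verts_step_subset h hx hout)
  have h3 := h.ncard_verts_le hT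
  rw [Finset.card_insert_of_notMem hx'] at h1
  rw [Set.insert_eq_of_mem hmem] at h2
  omega

end IsFull

end OuterMap

/-! ### Full maps are ear decompositions, and all maps are simple -/

namespace OuterMap

variable {V X : Type*} {M : OuterMap V X}

/-- The edges of a set of faces are pairwise distinct and no loops. -/
def SimpleOn (M : OuterMap V X) (T : Finset M.Faces) : Prop :=
  (∀ x, M.face x ∈ T → M.vt x ≠ M.vt (M.α x)) ∧
  ∀ x y, M.face x ∈ T → M.face y ∈ T → s(M.vt x, M.vt (M.α x)) = s(M.vt y, M.vt (M.α y)) →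
    x = y ∨ x = M.α y

namespace IsFull

open Classical in
theorem ear_base [Finite X] [Fintype V] (h : M.IsFull) {x : X} (hx : ¬ M.Outer x) :
    Ear (M.verts {M.face x}) (M.edges {M.face x}) (M.bdry {M.face x}) ∧
      M.SimpleOn {M.face x} := by
  have hf : ∀ y, M.face y ∈ ({M.face x} : Finset M.Faces) ↔
      y = x ∨ y = M.φ x ∨ y = M.φ (M.φ x) := by
    intro y
    rw [Finset.mem_singleton]
    refine ⟨h.eq_of_face_eq hx, ?_⟩
    rintro (rfl | rfl | rfl) <;> simp [face_φ]
  have h0 : M.vt (M.α x) = M.vt (M.φ x) := (M.vt_φ _).symm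
  have h1 : M.vt (M.α (M.φ x)) = M.vt (M.φ (M.φ x)) := (M.vt_φ _).symm
  have h2 : M.vt (M.α (M.φ (M.φ x))) = M.vt x := by rw [← M.vt_φ, h.tri x hx]
  have hv : M.verts {M.face x} = {M.vt x, M.vt (M.φ x), M.vt (M.φ (M.φ x))} := by
    ext v
    constructor
    · rintro ⟨y, hy, rfl⟩
      rcases (hf y).1 hy with rfl | rfl | rfl <;> simp
    · rintro (rfl | rfl | rfl)
      · exact ⟨_, (hf _).2 (Or.inl rfl), rfl⟩
      · exact ⟨_, (hf _).2 (Or.inr (Or.inl rfl)), rfl⟩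
      · exact ⟨_, (hf _).2 (Or.inr (Or.inr rfl)), rfl⟩
  have hc := h.card_le_ncard_verts (Glued.base x hx)
  rw [hv, Finset.card_singleton] at hc
  have hab : M.vt x ≠ M.vt (M.φ x) := by
    intro he
    rw [he, Set.insert_eq_of_mem (by simp)] at hc
    have := Set.ncard_insert_le (M.vt (M.φ x)) {M.vt (M.φ (M.φ x))}
    rw [Set.ncard_singleton] at this
    omega
  have hbc : M.vt (M.φ x) ≠ M.vt (M.φ (M.φ x)) := by
    intro he
    rw [he, Set.insert_eq_of_mem (a := M.vt (M.φ (M.φ x))) (by simp)] at hc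
    have := Set.ncard_insert_le (M.vt x) {M.vt (M.φ (M.φ x))}
    rw [Set.ncard_singleton] at this
    omega
  have hca : M.vt (M.φ (M.φ x)) ≠ M.vt x := by
    intro he
    rw [he, Set.insert_eq_of_mem (a := M.vt x) (by simp)] at hc
    have := Set.ncard_insert_le (M.vt (M.φ x)) {M.vt x}
    rw [Set.ncard_singleton] at this
    omega
  have he : M.edges {M.face x} = {s(M.vt x, M.vt (M.φ x)), s(M.vt (M.φ x), M.vt (M.φ (M.φ x))),
      s(M.vt (M.φ (M.φ x)), M.vt x)} := by
    ext e
    constructor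
    · rintro ⟨y, hy, rfl⟩
      rcases (hf y).1 hy with rfl | rfl | rfl
      · rw [h0]; simp
      · rw [h1]; simp
      · rw [h2]; simp
    · rintro (rfl | rfl | rfl)
      · exact ⟨_, (hf _).2 (Or.inl rfl), by rw [h0]⟩
      · exact ⟨_, (hf _).2 (Or.inr (Or.inl rfl)), by rw [h1]⟩
      · exact ⟨_, (hf _).2 (Or.inr (Or.inr rfl)), by rw [h2]⟩
  -- No side of the triangle is the reversal of a side of the same triangle, because its corners are
  -- distinct.
  have hα : ∀ y, M.face y ∈ ({M.face x} : Finset M.Faces) →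
      M.face (M.α y) ∉ ({M.face x} : Finset M.Faces) := by
    intro y hy hy'
    have key : ∀ z w, M.α z = w → M.vt z = M.vt (M.α w) ∧ M.vt (M.α z) = M.vt w := by
      rintro z w rfl
      rw [M.α_α]; exact ⟨rfl, rfl⟩
    rcases (hf y).1 hy with rfl | rfl | rfl <;> rcases (hf _).1 hy' with hz | hz | hz <;>
      obtain ⟨e1, e2⟩ := key _ _ hz <;> simp only [h0, h1, h2] at e1 e2 <;>
      first
      | exact hab e1 | exact hbc e1 | exact hca e1 | exact hab e1.symm | exact hbc e1.symm
      | exact hca e1.symm | exact hab e2 | exact hbc e2 | exact hca e2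
  have hb : M.bdry {M.face x} = {(M.vt x, M.vt (M.φ x)), (M.vt (M.φ x), M.vt (M.φ (M.φ x))),
      (M.vt (M.φ (M.φ x)), M.vt x)} := by
    ext e
    constructor
    · rintro ⟨y, hy, -, rfl⟩
      rcases (hf y).1 hy with rfl | rfl | rfl
      · rw [h0]; simp
      · rw [h1]; simp
      · rw [h2]; simp
    · have key : ∀ y, M.face y ∈ ({M.face x} : Finset M.Faces) →
        (M.vt y, M.vt (M.α y)) ∈ M.bdry {M.face x} := fun y hy => ⟨y, hy, hα y hy, rfl⟩
      rintro (rfl | rfl | rfl)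
      · rw [← h0]; exact key _ ((hf _).2 (Or.inl rfl))
      · rw [← h1]; exact key _ ((hf _).2 (Or.inr (Or.inl rfl)))
      · have := key _ ((hf _).2 (Or.inr (Or.inr rfl)))
        rwa [h2] at this
  refine ⟨?_, ?_, ?_⟩
  · rw [hv, he, hb]
    exact Ear.tri _ _ _ hab hbc hca
  · intro y hy
    rcases (hf y).1 hy with rfl | rfl | rfl
    · rwa [h0]
    · rwa [h1]
    · rwa [h2]
  · intro y z hy hz heq
    left
    rcases (hf y).1 hy with rfl | rfl | rfl <;> rcases (hf z).1 hz with rfl | rfl | rfl <;>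
      simp only [h0, h1, h2, Sym2.eq_iff] at heq <;>
      rcases heq with ⟨e1, e2⟩ | ⟨e1, e2⟩ <;>
      first
      | rfl
      | exact absurd e1 hab | exact absurd e1 hbc | exact absurd e1 hca
      | exact absurd e1.symm hab | exact absurd e1.symm hbc | exact absurd e1.symm hca
      | exact absurd e2 hab | exact absurd e2 hbc | exact absurd e2 hca

-- The boundary is recorded by pairs of vertices, so deleting the pair of the shared edge is
-- harmless only if no other dart of `T` has the same ends; therefore simplicity is carried along.
-- It persists because both new edges end at a new vertex.
open Classical in
theorem ear_step [Finite X] [Fintype V] (h : M.IsFull) {T : Finset M.Faces} {x : X}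
    (hT : M.Glued T) (hx : M.face x ∈ T) (hx' : M.face (M.α x) ∉ T) (hout : ¬ M.Outer (M.α x))
    (hE : Ear (M.verts T) (M.edges T) (M.bdry T)) (hS : M.SimpleOn T) :
    Ear (M.verts (insert (M.face (M.α x)) T)) (M.edges (insert (M.face (M.α x)) T))
      (M.bdry (insert (M.face (M.α x)) T)) ∧ M.SimpleOn (insert (M.face (M.α x)) T) := by
  have hv := h.apex_notMem hT hx hx' hout
  set y := M.α x with hy
  have hαy : M.α y = x := M.α_α x
  set v := M.vt (M.φ (M.φ y)) with hvdef
  have hf : ∀ z, M.face z ∈ insert (M.face y) T ↔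
      M.face z ∈ T ∨ z = y ∨ z = M.φ y ∨ z = M.φ (M.φ y) := by
    intro z
    rw [Finset.mem_insert, or_comm]
    refine or_congr_right ⟨h.eq_of_face_eq hout, ?_⟩
    rintro (rfl | rfl | rfl) <;> simp [face_φ]
  have hp : M.vt (M.φ y) = M.vt x := by rw [M.vt_φ, hαy]
  have h1 : M.vt (M.α (M.φ y)) = v := (M.vt_φ _).symm
  have h2 : M.vt (M.α (M.φ (M.φ y))) = M.vt y := by rw [← M.vt_φ, h.tri y hout]
  have hpv : M.vt x ≠ v := fun he => hv (he ▸ vt_mem_verts hx)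
  have hqv : M.vt y ≠ v := fun he => hv (he ▸ vt_α_mem_verts hx)
  have hpq : M.vt x ≠ M.vt y := hS.1 x hx
  have hnew1 : M.face (M.φ y) ∈ insert (M.face y) T := (hf _).2 (Or.inr (Or.inr (Or.inl rfl)))
  have hnew2 : M.face (M.φ (M.φ y)) ∈ insert (M.face y) T :=
    (hf _).2 (Or.inr (Or.inr (Or.inr rfl)))
  have hold : ∀ z, M.face z ∈ T → M.vt z ≠ v ∧ M.vt (M.α z) ≠ v := fun z hz =>
    ⟨fun he => hv (he ▸ vt_mem_verts hz), fun he => hv (he ▸ vt_α_mem_verts hz)⟩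
  have hverts : M.verts (insert (M.face y) T) = insert v (M.verts T) := by
    refine (verts_step_subset h hx hout).antisymm ?_
    rintro w (rfl | ⟨z, hz, rfl⟩)
    · exact ⟨_, hnew2, rfl⟩
    · exact ⟨z, (hf z).2 (Or.inl hz), rfl⟩
  have hedges : M.edges (insert (M.face y) T) =
      M.edges T ∪ {s(M.vt x, v), s(v, M.vt y)} := by
    ext e
    constructor
    · rintro ⟨z, hz, rfl⟩
      rcases (hf z).1 hz with hz | rfl | rfl | rfl
      · exact Or.inl ⟨z, hz, rfl⟩
      · exact Or.inl ⟨x, hx, by rw [hαy, ← hy, Sym2.eq_swap]⟩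
      · rw [hp, h1]; simp
      · rw [h2]; simp [hvdef]
    · rintro (⟨z, hz, rfl⟩ | rfl | rfl)
      · exact ⟨z, (hf z).2 (Or.inl hz), rfl⟩
      · exact ⟨_, hnew1, by rw [hp, h1]⟩
      · exact ⟨_, hnew2, by rw [h2]⟩
  -- The only boundary dart of `T` that becomes internal is `x`: the other two sides of the triangle
  -- end at the apex, which no dart of `T` meets.
  have hrev : ∀ z, M.face z ∈ T → M.face (M.α z) ∉ T →
      M.face (M.α z) ∈ insert (M.face y) T → z = x := by
    intro z hz hz' hz2
    rcases (hf _).1 hz2 with h3 | h3 | h3 | h3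
    · exact absurd h3 hz'
    · exact M.α.injective h3
    · refine absurd ?_ (hold z hz).1
      rw [← M.α_α z, h3, h1]
    · refine absurd ?_ (hold z hz).2
      rw [h3]
  have hnewα : ∀ z, z = M.φ y ∨ z = M.φ (M.φ y) → M.face (M.α z) ∉ insert (M.face y) T := by
    intro z hz hz'
    have key : ∀ z w, M.α z = w → M.vt z = M.vt (M.α w) ∧ M.vt (M.α z) = M.vt w := by
      rintro z w rfl
      rw [M.α_α]; exact ⟨rfl, rfl⟩
    rcases (hf _).1 hz' with h3 | h3
    · have := hold _ h3
      rw [M.α_α] at this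
      rcases hz with rfl | rfl
      · exact this.1 h1
      · exact this.2 rfl
    · rcases hz with rfl | rfl <;> rcases h3 with h3 | h3 | h3
      · have := (key _ _ h3).2
        rw [h1] at this
        exact hqv this.symm
      · exact M.α_ne _ h3
      · have := (key _ _ h3).1
        rw [hp, h2] at this
        exact hpq this
      · have := (key _ _ h3).1
        rw [hαy] at this
        exact hpv this.symm
      · have := (key _ _ h3).2
        rw [hp, h2] at this
        exact hpq this.symm
      · exact M.α_ne _ h3
  have hbdry : M.bdry (insert (M.face y) T) =
      M.bdry T \ {(M.vt x, M.vt y)} ∪ {(M.vt x, v), (v, M.vt y)} := by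
    ext e
    constructor
    · rintro ⟨z, hz, hz', rfl⟩
      rcases (hf z).1 hz with hzT | rfl | rfl | rfl
      · refine Or.inl ⟨⟨z, hzT, fun hc => hz' ((hf _).2 (Or.inl hc)), rfl⟩, fun heq => ?_⟩
        rcases hS.2 z x hzT hx (by simpa using congrArg (fun p : V × V => s(p.1, p.2)) heq)
          with rfl | rfl
        · exact hz' ((hf _).2 (Or.inr (Or.inl rfl)))
        · exact hx' hzT
      · exact absurd ((hf _).2 (Or.inl (by rwa [hαy]))) hz'
      · rw [hp, h1]; simp
      · rw [h2]; simp [hvdef]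
    · rintro (⟨⟨z, hz, hz', rfl⟩, hne⟩ | rfl | rfl)
      · refine ⟨z, (hf z).2 (Or.inl hz), fun hc => hne ?_, rfl⟩
        rw [hrev z hz hz' hc]
        rfl
      · exact ⟨_, hnew1, hnewα _ (Or.inl rfl), by rw [hp, h1]⟩
      · exact ⟨_, hnew2, hnewα _ (Or.inr rfl), by rw [h2]⟩
  refine ⟨?_, ?_, ?_⟩
  · rw [hverts, hedges, hbdry]
    exact Ear.glue _ _ _ _ _ _ hE ⟨x, hx, hx', rfl⟩ hv
  · intro z hz
    rcases (hf z).1 hz with hz | rfl | rfl | rfl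
    · exact hS.1 z hz
    · rw [hαy]; exact hpq.symm
    · rw [hp, h1]; exact hpv
    · rw [h2]; exact hqv.symm
  · have mixed : ∀ z w, M.face z ∈ T → (w = y ∨ w = M.φ y ∨ w = M.φ (M.φ y)) →
        s(M.vt z, M.vt (M.α z)) = s(M.vt w, M.vt (M.α w)) → z = w ∨ z = M.α w := by
      rintro z w hz (rfl | rfl | rfl) heq
      · rw [hαy, Sym2.eq_swap (a := M.vt y)] at heq
        rw [hαy]
        exact (hS.2 z x hz hx heq).symm
      · rw [h1] at heq
        have : v ∈ s(M.vt z, M.vt (M.α z)) := heq ▸ Sym2.mem_mk_right _ _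
        rcases Sym2.mem_iff.1 this with h3 | h3
        · exact absurd h3.symm (hold z hz).1
        · exact absurd h3.symm (hold z hz).2
      · have : v ∈ s(M.vt z, M.vt (M.α z)) := heq ▸ Sym2.mem_mk_left _ _
        rcases Sym2.mem_iff.1 this with h3 | h3
        · exact absurd h3.symm (hold z hz).1
        · exact absurd h3.symm (hold z hz).2
    intro z w hz hw heq
    rcases (hf z).1 hz with hzT | hz3
    · rcases (hf w).1 hw with hwT | hw3
      · exact hS.2 z w hzT hwT heq
      · exact mixed z w hzT hw3 heq
    · rcases (hf w).1 hw with hwT | hw3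
      · rcases mixed w z hwT hz3 heq.symm with rfl | rfl
        · exact Or.inl rfl
        · exact Or.inr (M.α_α z).symm
      · left
        rcases hz3 with rfl | rfl | rfl <;> rcases hw3 with rfl | rfl | rfl <;>
          simp only [hαy, hp, h1, h2, ← hvdef, Sym2.eq_iff] at heq <;>
          rcases heq with ⟨e1, e2⟩ | ⟨e1, e2⟩ <;>
          first
          | rfl
          | exact absurd e1 hpq | exact absurd e1 hpv | exact absurd e1 hqv
          | exact absurd e1.symm hpq | exact absurd e1.symm hpv | exact absurd e1.symm hqv
          | exact absurd e2 hpq | exact absurd e2 hpv | exact absurd e2 hqv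
          | exact absurd e2.symm hpq | exact absurd e2.symm hpv | exact absurd e2.symm hqv

theorem ear_of_glued [Finite X] [Fintype V] (h : M.IsFull) {T : Finset M.Faces}
    (hT : M.Glued T) : Ear (M.verts T) (M.edges T) (M.bdry T) ∧ M.SimpleOn T := by
  induction hT with
  | base x hx => exact h.ear_base hx
  | step T x hT hx hx' hout ih => exact h.ear_step hT hx hx' hout ih.1 ih.2

/-- If all darts were outer there would be a single face, and `IsFull.numCycles` would leave only
two vertices. -/
theorem exists_inner [Finite X] [Fintype V] (h : M.IsFull) (hV : 3 ≤ Fintype.card V) :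
    ∃ x, ¬ M.Outer x := by
  classical
  by_contra! hcon
  have : Fintype X := Fintype.ofFinite X
  have h1 : _root_.numCycles M.φ = Nat.card Unit :=
    numCycles_eq_card (fun _ => ()) (fun _ => ⟨M.o, rfl⟩) (fun _ => rfl)
      fun x y _ => Perm.SameCycle.trans (Perm.SameCycle.symm (hcon x)) (hcon y)
  have h2 := h.numCycles
  rw [h1, Nat.card_eq_fintype_card, Fintype.card_unit] at h2
  omega

theorem exists_glued_all [Finite X] [Fintype V] (h : M.IsFull) (hV : 3 ≤ Fintype.card V) :
    ∃ T : Finset M.Faces, M.Glued T ∧ (∀ v, v ∈ M.verts T) ∧ ∀ x, M.face x ∈ T ∨ M.Outer x := by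
  classical
  have : Fintype X := Fintype.ofFinite X
  obtain ⟨x, hx⟩ := h.exists_inner hV
  obtain ⟨T, hT⟩ := (Set.toFinite {T : Finset M.Faces | M.Glued T}).exists_maximal ⟨_, Glued.base x hx⟩
  refine ⟨T, hT.1, h.mem_of_closed hT.1 ?_⟩
  by_contra! hcl
  obtain ⟨y, hy, hy', hout⟩ := hcl
  exact hy' (hT.2 (Glued.step T y hT.1 hy hy' hout) (Finset.subset_insert _ _)
    (Finset.mem_insert_self _ _))

/-- A full map is simple, and it is a triangulated polygon. -/
theorem ear [Finite X] [Fintype V] (h : M.IsFull) (hV : 3 ≤ Fintype.card V) :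
    M.IsSimple ∧ ∃ B, Ear Set.univ {e | ∃ x, s(M.vt x, M.vt (M.α x)) = e} B := by
  obtain ⟨T, hT, hv, hall⟩ := h.exists_glued_all hV
  obtain ⟨hE, hS⟩ := h.ear_of_glued hT
  -- Were both sides of an edge outer, the dart `x` would follow itself in the rotation and be alone
  -- at its tail; but some dart there lies on a face of `T`.
  have hα : ∀ x, M.Outer x → M.face (M.α x) ∈ T := by
    intro x hx
    refine (hall _).resolve_right fun hx' => ?_
    obtain ⟨y, hy, hyx⟩ := hv (M.vt x)
    have hfix : M.φ (M.α x) = x := h.inj _ _ (M.outer_φ.2 hx') hx (M.vt_rot x)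
    have : y = x := mem_of_sameCycle (S := {z | z = x}) (by rintro z rfl; exact hfix) rfl
      (M.rot_trans x y hyx.symm)
    exact hT.not_outer hy (this ▸ hx)
  refine ⟨⟨fun x => ?_, fun x y h1 h2 => ?_⟩, M.bdry T, ?_⟩
  · rcases hall x with hx | hx
    · exact hS.1 x hx
    · have := hS.1 _ (hα x hx)
      rw [M.α_α] at this
      exact this.symm
  · have mixed : ∀ x y, M.face x ∈ T → M.Outer y → M.vt x = M.vt y →
        M.vt (M.α x) = M.vt (M.α y) → x = y := by
      intro x y hx hy h1 h2
      have := hS.2 x (M.α y) hx (hα y hy) (by rw [M.α_α, h1, h2, Sym2.eq_swap])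
      rw [M.α_α] at this
      refine this.resolve_left fun he => hS.1 x hx ?_
      rw [h2, ← he]
    rcases hall x with hx | hx <;> rcases hall y with hy | hy
    · refine (hS.2 x y hx hy (by rw [h1, h2])).resolve_right fun he => hS.1 x hx ?_
      rw [h1, he, M.α_α]
    · exact mixed x y hx hy h1 h2
    · exact (mixed y x hy hx h1.symm h2.symm).symm
    · exact h.inj x y hx hy h1
  · convert hE using 1
    · exact (Set.eq_univ_of_forall hv).symm
    · ext e
      constructor
      · rintro ⟨x, rfl⟩
        rcases hall x with hx | hx
        · exact ⟨x, hx, rfl⟩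
        · exact ⟨M.α x, hα x hx, by rw [M.α_α, Sym2.eq_swap]⟩
      · rintro ⟨x, -, rfl⟩
        exact ⟨x, rfl⟩

end IsFull

/-- Loops and parallel edges cannot occur, as the map can be completed to a full one. -/
theorem isSimple [Fintype V] (hV : 3 ≤ Fintype.card V) [Finite X] (M : OuterMap V X) :
    M.IsSimple := by
  have : Fintype X := Fintype.ofFinite X
  -- Induction on the number of darts that `card_le` still allows. The completed map restricts to
  -- the given one, and simplicity is inherited.
  have key : ∀ (k : ℕ) (X : Type _) [Fintype X] (M : OuterMap V X),
      4 * Fintype.card V - Fintype.card X ≤ k → M.IsSimple := by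
    intro k
    induction k with
    | zero =>
      intro X _ M hk
      have := M.card_le
      omega
    | succ k ih =>
      intro X _ M hk
      by_cases hfull : M.IsFull
      · exact (hfull.ear hV).1
      · obtain ⟨M', v, w, hα, hvt⟩ := M.exists_insert hV hfull
        have hM' := ih (X ⊕ Bool) M' (by
          rw [Fintype.card_sum, Fintype.card_bool]
          have := M.card_le
          omega)
        refine ⟨fun x => ?_, fun x y h1 h2 => ?_⟩
        · have := hM'.ne (.inl x)
          rw [hα, hvt] at this
          exact this
        · have := hM'.inj (.inl x) (.inl y)
          rw [hα, hvt] at this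
          exact Sum.inl.inj (this h1 h2)
  exact key _ X M le_rfl

end OuterMap

/-! ### Rotation systems and outerplanar maps -/

section Conversion

variable {V X : Type*} {G : SimpleGraph V}

theorem RotationSystem.facePerm_apply (R : RotationSystem G) (d : G.Dart) :
    R.facePerm d = R.rot d.symm := rfl

theorem RotationSystem.fst_facePerm (R : RotationSystem G) (d : G.Dart) :
    (R.facePerm d).fst = d.snd := by
  rw [facePerm_apply, R.fst_rot]; rfl

theorem RotationSystem.faceOf_eq (R : RotationSystem G) {d e : G.Dart} :
    R.faceOf d = R.faceOf e ↔ R.facePerm.SameCycle d e :=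
  ⟨fun h => Quotient.exact h, fun h => Quotient.sound h⟩

theorem RotationSystem.card_face (R : RotationSystem G) : Nat.card R.Face = numCycles R.facePerm :=
  rfl

instance finite_dart [Finite V] : Finite G.Dart :=
  Finite.of_injective (fun d : G.Dart => d.toProd) fun _ _ h => SimpleGraph.Dart.ext _ _ h

theorem two_mul_card_edgeSet [Finite V] : 2 * Nat.card G.edgeSet = Nat.card G.Dart := by
  classical
  have := Fintype.ofFinite V
  rw [Nat.card_eq_fintype_card, Nat.card_eq_fintype_card, ← SimpleGraph.edgeFinset_card]
  exact G.dart_card_eq_twice_card_edges.symm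

theorem card_connectedComponent_of_connected (hG : G.Connected) :
    Nat.card G.ConnectedComponent = 1 := by
  have := hG.preconnected.subsingleton_connectedComponent
  have : Nonempty G.ConnectedComponent := ⟨G.connectedComponentMk hG.nonempty.some⟩
  exact Nat.card_unique

theorem eq_univ_of_connected (hG : G.Connected) (A : Set V) (hA : A.Nonempty)
    (h : ∀ v w, G.Adj v w → v ∈ A → w ∈ A) : A = Set.univ := by
  obtain ⟨v, hv⟩ := hA
  refine Set.eq_univ_of_forall fun w => ?_
  obtain ⟨p⟩ := hG.preconnected v w
  induction p with
  | nil => exact hv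
  | cons h' _ ih => exact ih (h _ _ h' hv)

theorem exists_adj_of_connected [Nontrivial V] (hG : G.Connected) (v : V) : ∃ w, G.Adj v w := by
  by_contra! h
  have := eq_univ_of_connected hG {v} ⟨v, rfl⟩ (by rintro _ w hvw rfl; exact absurd hvw (h w))
  obtain ⟨w, hw⟩ := exists_ne v
  exact hw (this ▸ Set.mem_univ w : w ∈ ({v} : Set V))

/-- A connected outerplanar graph as an abstract map. -/
theorem exists_outerMap [Fintype V] (hV : 3 ≤ Fintype.card V) (hG : G.Connected)
    (R : RotationSystem G) (O : Set R.Face) (hP : R.IsPlanar) (hO : R.IsOuter O) :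
    ∃ M : OuterMap V G.Dart, M.φ = R.facePerm ∧ (∀ d, M.α d = d.symm) ∧ (∀ d, M.vt d = d.fst) ∧
      ∀ d, M.Outer d ↔ R.faceOf d ∈ O := by
  have : Nontrivial V := Fintype.one_lt_card_iff_nontrivial.1 (by omega)
  have hOv : ∀ v, ∃ d : G.Dart, d.fst = v ∧ R.faceOf d ∈ O := by
    intro v
    obtain ⟨w, hw⟩ := exists_adj_of_connected hG v
    exact hO.2 v w hw
  obtain ⟨o, -, ho⟩ := hOv hG.nonempty.some
  have hsame : ∀ d, R.faceOf d ∈ O → R.facePerm.SameCycle o d := fun d hd =>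
    R.faceOf_eq.1 (hO.1 o d ho hd (hG.preconnected _ _))
  have hmul : R.facePerm * (SimpleGraph.Dart.symm_involutive (G := G)).toPerm = R.rot := by
    ext1 d
    change R.rot d.symm.symm = R.rot d
    rw [d.symm_symm]
  refine ⟨⟨R.facePerm, (SimpleGraph.Dart.symm_involutive (G := G)).toPerm, fun d => d.fst, o,
    fun d => d.symm_symm, fun d => d.symm_ne, ?_, ?_, ?_, ?_, ?_, ?_, ?_⟩, rfl, fun _ => rfl,
    fun _ => rfl, fun d => ?_⟩
  · intro d
    exact R.fst_facePerm _
  · intro d e hde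
    rw [hmul]
    exact R.sameCycle_of_fst_eq d e hde
  · intro A hA h
    exact eq_univ_of_connected hG A hA fun v w hvw => h ⟨(v, w), hvw⟩
  · intro v
    obtain ⟨d, hd, hdO⟩ := hOv v
    exact ⟨d, hsame d hdO, hd⟩
  · have h1 := hP
    rw [RotationSystem.IsPlanar, card_connectedComponent_of_connected hG,
      RotationSystem.card_face] at h1
    have h2 := two_mul_card_edgeSet (G := G)
    have h3 : Nat.card {v : V // ∀ w, ¬ G.Adj v w} = 0 := by
      rw [Nat.card_eq_zero]
      left
      refine ⟨fun v => ?_⟩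
      obtain ⟨w, hw⟩ := exists_adj_of_connected hG v.1
      exact v.2 w hw
    omega
  · intro d hd
    have := R.fst_facePerm d
    rw [hd] at this
    exact d.adj.ne this
  -- A facial walk of length two is an entire component with two vertices, which `hV` excludes.
  · intro d hd
    have h1 := R.fst_facePerm d
    have h2 := R.fst_facePerm (R.facePerm d)
    rw [hd] at h2
    have h3 : R.facePerm d = d.symm := SimpleGraph.Dart.ext _ _ (Prod.ext h1 h2.symm)
    -- both ends of `d` have degree one
    have h4 : R.rot d.symm = d.symm := h3
    have h5 : R.rot d = d := by
      have : R.facePerm d.symm = d := by rw [← h3, hd]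
      rwa [RotationSystem.facePerm_apply, d.symm_symm] at this
    have hfix : ∀ e : G.Dart, R.rot e = e → ∀ w, G.Adj e.fst w → w = e.snd := by
      intro e he w hw
      have : (⟨(e.fst, w), hw⟩ : G.Dart) = e := mem_of_sameCycle (S := {z | z = e})
        (by rintro z rfl; exact he) rfl (R.sameCycle_of_fst_eq e ⟨(e.fst, w), hw⟩ rfl)
      exact congrArg (fun e : G.Dart => e.snd) this
    have hu := eq_univ_of_connected hG {d.fst, d.snd} ⟨d.fst, by simp⟩ (by
      rintro v w hvw (rfl | rfl)
      · exact Or.inr (hfix d h5 w hvw)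
      · exact Or.inl (hfix d.symm h4 w hvw))
    have hc : (Set.univ : Set V).ncard ≤ 2 := by
      rw [← hu]
      exact (Set.ncard_insert_le _ _).trans (by rw [Set.ncard_singleton])
    rw [Set.ncard_univ, Nat.card_eq_fintype_card] at hc
    omega
  · change R.facePerm.SameCycle o d ↔ _
    refine ⟨fun h => ?_, hsame d⟩
    rw [← R.faceOf_eq.2 h]
    exact ho

/-- A rotation system from the permutations of an abstract set of darts. -/
theorem exists_rotationSystem {φ α : Perm X} {vt : X → V} (hα : ∀ x, α (α x) = x)
    (hvt : ∀ x, vt (φ (α x)) = vt x) (hrot : ∀ x y, vt x = vt y → (φ * α).SameCycle x y)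
    (hinj : ∀ x y, vt x = vt y → vt (α x) = vt (α y) → x = y)
    (hG : ∀ v w, G.Adj v w ↔ ∃ x, vt x = v ∧ vt (α x) = w) :
    ∃ (R : RotationSystem G) (e : X ≃ G.Dart), (∀ x, (e x).fst = vt x) ∧
      (∀ x, (e x).symm = e (α x)) ∧ ∀ x, R.facePerm (e x) = e (φ x) := by
  let e : X ≃ G.Dart := Equiv.ofBijective
    (fun x => ⟨(vt x, vt (α x)), (hG _ _).2 ⟨x, rfl, rfl⟩⟩) (by
      constructor
      · intro x y h
        have h1 := congrArg (fun d : G.Dart => d.fst) h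
        have h2 := congrArg (fun d : G.Dart => d.snd) h
        exact hinj x y h1 h2
      · rintro ⟨⟨v, w⟩, h⟩
        obtain ⟨x, rfl, rfl⟩ := (hG _ _).1 h
        exact ⟨x, rfl⟩)
  have he1 : ∀ x, (e x).fst = vt x := fun _ => rfl
  have he2 : ∀ x, (e x).symm = e (α x) := fun x =>
    SimpleGraph.Dart.ext _ _ (Prod.ext rfl (by change vt x = vt (α (α x)); rw [hα]))
  refine ⟨⟨e.permCongr (φ * α), fun d => ?_, fun d d' h => ?_⟩, e, he1, he2, fun x => ?_⟩
  · obtain ⟨x, rfl⟩ := e.surjective d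
    rw [Equiv.permCongr_apply, e.symm_apply_apply, he1, he1]
    exact hvt x
  · obtain ⟨x, rfl⟩ := e.surjective d
    obtain ⟨y, rfl⟩ := e.surjective d'
    rw [he1, he1] at h
    refine sameCycle_map e (fun x => ⟨1, ?_⟩) (hrot x y h)
    simp
  · rw [RotationSystem.facePerm_apply]
    change e.permCongr (φ * α) (e x).symm = _
    rw [he2, Equiv.permCongr_apply, e.symm_apply_apply, Perm.mul_apply, hα]

theorem OuterMap.connected (M : OuterMap V X) (hG : ∀ v w, G.Adj v w ↔ ∃ x, M.vt x = v ∧ M.vt (M.α x) = w) :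
    G.Connected := by
  have : Nonempty V := ⟨M.vt M.o⟩
  refine ⟨fun v w => ?_⟩
  have := M.conn {w | G.Reachable v w} ⟨v, SimpleGraph.Reachable.refl v⟩ fun x hx =>
    SimpleGraph.Reachable.trans hx ((hG _ _).2 ⟨x, rfl, rfl⟩ : G.Adj _ _).reachable
  exact (this ▸ Set.mem_univ w : w ∈ {w | G.Reachable v w})

/-- The graph of a simple abstract map is outerplanar. -/
theorem OuterMap.exists_embedding [Finite V] (M : OuterMap V X) (hs : M.IsSimple)
    (hG : ∀ v w, G.Adj v w ↔ ∃ x, M.vt x = v ∧ M.vt (M.α x) = w) :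
    ∃ (R : RotationSystem G) (O : Set R.Face) (e : X ≃ G.Dart), R.IsPlanar ∧ R.IsOuter O ∧
      (∀ x, (e x).fst = M.vt x) ∧ (∀ x, (e x).symm = e (M.α x)) ∧
      (∀ x, R.facePerm (e x) = e (M.φ x)) ∧ ∀ x, R.faceOf (e x) ∈ O ↔ M.Outer x := by
  obtain ⟨R, e, he1, he2, he3⟩ := exists_rotationSystem M.α_α M.vt_rot M.rot_trans hs.inj hG
  have hcyc : ∀ x y, R.facePerm.SameCycle (e x) (e y) ↔ M.φ.SameCycle x y := by
    refine fun x y => ⟨fun h => ?_, sameCycle_map e fun x => ⟨1, he3 x⟩⟩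
    have := sameCycle_map (τ := M.φ) e.symm (fun d => ⟨1, by
      obtain ⟨x, rfl⟩ := e.surjective d
      rw [he3]; simp⟩) h
    simpa using this
  have hO : ∀ x, R.faceOf (e x) ∈ ({R.faceOf (e M.o)} : Set R.Face) ↔ M.Outer x := by
    intro x
    rw [Set.mem_singleton_iff, RotationSystem.faceOf_eq, hcyc, Perm.sameCycle_comm]
    rfl
  have hconn := M.connected hG
  refine ⟨R, {R.faceOf (e M.o)}, e, ?_, ⟨fun d d' hd hd' _ => ?_, fun v w _ => ?_⟩, he1, he2, he3, hO⟩
  · rw [RotationSystem.IsPlanar, card_connectedComponent_of_connected hconn,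
      RotationSystem.card_face, ← numCycles_conj e fun x => (he3 x).symm]
    have h1 := M.euler
    have h2 := two_mul_card_edgeSet (G := G)
    rw [← Nat.card_congr e] at h2
    have h3 : Nat.card {v : V // ∀ w, ¬ G.Adj v w} = 0 := by
      rw [Nat.card_eq_zero]
      left
      refine ⟨fun v => ?_⟩
      obtain ⟨x, -, hx⟩ := M.outer v.1
      exact v.2 _ ((hG _ _).2 ⟨x, hx, rfl⟩)
    omega
  · rw [Set.mem_singleton_iff] at hd hd'
    rw [hd, hd']
  · obtain ⟨x, hx, rfl⟩ := M.outer v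
    exact ⟨e x, he1 x, (hO x).2 hx⟩

end Conversion

/-! ### Joining two components of an outerplanar graph by an edge -/

section Join

variable {V : Type*} {G : SimpleGraph V}

theorem reachable_sup_edge_iff {v w x y : V} :
    (G ⊔ SimpleGraph.edge v w).Reachable x y ↔ G.Reachable x y ∨
      ((G.Reachable x v ∨ G.Reachable x w) ∧ (G.Reachable y v ∨ G.Reachable y w)) := by
  have hle : ∀ {x y}, G.Reachable x y → (G ⊔ SimpleGraph.edge v w).Reachable x y :=
    fun h => h.mono le_sup_left
  have hvw : (G ⊔ SimpleGraph.edge v w).Reachable v w := by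
    by_cases h : v = w
    · rw [h]
    · exact SimpleGraph.Adj.reachable (Or.inr ((SimpleGraph.edge_adj _ _ _ _).2 ⟨Or.inl ⟨rfl, rfl⟩, h⟩))
  constructor
  · rintro ⟨p⟩
    induction p with
    | nil => exact Or.inl (SimpleGraph.Reachable.refl _)
    | @cons a b c h p ih =>
      have hab : (mergeSetoid G.reachableSetoid v w) a b := by
        rcases h with h | h
        · exact Or.inl h.reachable
        · rcases ((SimpleGraph.edge_adj _ _ _ _).1 h).1 with ⟨rfl, rfl⟩ | ⟨rfl, rfl⟩
          · exact Or.inr ⟨Or.inl (SimpleGraph.Reachable.refl _), Or.inr (SimpleGraph.Reachable.refl _)⟩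
          · exact Or.inr ⟨Or.inr (SimpleGraph.Reachable.refl _), Or.inl (SimpleGraph.Reachable.refl _)⟩
      exact (mergeSetoid G.reachableSetoid v w).trans hab ih
  · rintro (h | ⟨h, h'⟩)
    · exact hle h
    · have h1 : (G ⊔ SimpleGraph.edge v w).Reachable x v :=
        h.elim hle fun h => (hle h).trans hvw.symm
      have h2 : (G ⊔ SimpleGraph.edge v w).Reachable y v :=
        h'.elim hle fun h => (hle h).trans hvw.symm
      exact h1.trans h2.symm

theorem card_connectedComponent_sup_edge [Finite V] {v w : V} (hvw : ¬ G.Reachable v w) :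
    Nat.card G.ConnectedComponent =
      Nat.card (G ⊔ SimpleGraph.edge v w).ConnectedComponent + 1 :=
  card_quotient_merge (r := G.reachableSetoid) (s := (G ⊔ SimpleGraph.edge v w).reachableSetoid)
    (a := v) (b := w) hvw fun _ _ => reachable_sup_edge_iff

theorem RotationSystem.reachable_of_sameCycle [Finite V] (R : RotationSystem G) {d e : G.Dart}
    (h : R.facePerm.SameCycle d e) : G.Reachable d.fst e.fst :=
  sameCycle_le_setoid (G.reachableSetoid.comap fun d : G.Dart => d.fst) (fun d => by
    change G.Reachable d.fst (R.facePerm d).fst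
    rw [R.fst_facePerm]
    exact d.adj.reachable) h

theorem exists_adj_of_reachable {x y : V} (h : G.Reachable x y) (hne : x ≠ y) :
    ∃ z, G.Adj x z := by
  obtain ⟨p⟩ := h
  cases p with
  | nil => exact absurd rfl hne
  | cons h _ => exact ⟨_, h⟩

/-- The common part of three cases, according to how many of `v` and `w` are isolated; `φ` is the
face permutation after the insertion. Hypothesis `h6` is Euler's formula in differential form: one
edge more and one component less, so faces and isolated vertices together drop by one. By `h2` and
`h3` the outer walks at `v` and `w` end up in one walk with both new darts. -/
theorem isOuterplanar_sup_edge_aux [Finite V] {R : RotationSystem G} {O : Set R.Face}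
    (hP : R.IsPlanar) (hO : R.IsOuter O) {v w : V} (hvw : ¬ G.Reachable v w)
    (φ : Perm (G.Dart ⊕ Bool))
    (h1 : ∀ d, φ.SameCycle (.inl d) (.inl (R.facePerm d)))
    (h2 : φ.SameCycle (.inr true) (.inr false))
    (h3 : ∀ d, R.faceOf d ∈ O → d.fst = v ∨ d.fst = w → φ.SameCycle (.inl d) (.inr true))
    (h4 : ∀ z, insertTail (fun d : G.Dart => d.fst) v w
      (φ (insertRev (SimpleGraph.Dart.symm_involutive (G := G)).toPerm z)) =
        insertTail (fun d : G.Dart => d.fst) v w z)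
    (h5 : ∀ z z', insertTail (fun d : G.Dart => d.fst) v w z =
      insertTail (fun d : G.Dart => d.fst) v w z' →
        (φ * insertRev (SimpleGraph.Dart.symm_involutive (G := G)).toPerm).SameCycle z z')
    (h6 : numCycles φ + Nat.card {u : V // ∀ x, ¬ (G ⊔ SimpleGraph.edge v w).Adj u x} + 1 =
      numCycles R.facePerm + Nat.card {u : V // ∀ x, ¬ G.Adj u x}) :
    IsOuterplanar (G ⊔ SimpleGraph.edge v w) := by
  have hne : v ≠ w := by rintro rfl; exact hvw (SimpleGraph.Reachable.refl _)
  have hnadj : ¬ G.Adj v w := fun h => hvw h.reachable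
  set α := insertRev (SimpleGraph.Dart.symm_involutive (G := G)).toPerm with hα
  set vt := insertTail (fun d : G.Dart => d.fst) v w with hvt
  have hadj : ∀ a b, (G ⊔ SimpleGraph.edge v w).Adj a b ↔ ∃ x, vt x = a ∧ vt (α x) = b := by
    intro a b
    constructor
    · rintro (h | h)
      · exact ⟨.inl ⟨(a, b), h⟩, rfl, rfl⟩
      · rcases ((SimpleGraph.edge_adj _ _ _ _).1 h).1 with ⟨rfl, rfl⟩ | ⟨rfl, rfl⟩
        · exact ⟨.inr true, rfl, rfl⟩
        · exact ⟨.inr false, rfl, rfl⟩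
    · rintro ⟨d | t, rfl, rfl⟩
      · exact Or.inl d.adj
      · right
        cases t
        · exact (SimpleGraph.edge_adj _ _ _ _).2 ⟨Or.inr ⟨rfl, rfl⟩, hne.symm⟩
        · exact (SimpleGraph.edge_adj _ _ _ _).2 ⟨Or.inl ⟨rfl, rfl⟩, hne⟩
  obtain ⟨R', e, he1, -, he3⟩ := exists_rotationSystem (φ := φ) (α := α) (vt := vt) (by
      rintro (d | t)
      · exact congrArg Sum.inl d.symm_symm
      · simp [hα]) h4 h5 (by
      rintro (d | t) (d' | t') h h'
      · exact congrArg Sum.inl (SimpleGraph.Dart.ext _ _ (Prod.ext h h'))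
      · cases t'
        · have h : d.fst = w := h
          have h' : d.snd = v := h'
          exact absurd (h ▸ h' ▸ d.adj.symm) hnadj
        · have h : d.fst = v := h
          have h' : d.snd = w := h'
          exact absurd (h ▸ h' ▸ d.adj) hnadj
      · cases t
        · have h : w = d'.fst := h
          have h' : v = d'.snd := h'
          exact absurd (h ▸ h' ▸ d'.adj.symm) hnadj
        · have h : v = d'.fst := h
          have h' : w = d'.snd := h'
          exact absurd (h ▸ h' ▸ d'.adj) hnadj
      · cases t <;> cases t'
        · rfl
        · exact absurd h hne.symm
        · exact absurd h hne
        · rfl) hadj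
  have hcyc : ∀ x y, φ.SameCycle x y → R'.faceOf (e x) = R'.faceOf (e y) := fun x y h =>
    R'.faceOf_eq.2 (sameCycle_map e (fun x => ⟨1, he3 x⟩) h)
  have h1' : ∀ d d', R.faceOf d = R.faceOf d' → φ.SameCycle (.inl d) (.inl d') := fun d d' h =>
    sameCycle_map Sum.inl h1 (R.faceOf_eq.1 h)
  -- The outer darts of the new embedding: the old ones and both new ones.
  let Z : G.Dart ⊕ Bool → Prop := Sum.elim (fun d => R.faceOf d ∈ O) fun _ => True
  have hA : ∀ z, Z z → (G ⊔ SimpleGraph.edge v w).Reachable (vt z) v →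
      φ.SameCycle z (.inr true) := by
    rintro (d | t) hz hr
    · have hz : R.faceOf d ∈ O := hz
      have hu : ∃ u, (u = v ∨ u = w) ∧ G.Reachable d.fst u := by
        rcases reachable_sup_edge_iff.1 hr with h | ⟨h | h, -⟩
        · exact ⟨v, Or.inl rfl, h⟩
        · exact ⟨v, Or.inl rfl, h⟩
        · exact ⟨w, Or.inr rfl, h⟩
      obtain ⟨u, hu, hdu⟩ := hu
      by_cases hd : d.fst = u
      · exact h3 d hz (hd ▸ hu)
      · obtain ⟨x, hx⟩ := exists_adj_of_reachable hdu.symm (Ne.symm hd)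
        obtain ⟨d', rfl, hd'⟩ := hO.2 u x hx
        exact (h1' _ _ (hO.1 d d' hz hd' hdu)).trans (h3 d' hd' hu)
    · cases t
      · exact h2.symm
      · exact Perm.SameCycle.refl _ _
  have hB : ∀ z z', Z z → Z z' → (G ⊔ SimpleGraph.edge v w).Reachable (vt z) (vt z') →
      φ.SameCycle z z' := by
    intro z z' hz hz' hr
    by_cases hzv : (G ⊔ SimpleGraph.edge v w).Reachable (vt z) v
    · exact (hA z hz hzv).trans (hA z' hz' (hr.symm.trans hzv)).symm
    · have hzv' : ¬ (G ⊔ SimpleGraph.edge v w).Reachable (vt z') v := fun h => hzv (hr.trans h)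
      have hbool : ∀ t, (G ⊔ SimpleGraph.edge v w).Reachable (vt (.inr t)) v := by
        intro t
        cases t
        · exact SimpleGraph.Adj.reachable ((hadj _ _).2 ⟨.inr false, rfl, rfl⟩)
        · exact SimpleGraph.Reachable.refl _
      rcases z with d | t
      · rcases z' with d' | t'
        · refine h1' _ _ (hO.1 d d' hz hz' ?_)
          refine (reachable_sup_edge_iff.1 hr).resolve_right fun h => hzv ?_
          exact reachable_sup_edge_iff.2
            (Or.inr ⟨h.1, Or.inl (SimpleGraph.Reachable.refl _)⟩)
        · exact absurd (hbool t') hzv'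
      · exact absurd (hbool t) hzv
  refine ⟨R', {f | ∃ z, Z z ∧ R'.faceOf (e z) = f}, ?_, ?_, ?_⟩
  · have p1 := hP
    rw [RotationSystem.IsPlanar, RotationSystem.card_face] at p1 ⊢
    rw [← numCycles_conj e fun x => (he3 x).symm]
    have p2 := two_mul_card_edgeSet (G := G)
    have p3 := two_mul_card_edgeSet (G := G ⊔ SimpleGraph.edge v w)
    rw [← Nat.card_congr e, Nat.card_sum, Nat.card_eq_fintype_card (α := Bool),
      Fintype.card_bool] at p3
    have p4 := card_connectedComponent_sup_edge hvw
    omega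
  · rintro d d' ⟨z, hz, hzd⟩ ⟨z', hz', hzd'⟩ hr
    rw [← hzd, ← hzd']
    refine hcyc _ _ (hB z z' hz hz' ?_)
    rw [← he1, ← he1]
    exact ((R'.reachable_of_sameCycle (R'.faceOf_eq.1 hzd)).trans hr).trans
      (R'.reachable_of_sameCycle (R'.faceOf_eq.1 hzd')).symm
  · rintro a b (h | h)
    · obtain ⟨d, rfl, hd⟩ := hO.2 a b h
      exact ⟨e (.inl d), he1 _, .inl d, hd, rfl⟩
    · rcases ((SimpleGraph.edge_adj _ _ _ _).1 h).1 with ⟨rfl, rfl⟩ | ⟨rfl, rfl⟩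
      · exact ⟨e (.inr true), he1 _, .inr true, trivial, rfl⟩
      · exact ⟨e (.inr false), he1 _, .inr false, trivial, rfl⟩

end Join

/-! ### The three cases of joining components, and the structure of maximal outerplanar graphs -/

section Join

variable {V : Type*} {G : SimpleGraph V}

theorem card_isolated_sup_edge [Finite V] {v w : V} (hne : v ≠ w) [Decidable (∀ x, ¬ G.Adj v x)]
    [Decidable (∀ x, ¬ G.Adj w x)] :
    Nat.card {u : V // ∀ x, ¬ (G ⊔ SimpleGraph.edge v w).Adj u x} +
      ((if ∀ x, ¬ G.Adj v x then 1 else 0) + (if ∀ x, ¬ G.Adj w x then 1 else 0)) =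
        Nat.card {u : V // ∀ x, ¬ G.Adj u x} := by
  classical
  have := Fintype.ofFinite V
  have h : (Finset.univ.filter fun u => ∀ x, ¬ (G ⊔ SimpleGraph.edge v w).Adj u x) =
      ((Finset.univ.filter fun u => ∀ x, ¬ G.Adj u x).erase v).erase w := by
    ext u
    simp only [Finset.mem_filter, Finset.mem_univ, true_and, Finset.mem_erase]
    constructor
    · intro hu
      refine ⟨?_, ?_, fun x hx => hu x (Or.inl hx)⟩
      · rintro rfl
        exact hu v (Or.inr ((SimpleGraph.edge_adj _ _ _ _).2 ⟨Or.inr ⟨rfl, rfl⟩, hne.symm⟩))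
      · rintro rfl
        exact hu w (Or.inr ((SimpleGraph.edge_adj _ _ _ _).2 ⟨Or.inl ⟨rfl, rfl⟩, hne⟩))
    · rintro ⟨hw, hv, hu⟩ x (hx | hx)
      · exact hu x hx
      · rcases ((SimpleGraph.edge_adj _ _ _ _).1 hx).1 with ⟨rfl, rfl⟩ | ⟨rfl, rfl⟩
        · exact hv rfl
        · exact hw rfl
  rw [Nat.card_eq_fintype_card, Nat.card_eq_fintype_card, Fintype.card_subtype,
    Fintype.card_subtype, h]
  have h1 := Finset.card_erase_add_one (s := (Finset.univ.filter fun u => ∀ x, ¬ G.Adj u x)) (a := v)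
  have h2 := Finset.card_erase_add_one
    (s := ((Finset.univ.filter fun u => ∀ x, ¬ G.Adj u x).erase v)) (a := w)
  have h3 := Finset.erase_eq_of_notMem (s := (Finset.univ.filter fun u => ∀ x, ¬ G.Adj u x)) (a := v)
  have h4 := Finset.erase_eq_of_notMem
    (s := ((Finset.univ.filter fun u => ∀ x, ¬ G.Adj u x).erase v)) (a := w)
  simp only [Finset.mem_filter, Finset.mem_univ, true_and, Finset.mem_erase, ne_eq, hne.symm,
    not_false_eq_true] at h1 h2 h3 h4
  split_ifs with hv hw hw
  · have := h1 hv; have := h2 hw; omega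
  · have := h1 hv; rw [h4 hw]; omega
  · have := h2 hw; rw [h3 hv] at this ⊢; omega
  · rw [h4 hw, h3 hv, Nat.add_zero]

theorem fst_ne_of_isolated {v : V} (hv : ∀ x, ¬ G.Adj v x) (z : G.Dart) : z.fst ≠ v := by
  rintro rfl
  exact hv _ z.adj

theorem exists_facePerm_eq (R : RotationSystem G) (d : G.Dart) :
    ∃ a : G.Dart, R.facePerm a = d ∧ a.snd = d.fst :=
  ⟨R.facePerm.symm d, by simp, by
    rw [← R.fst_facePerm]; simp⟩

theorem RotationSystem.facePerm_mul_symm (R : RotationSystem G) :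
    R.facePerm * (SimpleGraph.Dart.symm_involutive (G := G)).toPerm = R.rot := by
  ext1 d
  change R.rot d.symm.symm = R.rot d
  rw [d.symm_symm]

/-- Neither end is isolated: the edge merges the outer walks of the two components into one, so one
face is lost. -/
theorem isOuterplanar_sup_edge_both [Finite V] (hG : IsOuterplanar G) {v w : V}
    (hvw : ¬ G.Reachable v w) (hv : ∃ x, G.Adj v x) (hw : ∃ x, G.Adj w x) :
    IsOuterplanar (G ⊔ SimpleGraph.edge v w) := by
  classical
  have hne : v ≠ w := by rintro rfl; exact hvw (SimpleGraph.Reachable.refl _)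
  obtain ⟨R, O, hP, hO⟩ := hG
  have hiso := card_isolated_sup_edge (G := G) hne
  rw [if_neg (by push Not; exact hv), if_neg (by push Not; exact hw)] at hiso
  obtain ⟨x, hx⟩ := hv
  obtain ⟨y, hy⟩ := hw
  obtain ⟨d, rfl, hdO⟩ := hO.2 v x hx
  obtain ⟨e, rfl, heO⟩ := hO.2 w y hy
  obtain ⟨a, ha, ha'⟩ := exists_facePerm_eq R d
  obtain ⟨b, hb, hb'⟩ := exists_facePerm_eq R e
  have had : R.facePerm.SameCycle a d := ⟨1, ha⟩
  have hbe : R.facePerm.SameCycle b e := ⟨1, hb⟩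
  have hcyc : ¬ R.facePerm.SameCycle a b := fun h =>
    hvw (R.reachable_of_sameCycle ((had.symm.trans h).trans hbe))
  have hab : a ≠ b := by rintro rfl; exact hcyc (Perm.SameCycle.refl _ _)
  have hα : ∀ z : G.Dart, (SimpleGraph.Dart.symm_involutive (G := G)).toPerm _
    ((SimpleGraph.Dart.symm_involutive (G := G)).toPerm _ z) = z := fun z => z.symm_symm
  have hvt : insertTail (fun d : G.Dart => d.fst) d.fst e.fst = insertTail
      (fun d : G.Dart => d.fst) (((SimpleGraph.Dart.symm_involutive (G := G)).toPerm _ a).fst)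
        (((SimpleGraph.Dart.symm_involutive (G := G)).toPerm _ b).fst) := by
    rw [← ha', ← hb']; rfl
  have hold : ∀ {x y}, R.facePerm.SameCycle x y →
      (insertFace R.facePerm a b).SameCycle (.inl x) (.inl y) := sameCycle_insertFace hcyc
  have h2 : (insertFace R.facePerm a b).SameCycle (.inr true) (.inr false) := by
    refine Perm.SameCycle.trans ⟨1, insertFace_true⟩ ?_
    rw [hb]
    exact (hold hbe.symm).trans ⟨1, insertFace_right⟩
  refine isOuterplanar_sup_edge_aux hP hO hvw (insertFace R.facePerm a b)
    (fun d => hold ⟨1, rfl⟩) h2 ?_ ?_ ?_ ?_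
  · rintro z hz (hzd | hze)
    · have : R.facePerm.SameCycle z d := R.faceOf_eq.1 (hO.1 z d hz hdO (by rw [hzd]))
      exact (hold (this.trans had.symm)).trans ⟨1, insertFace_left hab⟩
    · have : R.facePerm.SameCycle z e := R.faceOf_eq.1 (hO.1 z e hz heO (by rw [hze]))
      exact ((hold (this.trans hbe.symm)).trans ⟨1, insertFace_right⟩).trans h2.symm
  · rw [hvt]
    exact vt_insert (vt := fun d : G.Dart => d.fst) hα hab fun z => by
      rw [R.fst_facePerm]; rfl
  · rw [hvt]
    exact rot_insert_trans (vt := fun d : G.Dart => d.fst) hα hab fun z z' h => by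
      rw [R.facePerm_mul_symm]
      exact R.sameCycle_of_fst_eq _ _ h
  · have := numCycles_insertFace_of_not_sameCycle hcyc
    omega

/-- A pendant edge is threaded into the outer walk at `w`, as `b`, `false`, `true`, `e`. The number
of faces stays the same and one isolated vertex disappears. -/
theorem isOuterplanar_sup_edge_left [Finite V] (hG : IsOuterplanar G) {v w : V}
    (hvw : ¬ G.Reachable v w) (hv : ∀ x, ¬ G.Adj v x) (hw : ∃ x, G.Adj w x) :
    IsOuterplanar (G ⊔ SimpleGraph.edge v w) := by
  classical
  have hne : v ≠ w := by rintro rfl; exact hvw (SimpleGraph.Reachable.refl _)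
  obtain ⟨R, O, hP, hO⟩ := hG
  have hiso := card_isolated_sup_edge (G := G) hne
  rw [if_pos hv, if_neg (by push Not; exact hw)] at hiso
  obtain ⟨y, hy⟩ := hw
  obtain ⟨e, rfl, heO⟩ := hO.2 w y hy
  obtain ⟨b, hb, hb'⟩ := exists_facePerm_eq R e
  have hbe : R.facePerm.SameCycle b e := ⟨1, hb⟩
  set φ : Perm (G.Dart ⊕ Bool) := Perm.sumCongr R.facePerm (1 : Perm Bool) *
    swap (.inl b) (.inr true) * swap (.inl b) (.inr false) with hφ
  have hφb : φ (.inl b) = .inr false := by simp [hφ, swap_apply_def]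
  have hφf : φ (.inr false) = .inr true := by simp [hφ]
  have hφt : φ (.inr true) = .inl e := by simp [hφ, swap_apply_def, hb]
  have hφi : ∀ x, x ≠ b → φ (.inl x) = .inl (R.facePerm x) := fun x hx => by
    simp [hφ, swap_apply_def, hx]
  have hold : ∀ {x y}, R.facePerm.SameCycle x y → φ.SameCycle (.inl x) (.inl y) :=
    sameCycle_two_insert _ _ _
  have h2 : φ.SameCycle (.inr true) (.inr false) := Perm.SameCycle.symm ⟨1, hφf⟩
  have hrot : φ * insertRev (SimpleGraph.Dart.symm_involutive (G := G)).toPerm =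
      Perm.sumCongr R.rot (1 : Perm Bool) * swap (.inl b.symm) (.inr false) := by
    ext1 z
    rw [Perm.mul_apply]
    rcases z with z | t
    · rw [insertRev_inl]
      change φ (.inl z.symm) = _
      by_cases hz : z = b.symm
      · rw [hz, b.symm_symm, hφb]; simp
      · have hz' : z.symm ≠ b := by rintro rfl; exact hz z.symm_symm.symm
        rw [hφi _ hz', R.facePerm_apply, z.symm_symm]
        simp [swap_apply_def, hz]
    · rw [insertRev_inr]
      cases t
      · rw [Bool.not_false, hφt, ← hb, R.facePerm_apply]; simp
      · rw [Bool.not_true, hφf]; simp [swap_apply_def]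
  refine isOuterplanar_sup_edge_aux hP hO hvw φ (fun d => hold ⟨1, rfl⟩) h2 ?_ ?_ ?_ ?_
  · rintro z hz (hzd | hze)
    · exact absurd (hzd ▸ z.adj) (hv _)
    · have : R.facePerm.SameCycle z e := R.faceOf_eq.1 (hO.1 z e hz heO (by rw [hze]))
      exact ((hold (this.trans hbe.symm)).trans ⟨1, hφb⟩).trans h2.symm
  · intro z
    rcases z with z | t
    · rw [insertRev_inl]
      change insertTail _ _ _ (φ (.inl z.symm)) = z.fst
      by_cases hz : z.symm = b
      · rw [hz, hφb, insertTail_false, ← hb', ← hz]; rfl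
      · rw [hφi _ hz, insertTail_inl, R.fst_facePerm]; rfl
    · rw [insertRev_inr]
      cases t
      · rw [Bool.not_false, hφt]; rfl
      · rw [Bool.not_true, hφf]
  · have hinl : ∀ z z' : G.Dart, z.fst = z'.fst →
        (φ * insertRev (SimpleGraph.Dart.symm_involutive (G := G)).toPerm).SameCycle
          (.inl z) (.inl z') := by
      intro z z' h
      rw [hrot]
      exact sameCycle_insert_fixed rfl (by simp)
        (sameCycle_map Sum.inl (fun x => ⟨1, rfl⟩) (R.sameCycle_of_fst_eq _ _ h))
    have hnew : ∀ z, insertTail (fun d : G.Dart => d.fst) v e.fst z = e.fst →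
        (φ * insertRev (SimpleGraph.Dart.symm_involutive (G := G)).toPerm).SameCycle
          (.inl b.symm) z := by
      rintro (z | t) h
      · exact hinl _ _ (hb'.trans h.symm)
      · cases t
        · refine ⟨1, ?_⟩
          rw [hrot]; simp
        · exact absurd h hne
    rintro (z | t) (z' | t') h
    · exact hinl z z' h
    · cases t'
      · exact (hnew _ h).symm.trans (hnew _ rfl)
      · exact absurd h (fst_ne_of_isolated hv z)
    · cases t
      · exact (hnew _ rfl).symm.trans (hnew _ h.symm)
      · exact absurd h.symm (fst_ne_of_isolated hv z')
    · cases t <;> cases t'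
      · exact Perm.SameCycle.refl _ _
      · exact absurd h hne.symm
      · exact absurd h hne
      · exact Perm.SameCycle.refl _ _
  · have h3 := numCycles_sumCongr_one (Y := Bool) R.facePerm
    have h4 := numCycles_two_insert (σ := Perm.sumCongr R.facePerm (1 : Perm Bool))
      (fun _ => rfl) b b
    rw [Nat.card_eq_fintype_card, Fintype.card_bool] at h3
    rw [← hφ] at h4
    omega

/-- The edge is a component of its own, with one facial walk made of its two darts: one face is
gained and two isolated vertices disappear. -/
theorem isOuterplanar_sup_edge_isolated [Finite V] (hG : IsOuterplanar G) {v w : V}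
    (hvw : ¬ G.Reachable v w) (hv : ∀ x, ¬ G.Adj v x) (hw : ∀ x, ¬ G.Adj w x) :
    IsOuterplanar (G ⊔ SimpleGraph.edge v w) := by
  classical
  have hne : v ≠ w := by rintro rfl; exact hvw (SimpleGraph.Reachable.refl _)
  obtain ⟨R, O, hP, hO⟩ := hG
  have hiso := card_isolated_sup_edge (G := G) hne
  rw [if_pos hv, if_pos hw] at hiso
  set φ : Perm (G.Dart ⊕ Bool) := Perm.sumCongr R.facePerm (swap true false) with hφ
  have hrot : φ * insertRev (SimpleGraph.Dart.symm_involutive (G := G)).toPerm =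
      Perm.sumCongr R.rot (1 : Perm Bool) := by
    ext1 z
    rcases z with z | t
    · change Sum.inl (R.rot z.symm.symm) = _
      rw [z.symm_symm]; rfl
    · cases t <;> rfl
  have hφ' : φ = Perm.sumCongr R.facePerm (1 : Perm Bool) * swap (.inr true) (.inr false) := by
    ext1 z
    rcases z with z | t
    · simp [hφ, swap_apply_def]
    · cases t <;> simp [hφ]
  refine isOuterplanar_sup_edge_aux hP hO hvw φ (fun d => ⟨1, rfl⟩) ⟨1, rfl⟩ ?_ ?_ ?_ ?_
  · rintro z hz (hzd | hze)
    · exact absurd (hzd ▸ z.adj) (hv _)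
    · exact absurd (hze ▸ z.adj) (hw _)
  · intro z
    rcases z with z | t
    · exact R.fst_facePerm _
    · cases t <;> rfl
  · rw [hrot]
    rintro (z | t) (z' | t') h
    · exact sameCycle_map Sum.inl (fun x => ⟨1, rfl⟩) (R.sameCycle_of_fst_eq _ _ h)
    · cases t'
      · exact absurd h (fst_ne_of_isolated hw z)
      · exact absurd h (fst_ne_of_isolated hv z)
    · cases t
      · exact absurd h.symm (fst_ne_of_isolated hw z')
      · exact absurd h.symm (fst_ne_of_isolated hv z')
    · cases t <;> cases t'
      · exact Perm.SameCycle.refl _ _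
      · exact absurd h hne.symm
      · exact absurd h hne
      · exact Perm.SameCycle.refl _ _
  · have h3 := numCycles_sumCongr_one (Y := Bool) R.facePerm
    have h4 := numCycles_insert_fixed (σ := Perm.sumCongr R.facePerm (1 : Perm Bool))
      (a := .inr true) (z := .inr false) rfl (by simp)
    rw [Nat.card_eq_fintype_card, Fintype.card_bool] at h3
    rw [← hφ'] at h4
    omega

theorem isOuterplanar_sup_edge [Finite V] (hG : IsOuterplanar G) {v w : V}
    (hvw : ¬ G.Reachable v w) : IsOuterplanar (G ⊔ SimpleGraph.edge v w) := by
  by_cases hv : ∃ x, G.Adj v x <;> by_cases hw : ∃ x, G.Adj w x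
  · exact isOuterplanar_sup_edge_both hG hvw hv hw
  · rw [SimpleGraph.edge_comm]
    push Not at hw
    exact isOuterplanar_sup_edge_left hG (fun h => hvw h.symm) hw hv
  · push Not at hv
    exact isOuterplanar_sup_edge_left hG hvw hv hw
  · push Not at hv hw
    exact isOuterplanar_sup_edge_isolated hG hvw hv hw

theorem IsMaximalOuterplanar.connected [Finite V] [Nonempty V] (hG : IsMaximalOuterplanar G) :
    G.Connected := by
  refine ⟨fun v w => ?_⟩
  by_contra h
  refine hG.2 v w ?_ (fun h' => h h'.reachable) (isOuterplanar_sup_edge hG.1 h)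
  rintro rfl
  exact h (SimpleGraph.Reachable.refl _)

/-- Maximal outerplanar graphs are triangulated polygons. -/
theorem IsMaximalOuterplanar.ear [Fintype V] (hG : IsMaximalOuterplanar G)
    (hV : 3 ≤ Fintype.card V) : ∃ B, Ear Set.univ G.edgeSet B := by
  have : Nonempty V := Fintype.card_pos_iff.1 (by omega)
  have hconn := hG.connected
  obtain ⟨R, O, hP, hO⟩ := hG.1
  obtain ⟨M, -, hα, hvt, -⟩ := exists_outerMap hV hconn R O hP hO
  by_cases hfull : M.IsFull
  · obtain ⟨-, B, hB⟩ := hfull.ear hV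
    refine ⟨B, ?_⟩
    convert hB using 1
    ext e
    induction e with | _ v w
    simp only [hα, hvt]
    constructor
    · intro h
      exact ⟨⟨(v, w), h⟩, rfl⟩
    · rintro ⟨d, hd⟩
      rw [← hd]
      exact d.adj
  -- The enlarged map is simple by `OuterMap.isSimple`, so the inserted edge is neither a loop nor
  -- parallel to an edge of `G`, and adding it keeps `G` outerplanar.
  · exfalso
    obtain ⟨M', v, w, hα', hvt'⟩ := M.exists_insert hV hfull
    have hs := M'.isSimple hV
    have hinr : ∀ t, M'.vt (.inr t) = if t then v else w := fun t => by rw [hvt']; rfl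
    have hinl : ∀ d, M'.vt (.inl d) = d.fst := fun d => by rw [hvt']; exact hvt d
    have hαinl : ∀ d, M'.vt (M'.α (.inl d)) = d.snd := fun d => by
      rw [hα', insertRev_inl, hinl, hα]; rfl
    have hαinr : ∀ t, M'.vt (M'.α (.inr t)) = if t then w else v := fun t => by
      rw [hα', insertRev_inr, hinr]; cases t <;> rfl
    have hne : v ≠ w := by
      have := hs.ne (.inr true)
      rwa [hinr, hαinr] at this
    have hnadj : ¬ G.Adj v w := by
      intro h
      have := hs.inj (.inl ⟨(v, w), h⟩) (.inr true) (by rw [hinl, hinr]; rfl)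
        (by rw [hαinl, hαinr]; rfl)
      cases this
    obtain ⟨R', O', -, hP', hO', -⟩ := M'.exists_embedding (G := G ⊔ SimpleGraph.edge v w) hs (by
      intro a b
      constructor
      · rintro (h | h)
        · exact ⟨.inl ⟨(a, b), h⟩, hinl _, hαinl _⟩
        · rcases ((SimpleGraph.edge_adj _ _ _ _).1 h).1 with ⟨rfl, rfl⟩ | ⟨rfl, rfl⟩
          · exact ⟨.inr true, hinr _, hαinr _⟩
          · exact ⟨.inr false, hinr _, hαinr _⟩
      · rintro ⟨d | t, rfl, rfl⟩
        · rw [hinl, hαinl]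
          exact Or.inl d.adj
        · rw [hinr, hαinr]
          right
          cases t
          · exact (SimpleGraph.edge_adj _ _ _ _).2 ⟨Or.inr ⟨rfl, rfl⟩, hne.symm⟩
          · exact (SimpleGraph.edge_adj _ _ _ _).2 ⟨Or.inl ⟨rfl, rfl⟩, hne⟩)
    exact hG.2 v w hne hnadj ⟨R', O', hP', hO'⟩

end Join

/-! ### Segments of a drawing -/

section SegmentUnion

variable {E : Type*} [AddCommGroup E] [Module ℝ E]

/-- Parametrised by the line through two of its points, a segment is an interval; unions of
overlapping segments are thus computed in `ℝ`. -/
theorem exists_segment_eq_image {a b x y : E} (hxy : x ≠ y) (hx : x ∈ segment ℝ a b)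
    (hy : y ∈ segment ℝ a b) :
    ∃ s t : ℝ, segment ℝ a b = AffineMap.lineMap x y '' Set.uIcc s t := by
  rw [segment_eq_image_lineMap] at hx hy
  obtain ⟨p, -, rfl⟩ := hx
  obtain ⟨q, -, rfl⟩ := hy
  have hpq : q - p ≠ 0 := by
    intro h
    apply hxy
    rw [sub_eq_zero.1 h]
  refine ⟨-p / (q - p), (1 - p) / (q - p), ?_⟩
  rw [← segment_eq_uIcc, image_segment]
  congr 1
  · simp only [AffineMap.lineMap_apply_module]
    match_scalars <;> field_simp <;> ring
  · simp only [AffineMap.lineMap_apply_module]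
    match_scalars <;> field_simp <;> ring

theorem uIcc_union_uIcc {s t s' t' r : ℝ} (h : r ∈ Set.uIcc s t) (h' : r ∈ Set.uIcc s' t') :
    ∃ m n, m ≤ n ∧ Set.uIcc s t ∪ Set.uIcc s' t' = Set.uIcc m n := by
  rw [Set.uIcc, Set.mem_Icc] at h h'
  refine ⟨min (s ⊓ t) (s' ⊓ t'), max (s ⊔ t) (s' ⊔ t'), ?_, ?_⟩
  · exact (min_le_left _ _).trans ((h.1.trans h.2).trans (le_max_left _ _))
  · rw [Set.uIcc, Set.uIcc, Set.Icc_union_Icc', Set.uIcc_of_le]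
    · exact (min_le_left _ _).trans ((h.1.trans h.2).trans (le_max_left _ _))
    · exact h'.1.trans h.2
    · exact h.1.trans h'.2

/-- The union of two segments on a common line that meet is a segment. -/
theorem exists_segment_union {a b c d x y p : E} (hxy : x ≠ y) (hx : x ∈ segment ℝ a b)
    (hy : y ∈ segment ℝ a b) (hcd : ∃ s t : ℝ, segment ℝ c d = AffineMap.lineMap x y '' Set.uIcc s t)
    (hp : p ∈ segment ℝ a b) (hp' : p ∈ segment ℝ c d) :
    ∃ m n : E, m ≠ n ∧ segment ℝ a b ∪ segment ℝ c d = segment ℝ m n := by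
  obtain ⟨s, t, h1⟩ := exists_segment_eq_image hxy hx hy
  obtain ⟨s', t', h2⟩ := hcd
  have hinj := AffineMap.lineMap_injective ℝ hxy
  rw [h1] at hp
  rw [h2] at hp'
  obtain ⟨r, hr, rfl⟩ := hp
  obtain ⟨r', hr', hrr⟩ := hp'
  rw [hinj hrr] at hr'
  obtain ⟨m, n, hmn, hu⟩ := uIcc_union_uIcc hr hr'
  have hunion : segment ℝ a b ∪ segment ℝ c d =
      segment ℝ (AffineMap.lineMap x y m) (AffineMap.lineMap x y n) := by
    rw [h1, h2, ← Set.image_union, hu, ← segment_eq_uIcc, image_segment]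
  refine ⟨_, _, ?_, hunion⟩
  intro he
  rw [he, segment_same] at hunion
  have hx' : x ∈ segment ℝ a b ∪ segment ℝ c d := Or.inl hx
  have hy' : y ∈ segment ℝ a b ∪ segment ℝ c d := Or.inl hy
  rw [hunion] at hx' hy'
  exact hxy (hx'.trans hy'.symm)

end SegmentUnion

section Segments

variable {V : Type*} {G : SimpleGraph V}

/-- The closed line segment between the ends of an edge. -/
def edgeSeg (pos : V → Plane) : Sym2 V → Set Plane :=
  Sym2.lift ⟨fun v w => segment ℝ (pos v) (pos w), fun _ _ => segment_symm ℝ _ _⟩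

@[simp] theorem edgeSeg_mk (pos : V → Plane) (v w : V) :
    edgeSeg pos s(v, w) = segment ℝ (pos v) (pos w) := rfl

theorem Drawing.edgeLine_eq (D : Drawing G) : D.edgeLine = edgeSeg D.pos := rfl

/-- The edges in `S` cover a line segment. -/
def CoversSegment (pos : V → Plane) (S : Set (Sym2 V)) : Prop :=
  ∃ a b : Plane, a ≠ b ∧ ⋃ e ∈ S, edgeSeg pos e = segment ℝ a b

theorem edgeSeg_subset {pos : V → Plane} {S : Set (Sym2 V)} {a b : Plane}
    (h : ⋃ e ∈ S, edgeSeg pos e = segment ℝ a b) {e : Sym2 V} (he : e ∈ S) :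
    edgeSeg pos e ⊆ segment ℝ a b := by
  rw [← h]
  exact Set.subset_biUnion_of_mem he

theorem CoversSegment.singleton {pos : V → Plane} {x y : V} (h : pos x ≠ pos y) :
    CoversSegment pos {s(x, y)} :=
  ⟨pos x, pos y, h, by simp⟩

theorem CoversSegment.union {pos : V → Plane} {S T : Set (Sym2 V)} (hS : CoversSegment pos S)
    (hT : CoversSegment pos T) {x y : V} (hne : pos x ≠ pos y) (hxS : s(x, y) ∈ S)
    (hxT : s(x, y) ∈ T) : CoversSegment pos (S ∪ T) := by
  obtain ⟨a, b, -, h1⟩ := hS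
  obtain ⟨c, d, -, h2⟩ := hT
  have e1 := edgeSeg_subset h1 hxS
  have e2 := edgeSeg_subset h2 hxT
  have hx : pos x ∈ edgeSeg pos s(x, y) := left_mem_segment ℝ _ _
  have hy : pos y ∈ edgeSeg pos s(x, y) := right_mem_segment ℝ _ _
  obtain ⟨m, n, hmn, h⟩ := exists_segment_union hne (e1 hx) (e1 hy)
    (exists_segment_eq_image hne (e2 hx) (e2 hy)) (e1 hx) (e2 hx)
  exact ⟨m, n, hmn, by rw [Set.biUnion_union, h1, h2, h]⟩

/-- A set of edges that covers a segment can be extended straight beyond an end of an edge. -/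
theorem CoversSegment.insert {pos : V → Plane} {S : Set (Sym2 V)} (hS : CoversSegment pos S)
    {x z v : V} (hzx : pos z ≠ pos x) (hxS : s(z, x) ∈ S)
    (hv : pos x ∈ segment ℝ (pos z) (pos v)) : CoversSegment pos (insert s(x, v) S) := by
  obtain ⟨a, b, -, h1⟩ := hS
  have e1 := edgeSeg_subset h1 hxS
  have hz : pos z ∈ edgeSeg pos s(z, x) := left_mem_segment ℝ _ _
  have hx : pos x ∈ edgeSeg pos s(z, x) := right_mem_segment ℝ _ _
  have hxv : ∃ s t : ℝ, segment ℝ (pos x) (pos v) =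
      AffineMap.lineMap (pos z) (pos x) '' Set.uIcc s t := by
    rw [segment_eq_image_lineMap] at hv
    obtain ⟨r, hr, hrx⟩ := hv
    have hr0 : r ≠ 0 := by
      rintro rfl
      rw [AffineMap.lineMap_apply_zero] at hrx
      exact hzx hrx
    -- `pos x` is at parameter `r` between `pos z` and `pos v`, so on the line with `pos z` at 0 and
    -- `pos x` at 1 the point `pos v` has parameter `1 / r`.
    refine ⟨1, 1 / r, ?_⟩
    rw [← segment_eq_uIcc, image_segment, AffineMap.lineMap_apply_one]
    congr 1
    rw [← hrx]
    simp only [AffineMap.lineMap_apply_module]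
    match_scalars <;> field_simp <;> ring
  obtain ⟨m, n, hmn, h⟩ := exists_segment_union hzx (e1 hz) (e1 hx) hxv (e1 hx)
    (left_mem_segment ℝ _ _)
  exact ⟨m, n, hmn, by rw [Set.biUnion_insert, h1, Set.union_comm, edgeSeg_mk, h]⟩

theorem Drawing.pos_ne (D : Drawing G) {x y : V} (h : s(x, y) ∈ G.edgeSet) : D.pos x ≠ D.pos y :=
  fun he => (show G.Adj x y from h).ne (D.pos_injective he)

theorem Drawing.FormsSegment.union {D : Drawing G} {S T : Set (Sym2 V)} (hS : D.FormsSegment S)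
    (hT : D.FormsSegment T) {e : Sym2 V} (heS : e ∈ S) (heT : e ∈ T) : D.FormsSegment (S ∪ T) := by
  induction e with | _ x y
  exact ⟨Set.union_subset hS.1 hT.1,
    CoversSegment.union hS.2 hT.2 (D.pos_ne (hS.1 heS)) heS heT⟩

theorem Drawing.eq_of_mem_segments {D : Drawing G} {S T : Set (Sym2 V)} (hS : S ∈ D.segments)
    (hT : T ∈ D.segments) {e : Sym2 V} (heS : e ∈ S) (heT : e ∈ T) : S = T := by
  have h := Drawing.FormsSegment.union hS.1 hT.1 heS heT
  exact (Set.subset_union_left.antisymm (hS.2 h Set.subset_union_left)).trans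
    ((hT.2 h Set.subset_union_right).antisymm Set.subset_union_right)

theorem Drawing.FormsSegment.nonempty {D : Drawing G} {S : Set (Sym2 V)} (hS : D.FormsSegment S) :
    S.Nonempty := by
  obtain ⟨-, a, b, -, h⟩ := hS
  by_contra hne
  rw [Set.not_nonempty_iff_eq_empty] at hne
  rw [hne, Set.biUnion_empty] at h
  exact (h ▸ left_mem_segment ℝ a b : a ∈ (∅ : Set Plane))

theorem Drawing.segments_finite [Finite V] (D : Drawing G) : D.segments.Finite := Set.toFinite _

/-- A member of `F` that shares an edge with a maximal set lies inside it. Choosing one member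
inside each segment is injective, because distinct segments have no common edge. -/
theorem Drawing.numSegments_le [Finite V] (D : Drawing G) (F : Finset (Set (Sym2 V)))
    (hF : ∀ S ∈ F, D.FormsSegment S) (hcov : ∀ e ∈ G.edgeSet, ∃ S ∈ F, e ∈ S) :
    D.numSegments ≤ F.card := by
  classical
  have h : ∀ T ∈ D.segments, ∃ S ∈ F, S ⊆ T := by
    intro T hT
    obtain ⟨e, he⟩ := Drawing.FormsSegment.nonempty hT.1
    obtain ⟨S, hS, heS⟩ := hcov e (hT.1.1 he)
    refine ⟨S, hS, Set.subset_union_right.trans (hT.2 ?_ Set.subset_union_left)⟩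
    exact Drawing.FormsSegment.union hT.1 (hF S hS) he heS
  choose! f hf hfT using h
  rw [Drawing.numSegments, ← Set.ncard_coe_finset]
  refine Set.ncard_le_ncard_of_injOn f (fun T hT => hf T hT) ?_
  intro T hT T' hT' hTT
  obtain ⟨e, he⟩ := Drawing.FormsSegment.nonempty (hF _ (hf T hT))
  exact Drawing.eq_of_mem_segments hT hT' (hfT T hT he) (hfT T' hT' (hTT ▸ he))

theorem Drawing.exists_segment_mem [Finite V] (D : Drawing G) {e : Sym2 V} (he : e ∈ G.edgeSet) :
    ∃ S ∈ D.segments, e ∈ S := by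
  induction e with | _ x y
  have h : D.FormsSegment {s(x, y)} :=
    ⟨Set.singleton_subset_iff.2 he, CoversSegment.singleton (D.pos_ne he)⟩
  obtain ⟨S, hS, hmax⟩ := (Set.toFinite {S | D.FormsSegment S}).exists_le_maximal h
  exact ⟨S, hmax, hS rfl⟩

end Segments

/-! ### Star-shaped triangulated polygons -/

section StarPolygon

variable {V : Type*}

theorem exists_coords {x y : Plane} (h : ∀ a b : ℝ, a • x + b • y = 0 → a = 0 ∧ b = 0) :
    ∃ a b : Plane → ℝ, Continuous a ∧ Continuous b ∧ (∀ u, u = a u • x + b u • y) ∧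
      (∀ s t : ℝ, a (s • x + t • y) = s ∧ b (s • x + t • y) = t) ∧
      ∀ (t : ℝ) u, a (t • u) = t * a u ∧ b (t • u) = t * b u := by
  have hd : x 0 * y 1 - x 1 * y 0 ≠ 0 := by
    intro hd
    have h1 := h (y 1) (-x 1) (by
      ext i; fin_cases i
      · simp; linarith
      · simp; ring)
    have h2 := h (y 0) (-x 0) (by
      ext i; fin_cases i
      · simp; ring
      · simp; linarith)
    have h3 := h 1 0 (by
      ext i; fin_cases i
      · simpa using h2.2
      · simpa using h1.2)
    exact one_ne_zero h3.1
  refine ⟨fun u => (u 0 * y 1 - u 1 * y 0) / (x 0 * y 1 - x 1 * y 0),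
    fun u => (x 0 * u 1 - x 1 * u 0) / (x 0 * y 1 - x 1 * y 0), by fun_prop, by fun_prop, ?_, ?_, ?_⟩
  · intro u
    ext i; fin_cases i
    · simp only [Fin.zero_eta, PiLp.add_apply, PiLp.smul_apply, smul_eq_mul]
      rw [div_mul_eq_mul_div, div_mul_eq_mul_div, ← add_div, eq_div_iff hd]
      ring
    · simp only [Fin.mk_one, PiLp.add_apply, PiLp.smul_apply, smul_eq_mul]
      rw [div_mul_eq_mul_div, div_mul_eq_mul_div, ← add_div, eq_div_iff hd]
      ring
  · intro s t
    constructor <;> simp only [PiLp.add_apply, PiLp.smul_apply, smul_eq_mul] <;>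
      rw [div_eq_iff hd] <;> ring
  · intro t u
    constructor
    · simp; ring
    · simp; ring

/-- A triangulated polygon with vertices `U`, edges `A` and boundary edges `B` (in cyclic order),
drawn star-shaped around the origin; `g` is the gauge of the polygon. -/
structure StarPolygon (U : Set V) (A : Set (Sym2 V)) (B : Set (V × V)) (pos : V → Plane)
    (g : Plane → ℝ) : Prop where
  g_cont : Continuous g
  g_smul : ∀ (t : ℝ) u, 0 ≤ t → g (t • u) = t * g u
  g_pos : ∀ u, u ≠ 0 → 0 < g u
  indep : ∀ p ∈ B, ∀ a b : ℝ, a • pos p.1 + b • pos p.2 = 0 → a = 0 ∧ b = 0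
  g_wedge : ∀ p ∈ B, ∀ a b : ℝ, 0 ≤ a → 0 ≤ b → g (a • pos p.1 + b • pos p.2) = a + b
  cover : ∀ u, ∃ p ∈ B, ∃ a b : ℝ, 0 ≤ a ∧ 0 ≤ b ∧ u = a • pos p.1 + b • pos p.2
  disj : ∀ p ∈ B, ∀ q ∈ B, p ≠ q → ∀ a b a' b' : ℝ, 0 < a → 0 < b → 0 ≤ a' → 0 ≤ b' →
    a • pos p.1 + b • pos p.2 ≠ a' • pos q.1 + b' • pos q.2
  out : ∀ x ∈ U, ∃ y, (x, y) ∈ B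
  bdry : ∀ p ∈ B, s(p.1, p.2) ∈ A
  ends : ∀ x y, s(x, y) ∈ A → x ∈ U ∧ y ∈ U ∧ x ≠ y
  inj : Set.InjOn pos U
  edge_ne : ∀ e ∈ A, ∀ u ∈ edgeSeg pos e, u ≠ 0
  edge_le : ∀ e ∈ A, ∀ u ∈ edgeSeg pos e, g u ≤ 1
  plane : ∀ e ∈ A, ∀ f ∈ A, e ≠ f → ∀ u ∈ edgeSeg pos e ∩ edgeSeg pos f,
    ∃ v, v ∈ e ∧ v ∈ f ∧ u = pos v
  -- The prolongation of `z p.1` beyond `p.1` enters the cone of the boundary edge because `b < 0`,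
  -- and leaves the polygon because `a + b < 1`. The apex of a triangle glued to `p` is placed
  -- there.
  ext : ∀ p ∈ B, (∃ z, s(z, p.1) ∈ A ∧ ∃ a b : ℝ, b < 0 ∧ a + b < 1 ∧
      pos z = a • pos p.1 + b • pos p.2) ∨
    ∃ z, s(z, p.2) ∈ A ∧ ∃ a b : ℝ, b < 0 ∧ a + b < 1 ∧ pos z = a • pos p.2 + b • pos p.1

namespace StarPolygon

variable {U : Set V} {A : Set (Sym2 V)} {B : Set (V × V)} {pos : V → Plane} {g : Plane → ℝ}

theorem mem_of_pos_mem (h : StarPolygon U A B pos g) {u : V} (hu : u ∈ U) {f : Sym2 V}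
    (hf : f ∈ A) (huf : pos u ∈ edgeSeg pos f) : u ∈ f := by
  obtain ⟨y, hy⟩ := h.out u hu
  by_cases he : s(u, y) = f
  · rw [← he]; exact Sym2.mem_mk_left _ _
  · obtain ⟨w, hw, hwf, huw⟩ := h.plane _ (h.bdry _ hy) f hf he (pos u)
      ⟨left_mem_segment ℝ _ _, huf⟩
    have hwU : w ∈ U := by
      induction f with | _ p q
      rcases Sym2.mem_iff.1 hwf with rfl | rfl
      · exact (h.ends _ _ hf).1
      · exact (h.ends _ _ hf).2.1
    rwa [h.inj hu hwU huw]

theorem mem_edgeSeg {pos : V → Plane} {x y : V} {u : Plane} (hu : u ∈ edgeSeg pos s(x, y)) :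
    ∃ a b : ℝ, 0 ≤ a ∧ 0 ≤ b ∧ a + b = 1 ∧ u = a • pos x + b • pos y := by
  obtain ⟨a, b, ha, hb, hab, rfl⟩ := hu
  exact ⟨a, b, ha, hb, hab, rfl⟩

theorem g_eq_one (h : StarPolygon U A B pos g) {p : V × V} (hp : p ∈ B) {u : Plane}
    (hu : u ∈ edgeSeg pos s(p.1, p.2)) : g u = 1 := by
  obtain ⟨a, b, ha, hb, hab, rfl⟩ := mem_edgeSeg hu
  rw [h.g_wedge p hp a b ha hb, hab]

theorem edgeSeg_congr {pos pos' : V → Plane} (h : ∀ u ∈ U, pos' u = pos u) {x y : V}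
    (hx : x ∈ U) (hy : y ∈ U) : edgeSeg pos' s(x, y) = edgeSeg pos s(x, y) := by
  simp only [edgeSeg_mk, h x hx, h y hy]

theorem edgeSeg_congr_of_mem (hA : StarPolygon U A B pos g) {pos' : V → Plane}
    (h : ∀ u ∈ U, pos' u = pos u) {e : Sym2 V} (he : e ∈ A) :
    edgeSeg pos' e = edgeSeg pos e := by
  induction e with | _ x y
  exact edgeSeg_congr h (hA.ends _ _ he).1 (hA.ends _ _ he).2.1

/-- Gluing a triangle to the boundary edge `(x, y)`, with apex `α • pos x + β • pos y`. -/
theorem glue (h : StarPolygon U A B pos g) {x y v : V} (hxy : (x, y) ∈ B) (hv : v ∉ U)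
    {α β : ℝ} (hα : 0 < α) (hβ : 0 < β) (hαβ : 1 < α + β) {pos' : V → Plane}
    (hpos : ∀ u ∈ U, pos' u = pos u) (hposv : pos' v = α • pos x + β • pos y) :
    ∃ g', StarPolygon (insert v U) (A ∪ {s(x, v), s(v, y)})
      (B \ {(x, y)} ∪ {(x, v), (v, y)}) pos' g' := by
  obtain ⟨ca, cb, hca, hcb, hcoord, hc, hcs⟩ := exists_coords (h.indep _ hxy)
  have hca' : ∀ s t : ℝ, ca (s • pos x + t • pos y) = s := fun s t => (hc s t).1
  have hcb' : ∀ s t : ℝ, cb (s • pos x + t • pos y) = t := fun s t => (hc s t).2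
  have hxU : x ∈ U := (h.ends _ _ (h.bdry _ hxy)).1
  have hyU : y ∈ U := (h.ends _ _ (h.bdry _ hxy)).2.1
  have hBU : ∀ p ∈ B, p.1 ∈ U ∧ p.2 ∈ U := fun p hp =>
    ⟨(h.ends _ _ (h.bdry _ hp)).1, (h.ends _ _ (h.bdry _ hp)).2.1⟩
  have hX : pos' x = pos x := hpos x hxU
  have hY : pos' y = pos y := hpos y hyU
  have hxv : x ≠ v := by rintro rfl; exact hv hxU
  have hyv : y ≠ v := by rintro rfl; exact hv hyU
  have hxney : x ≠ y := (h.ends _ _ (h.bdry _ hxy)).2.2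
  -- points of the two new wedges in terms of the old one
  have hxP : ∀ s t : ℝ, s • pos' x + t • pos' v = (s + t * α) • pos x + (t * β) • pos y := by
    intro s t; rw [hX, hposv]; module
  have hPy : ∀ s t : ℝ, s • pos' v + t • pos' y = (s * α) • pos x + (s * β + t) • pos y := by
    intro s t; rw [hY, hposv]; module
  have hold : ∀ p ∈ B, ∀ a b : ℝ, a • pos' p.1 + b • pos' p.2 = a • pos p.1 + b • pos p.2 := by
    intro p hp a b
    rw [hpos _ (hBU p hp).1, hpos _ (hBU p hp).2]
  -- Only the cone of the old edge needs correction. In it the minimum is the coefficient of the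
  -- apex in the decomposition over the two new cones, and `g` exceeds the desired value by `α + β -
  -- 1` times this coefficient.
  let g' : Plane → ℝ := fun u => g u - (α + β - 1) * max 0 (min (ca u / α) (cb u / β))
  have hg'def : ∀ u, g' u = g u - (α + β - 1) * max 0 (min (ca u / α) (cb u / β)) := fun _ => rfl
  have hg'le : ∀ u, g' u ≤ g u := by
    intro u
    have : 0 ≤ (α + β - 1) * max 0 (min (ca u / α) (cb u / β)) :=
      mul_nonneg (by linarith) (le_max_left _ _)
    rw [hg'def]; linarith
  have hg'1 : ∀ s t : ℝ, 0 ≤ s → 0 ≤ t → g' (s • pos' x + t • pos' v) = s + t := by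
    intro s t hs ht
    rw [hg'def, hxP, hca', hcb', h.g_wedge _ hxy _ _ (by positivity) (by positivity)]
    have h1 : t * β / β = t := by field_simp
    have h2 : t ≤ (s + t * α) / α := by rw [le_div_iff₀ hα]; linarith
    rw [h1, min_eq_right h2, max_eq_right ht]
    ring
  have hg'2 : ∀ s t : ℝ, 0 ≤ s → 0 ≤ t → g' (s • pos' v + t • pos' y) = s + t := by
    intro s t hs ht
    rw [hg'def, hPy, hca', hcb', h.g_wedge _ hxy _ _ (by positivity) (by positivity)]
    have h1 : s * α / α = s := by field_simp
    have h2 : s ≤ (s * β + t) / β := by rw [le_div_iff₀ hβ]; linarith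
    rw [h1, min_eq_left h2, max_eq_right hs]
    ring
  have hg'3 : ∀ u, ca u ≤ 0 ∨ cb u ≤ 0 → g' u = g u := by
    intro u hu
    have : min (ca u / α) (cb u / β) ≤ 0 := by
      rcases hu with hu | hu
      · exact (min_le_left _ _).trans (div_nonpos_of_nonpos_of_nonneg hu hα.le)
      · exact (min_le_right _ _).trans (div_nonpos_of_nonpos_of_nonneg hu hβ.le)
    rw [hg'def, max_eq_left this]; ring
  -- The ray through the apex divides the old cone; the side is decided by comparing `a / α` with `b
  -- / β`.
  have hsplit : ∀ a b : ℝ, 0 ≤ a → 0 ≤ b →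
      (∃ s t : ℝ, 0 ≤ s ∧ 0 ≤ t ∧ a • pos x + b • pos y = s • pos' x + t • pos' v) ∨
      ∃ s t : ℝ, 0 ≤ s ∧ 0 ≤ t ∧ a • pos x + b • pos y = s • pos' v + t • pos' y := by
    intro a b ha hb
    rcases le_total (b / β) (a / α) with hle | hle
    · left
      rw [div_le_div_iff₀ hβ hα] at hle
      refine ⟨a - b / β * α, b / β, ?_, by positivity, ?_⟩
      · rw [sub_nonneg, div_mul_eq_mul_div, div_le_iff₀ hβ]; linarith
      · rw [hxP]; congr 2
        · ring
        · field_simp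
    · right
      rw [div_le_div_iff₀ hα hβ] at hle
      refine ⟨a / α, b - a / α * β, by positivity, ?_, ?_⟩
      · rw [sub_nonneg, div_mul_eq_mul_div, div_le_iff₀ hα]; linarith
      · rw [hPy]; congr 2
        · field_simp
        · ring
  have hwedge_old : ∀ q ∈ B, q ≠ (x, y) → ∀ a b : ℝ, 0 ≤ a → 0 ≤ b →
      ca (a • pos q.1 + b • pos q.2) ≤ 0 ∨ cb (a • pos q.1 + b • pos q.2) ≤ 0 := by
    intro q hq hne a b ha hb
    by_contra! hcon
    exact h.disj _ hxy q hq hne.symm _ _ a b hcon.1 hcon.2 ha hb (hcoord _).symm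
  have hg0 : g' 0 = 0 := by
    have h1 := h.g_smul 0 0 le_rfl
    have h2 := (hcs 0 0).1
    rw [zero_smul, zero_mul] at h1 h2
    rw [hg'3 0 (Or.inl h2.le), h1]
  have hnewseg1 : ∀ u ∈ edgeSeg pos' s(x, v), ∃ t : ℝ, 0 ≤ t ∧ t ≤ 1 ∧
      u = (1 - t + t * α) • pos x + (t * β) • pos y ∧ g' u = 1 ∧ g u = 1 + t * (α + β - 1) := by
    intro u hu
    obtain ⟨a, t, ha, ht, hat, rfl⟩ := mem_edgeSeg hu
    obtain rfl : a = 1 - t := by linarith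
    refine ⟨t, ht, by linarith, hxP _ _, ?_, ?_⟩
    · rw [hg'1 _ _ ha ht]; ring
    · rw [hxP, h.g_wedge _ hxy _ _ (by positivity) (by positivity)]; ring
  have hnewseg2 : ∀ u ∈ edgeSeg pos' s(v, y), ∃ t : ℝ, 0 ≤ t ∧ t ≤ 1 ∧
      u = (t * α) • pos x + (t * β + (1 - t)) • pos y ∧ g' u = 1 ∧
        g u = 1 + t * (α + β - 1) := by
    intro u hu
    obtain ⟨t, b, ht, hb, htb, rfl⟩ := mem_edgeSeg hu
    obtain rfl : b = 1 - t := by linarith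
    refine ⟨t, ht, by linarith, hPy _ _, ?_, ?_⟩
    · rw [hg'2 _ _ ht hb]; ring
    · rw [hPy, h.g_wedge _ hxy _ _ (by positivity) (by positivity)]; ring
  -- Along a new edge `g` grows strictly from its value 1 at the old end, whereas `g ≤ 1` on all old
  -- edges: they can meet at that end only.
  have hplane1 : ∀ f ∈ A, ∀ u ∈ edgeSeg pos' s(x, v), u ∈ edgeSeg pos' f → x ∈ f ∧ u = pos' x := by
    intro f hf u hu huf
    rw [edgeSeg_congr_of_mem h hpos hf] at huf
    obtain ⟨t, ht, -, hu', -, hgu⟩ := hnewseg1 u hu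
    have hle := h.edge_le f hf u huf
    rw [hgu] at hle
    have ht0 : t = 0 := by nlinarith
    have hux : u = pos x := by rw [hu', ht0]; simp
    exact ⟨h.mem_of_pos_mem hxU hf (hux ▸ huf), by rw [hux, hX]⟩
  have hplane2 : ∀ f ∈ A, ∀ u ∈ edgeSeg pos' s(v, y), u ∈ edgeSeg pos' f → y ∈ f ∧ u = pos' y := by
    intro f hf u hu huf
    rw [edgeSeg_congr_of_mem h hpos hf] at huf
    obtain ⟨t, ht, -, hu', -, hgu⟩ := hnewseg2 u hu
    have hle := h.edge_le f hf u huf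
    rw [hgu] at hle
    have ht0 : t = 0 := by nlinarith
    have huy : u = pos y := by rw [hu', ht0]; simp
    exact ⟨h.mem_of_pos_mem hyU hf (huy ▸ huf), by rw [huy, hY]⟩
  have hplane3 : ∀ u ∈ edgeSeg pos' s(x, v), u ∈ edgeSeg pos' s(v, y) → u = pos' v := by
    intro u hu hu2
    obtain ⟨t, ht, ht1, hu', -, -⟩ := hnewseg1 u hu
    obtain ⟨s, hs, hs1, hu2', -, -⟩ := hnewseg2 u hu2
    have e1 : 1 - t + t * α = s * α := by rw [← hca' (1 - t + t * α) (t * β), ← hu', hu2', hca']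
    have e2 : t * β = s * β + (1 - s) := by rw [← hcb' (1 - t + t * α) (t * β), ← hu', hu2', hcb']
    have hts : s ≤ t := by nlinarith
    have ht1 : t = 1 := by nlinarith
    rw [hu', ht1, hposv]; simp
  have hv_notMem : ∀ f ∈ A, v ∉ f := by
    intro f hf hvf
    induction f with | _ p q
    rcases Sym2.mem_iff.1 hvf with rfl | rfl
    · exact hv (h.ends _ _ hf).1
    · exact hv (h.ends _ _ hf).2.1
  refine ⟨g', ?_, ?_, ?_, ?_, ?_, ?_, ?_, ?_, ?_, ?_, ?_, ?_, ?_, ?_, ?_⟩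
  · have := h.g_cont
    fun_prop
  · intro t u ht
    rw [hg'def, hg'def, h.g_smul t u ht, (hcs t u).1, (hcs t u).2, mul_div_assoc, mul_div_assoc,
      ← mul_min_of_nonneg _ _ ht]
    nth_rewrite 1 [← mul_zero t]
    rw [← mul_max_of_nonneg _ _ ht]
    ring
  · intro u hu
    by_cases hneg : ca u ≤ 0 ∨ cb u ≤ 0
    · rw [hg'3 u hneg]
      exact h.g_pos u hu
    · push Not at hneg
      rw [hcoord u] at hu ⊢
      rcases hsplit (ca u) (cb u) hneg.1.le hneg.2.le with ⟨s, t, hs, ht, he⟩ | ⟨s, t, hs, ht, he⟩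
      · rw [he] at hu ⊢
        rw [hg'1 s t hs ht]
        rcases hs.lt_or_eq with hs | rfl
        · linarith
        · rcases ht.lt_or_eq with ht | rfl
          · linarith
          · simp at hu
      · rw [he] at hu ⊢
        rw [hg'2 s t hs ht]
        rcases hs.lt_or_eq with hs | rfl
        · linarith
        · rcases ht.lt_or_eq with ht | rfl
          · linarith
          · simp at hu
  · rintro p (⟨hp, -⟩ | rfl | rfl) a b hab
    · rw [hold p hp] at hab
      exact h.indep p hp a b hab
    · dsimp only at hab
      rw [hxP] at hab
      obtain ⟨h1, h2⟩ := h.indep _ hxy _ _ hab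
      have hb : b = 0 := (mul_eq_zero.1 h2).resolve_right hβ.ne'
      subst hb
      exact ⟨by linarith, rfl⟩
    · dsimp only at hab
      rw [hPy] at hab
      obtain ⟨h1, h2⟩ := h.indep _ hxy _ _ hab
      have ha : a = 0 := (mul_eq_zero.1 h1).resolve_right hα.ne'
      subst ha
      exact ⟨rfl, by linarith⟩
  · rintro p (⟨hp, hne⟩ | rfl | rfl) a b ha hb
    · rw [hold p hp, hg'3 _ (hwedge_old p hp hne a b ha hb)]
      exact h.g_wedge p hp a b ha hb
    · exact hg'1 a b ha hb
    · exact hg'2 a b ha hb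
  · intro u
    obtain ⟨p, hp, a, b, ha, hb, hu⟩ := h.cover u
    by_cases hne : p = (x, y)
    · subst hne
      rcases hsplit a b ha hb with ⟨s, t, hs, ht, he⟩ | ⟨s, t, hs, ht, he⟩
      · exact ⟨(x, v), by simp, s, t, hs, ht, hu.trans he⟩
      · exact ⟨(v, y), by simp, s, t, hs, ht, hu.trans he⟩
    · exact ⟨p, Or.inl ⟨hp, hne⟩, a, b, ha, hb, by rw [hold p hp, hu]⟩
  · rintro p (⟨hp, hpne⟩ | rfl | rfl) q (⟨hq, hqne⟩ | rfl | rfl) hpq a b a' b' ha hb ha' hb' heq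
    · rw [hold p hp, hold q hq] at heq
      exact h.disj p hp q hq hpq a b a' b' ha hb ha' hb' heq
    · rw [hold p hp] at heq
      dsimp only at heq
      rw [hxP] at heq
      exact h.disj p hp _ hxy hpne a b _ _ ha hb (by positivity) (by positivity) heq
    · rw [hold p hp] at heq
      dsimp only at heq
      rw [hPy] at heq
      exact h.disj p hp _ hxy hpne a b _ _ ha hb (by positivity) (by positivity) heq
    · rw [hold q hq] at heq
      dsimp only at heq
      rw [hxP] at heq
      exact h.disj _ hxy q hq (Ne.symm hqne) _ _ a' b' (by positivity) (by positivity) ha' hb' heq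
    · exact hpq rfl
    · dsimp only at heq
      rw [hxP, hPy] at heq
      have e1 : a + b * α = a' * α := by rw [← hca' (a + b * α) (b * β), heq, hca']
      have e2 : b * β = a' * β + b' := by rw [← hcb' (a + b * α) (b * β), heq, hcb']
      have : a' ≤ b := by nlinarith
      nlinarith
    · rw [hold q hq] at heq
      dsimp only at heq
      rw [hPy] at heq
      exact h.disj _ hxy q hq (Ne.symm hqne) _ _ a' b' (by positivity) (by positivity) ha' hb' heq
    · dsimp only at heq
      rw [hxP, hPy] at heq
      have e1 : a * α = a' + b' * α := by rw [← hca' (a * α) (a * β + b), heq, hca']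
      have e2 : a * β + b = b' * β := by rw [← hcb' (a * α) (a * β + b), heq, hcb']
      have : b' ≤ a := by nlinarith
      nlinarith
    · exact hpq rfl
  · rintro z (rfl | hz)
    · exact ⟨y, by simp⟩
    · obtain ⟨w, hw⟩ := h.out z hz
      by_cases hzx : z = x
      · exact ⟨v, by simp [hzx]⟩
      · exact ⟨w, Or.inl ⟨hw, fun he => hzx (congrArg Prod.fst he)⟩⟩
  · rintro p (⟨hp, -⟩ | rfl | rfl)
    · exact Or.inl (h.bdry p hp)
    · simp
    · simp
  · rintro p q (hpq | hpq | hpq)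
    · obtain ⟨h1, h2, h3⟩ := h.ends p q hpq
      exact ⟨Or.inr h1, Or.inr h2, h3⟩
    · rcases Sym2.eq_iff.1 hpq with ⟨rfl, rfl⟩ | ⟨rfl, rfl⟩
      · exact ⟨Or.inr hxU, Or.inl rfl, hxv⟩
      · exact ⟨Or.inl rfl, Or.inr hxU, hxv.symm⟩
    · rcases Sym2.eq_iff.1 hpq with ⟨rfl, rfl⟩ | ⟨rfl, rfl⟩
      · exact ⟨Or.inl rfl, Or.inr hyU, hyv.symm⟩
      · exact ⟨Or.inr hyU, Or.inl rfl, hyv⟩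
  · have hgU : ∀ z ∈ U, g (pos z) = 1 := by
      intro z hz
      obtain ⟨w, hw⟩ := h.out z hz
      exact h.g_eq_one hw (left_mem_segment ℝ _ _)
    have hgv : g (pos' v) = α + β := by
      rw [hposv, h.g_wedge _ hxy _ _ hα.le hβ.le]
    rintro z (rfl | hz) w (rfl | hw) he
    · rfl
    · rw [hpos w hw] at he
      have := hgU w hw
      rw [← he, hgv] at this
      linarith
    · rw [hpos z hz] at he
      have := hgU z hz
      rw [he, hgv] at this
      linarith
    · rw [hpos z hz, hpos w hw] at he
      exact h.inj hz hw he
  · rintro e (he | rfl | rfl) u hu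
    · rw [edgeSeg_congr_of_mem h hpos he] at hu
      exact h.edge_ne e he u hu
    · rintro rfl
      obtain ⟨-, -, -, -, h1, -⟩ := hnewseg1 _ hu
      rw [hg0] at h1
      exact zero_ne_one h1
    · rintro rfl
      obtain ⟨-, -, -, -, h1, -⟩ := hnewseg2 _ hu
      rw [hg0] at h1
      exact zero_ne_one h1
  · rintro e (he | rfl | rfl) u hu
    · rw [edgeSeg_congr_of_mem h hpos he] at hu
      exact (hg'le u).trans (h.edge_le e he u hu)
    · obtain ⟨-, -, -, -, h1, -⟩ := hnewseg1 _ hu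
      exact h1.le
    · obtain ⟨-, -, -, -, h1, -⟩ := hnewseg2 _ hu
      exact h1.le
  · rintro e (he | rfl | rfl) f (hf | rfl | rfl) hef u ⟨hue, huf⟩
    · rw [edgeSeg_congr_of_mem h hpos he] at hue
      rw [edgeSeg_congr_of_mem h hpos hf] at huf
      obtain ⟨z, hze, hzf, huz⟩ := h.plane e he f hf hef u ⟨hue, huf⟩
      refine ⟨z, hze, hzf, huz.trans (hpos z ?_).symm⟩
      induction e with | _ p q
      rcases Sym2.mem_iff.1 hze with rfl | rfl
      · exact (h.ends _ _ he).1
      · exact (h.ends _ _ he).2.1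
    · obtain ⟨h1, h2⟩ := hplane1 e he u huf hue
      exact ⟨x, h1, Sym2.mem_mk_left _ _, h2⟩
    · obtain ⟨h1, h2⟩ := hplane2 e he u huf hue
      exact ⟨y, h1, Sym2.mem_mk_right _ _, h2⟩
    · obtain ⟨h1, h2⟩ := hplane1 f hf u hue huf
      exact ⟨x, Sym2.mem_mk_left _ _, h1, h2⟩
    · exact absurd rfl hef
    · exact ⟨v, Sym2.mem_mk_right _ _, Sym2.mem_mk_left _ _, hplane3 u hue huf⟩
    · obtain ⟨h1, h2⟩ := hplane2 f hf u hue huf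
      exact ⟨y, Sym2.mem_mk_right _ _, h1, h2⟩
    · exact ⟨v, Sym2.mem_mk_left _ _, Sym2.mem_mk_right _ _, hplane3 u huf hue⟩
    · exact absurd rfl hef
  · rintro p (⟨hp, -⟩ | rfl | rfl)
    · rcases h.ext p hp with ⟨z, hz, a, b, hb, hab, he⟩ | ⟨z, hz, a, b, hb, hab, he⟩
      · left
        refine ⟨z, Or.inl hz, a, b, hb, hab, ?_⟩
        rw [hpos _ (hBU p hp).1, hpos _ (hBU p hp).2, hpos _ (h.ends _ _ hz).1, he]
      · right
        refine ⟨z, Or.inl hz, a, b, hb, hab, ?_⟩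
        rw [hpos _ (hBU p hp).1, hpos _ (hBU p hp).2, hpos _ (h.ends _ _ hz).1, he]
    · right
      -- At the apex each new side serves the other: `y v` prolonged beyond `v` enters the cone of
      -- `x v`, and vice versa. The condition `a + b < 1` amounts to `1 < α + β`.
      refine ⟨y, by simp [Sym2.eq_swap], 1 / β, -α / β, ?_, ?_, ?_⟩
      · exact div_neg_of_neg_of_pos (by linarith) hβ
      · rw [← add_div, div_lt_one hβ]; linarith
      · dsimp only
        rw [hX, hY, hposv]
        match_scalars <;> field_simp <;> ring
    · left
      refine ⟨x, by simp, 1 / α, -β / α, ?_, ?_, ?_⟩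
      · exact div_neg_of_neg_of_pos (by linarith) hα
      · rw [← add_div, div_lt_one hα]; linarith
      · dsimp only
        rw [hX, hY, hposv]
        match_scalars <;> field_simp <;> ring

end StarPolygon

end StarPolygon

/-! ### Drawing an ear decomposition with one new segment for each new vertex -/

section EarDrawing

variable {V : Type*}

/-- The origin is the centroid, and each of the three linear forms equals one on one side. The
positions sum to zero, so each corner is minus the sum of the other two, which gives `ext` with both
coefficients `-1`. -/
theorem starPolygon_triangle {a b c : V} (hab : a ≠ b) (hbc : b ≠ c) (hca : c ≠ a)
    {pos : V → Plane} (ha : pos a = !₂[1, 0]) (hb : pos b = !₂[0, 1]) (hc : pos c = !₂[-1, -1]) :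
    StarPolygon {a, b, c} {s(a, b), s(b, c), s(c, a)} {(a, b), (b, c), (c, a)} pos
      fun u => max (u 0 + u 1) (max (-2 * u 0 + u 1) (u 0 - 2 * u 1)) := by
  have kab : ∀ s t : ℝ, s • pos a + t • pos b = !₂[s, t] := by
    intro s t; rw [ha, hb]; ext i; fin_cases i <;> simp
  have kbc : ∀ s t : ℝ, s • pos b + t • pos c = !₂[-t, s - t] := by
    intro s t; rw [hb, hc]; ext i; fin_cases i <;> simp [sub_eq_add_neg]
  have kca : ∀ s t : ℝ, s • pos c + t • pos a = !₂[t - s, -s] := by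
    intro s t; rw [hc, ha]; ext i; fin_cases i <;> simp; ring
  have hext : ∀ p q r s : ℝ, (!₂[p, q] : Plane) = !₂[r, s] → p = r ∧ q = s := by
    intro p q r s h
    exact ⟨by simpa using congrArg (fun u : Plane => u 0) h,
      by simpa using congrArg (fun u : Plane => u 1) h⟩
  have hzero : ∀ p q : ℝ, (!₂[p, q] : Plane) = 0 → p = 0 ∧ q = 0 := by
    intro p q h
    exact ⟨by simpa using congrArg (fun u : Plane => u 0) h,
      by simpa using congrArg (fun u : Plane => u 1) h⟩
  have hu : ∀ u : Plane, u = !₂[u 0, u 1] := by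
    intro u; ext i; fin_cases i <;> simp
  have gab : ∀ s t : ℝ, 0 ≤ s → 0 ≤ t → max (s + t) (max (-2 * s + t) (s - 2 * t)) = s + t := by
    intro s t hs ht
    exact max_eq_left (max_le (by linarith) (by linarith))
  have gbc : ∀ s t : ℝ, 0 ≤ s → 0 ≤ t →
      max (-t + (s - t)) (max (-2 * -t + (s - t)) (-t - 2 * (s - t))) = s + t := by
    intro s t hs ht
    rw [max_eq_left (a := -2 * -t + (s - t)) (by linarith), max_eq_right (by linarith)]
    ring
  have gca : ∀ s t : ℝ, 0 ≤ s → 0 ≤ t →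
      max (t - s + -s) (max (-2 * (t - s) + -s) (t - s - 2 * -s)) = s + t := by
    intro s t hs ht
    rw [max_eq_right (a := -2 * (t - s) + -s) (by linarith), max_eq_right (by linarith)]
    ring
  have pab : ∀ u, u ∈ edgeSeg pos s(a, b) → ∃ s t : ℝ, 0 ≤ s ∧ 0 ≤ t ∧ s + t = 1 ∧ u = !₂[s, t] := by
    intro u hu
    obtain ⟨s, t, hs, ht, hst, rfl⟩ := StarPolygon.mem_edgeSeg hu
    exact ⟨s, t, hs, ht, hst, kab s t⟩
  have pbc : ∀ u, u ∈ edgeSeg pos s(b, c) →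
      ∃ s t : ℝ, 0 ≤ s ∧ 0 ≤ t ∧ s + t = 1 ∧ u = !₂[-t, s - t] := by
    intro u hu
    obtain ⟨s, t, hs, ht, hst, rfl⟩ := StarPolygon.mem_edgeSeg hu
    exact ⟨s, t, hs, ht, hst, kbc s t⟩
  have pca : ∀ u, u ∈ edgeSeg pos s(c, a) →
      ∃ s t : ℝ, 0 ≤ s ∧ 0 ≤ t ∧ s + t = 1 ∧ u = !₂[t - s, -s] := by
    intro u hu
    obtain ⟨s, t, hs, ht, hst, rfl⟩ := StarPolygon.mem_edgeSeg hu
    exact ⟨s, t, hs, ht, hst, kca s t⟩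
  have iabc : ∀ u, u ∈ edgeSeg pos s(a, b) → u ∈ edgeSeg pos s(b, c) → u = pos b := by
    intro u h1 h2
    obtain ⟨s, t, hs, ht, hst, rfl⟩ := pab u h1
    obtain ⟨s', t', hs', ht', hst', he⟩ := pbc _ h2
    obtain ⟨e1, e2⟩ := hext _ _ _ _ he
    rw [hb, show s = 0 by linarith, show t = 1 by linarith]
  have ibca : ∀ u, u ∈ edgeSeg pos s(b, c) → u ∈ edgeSeg pos s(c, a) → u = pos c := by
    intro u h1 h2
    obtain ⟨s, t, hs, ht, hst, rfl⟩ := pbc u h1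
    obtain ⟨s', t', hs', ht', hst', he⟩ := pca _ h2
    obtain ⟨e1, e2⟩ := hext _ _ _ _ he
    rw [hc, show s = 0 by linarith, show t = 1 by linarith]
    norm_num
  have icab : ∀ u, u ∈ edgeSeg pos s(c, a) → u ∈ edgeSeg pos s(a, b) → u = pos a := by
    intro u h1 h2
    obtain ⟨s, t, hs, ht, hst, rfl⟩ := pca u h1
    obtain ⟨s', t', hs', ht', hst', he⟩ := pab _ h2
    obtain ⟨e1, e2⟩ := hext _ _ _ _ he
    rw [ha, show s = 0 by linarith, show t = 1 by linarith]
    norm_num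
  refine ⟨by fun_prop, ?_, ?_, ?_, ?_, ?_, ?_, ?_, ?_, ?_, ?_, ?_, ?_, ?_, ?_⟩
  · intro t u ht
    simp only [PiLp.smul_apply, smul_eq_mul]
    rw [mul_max_of_nonneg _ _ ht, mul_max_of_nonneg _ _ ht]
    congr 1
    · ring
    · congr 1 <;> ring
  · intro u hne
    by_contra! hcon
    have h1 := (le_max_left _ _).trans hcon
    have h2 := ((le_max_left _ _).trans (le_max_right _ _)).trans hcon
    have h3 := ((le_max_right _ _).trans (le_max_right _ _)).trans hcon
    apply hne
    rw [hu u, show u 0 = 0 by linarith, show u 1 = 0 by linarith]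
    ext i; fin_cases i <;> simp
  · rintro p (rfl | rfl | rfl) s t h
    · exact hzero _ _ ((kab s t).symm.trans h)
    · obtain ⟨h1, h2⟩ := hzero _ _ ((kbc s t).symm.trans h)
      exact ⟨by linarith, by linarith⟩
    · obtain ⟨h1, h2⟩ := hzero _ _ ((kca s t).symm.trans h)
      exact ⟨by linarith, by linarith⟩
  · rintro p (rfl | rfl | rfl) s t hs ht
    · dsimp only; rw [kab]; exact gab s t hs ht
    · dsimp only; rw [kbc]; exact gbc s t hs ht
    · dsimp only; rw [kca]; exact gca s t hs ht
  · intro u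
    by_cases h1 : 0 ≤ u 0 ∧ 0 ≤ u 1
    · exact ⟨(a, b), by simp, u 0, u 1, h1.1, h1.2, (hu u).trans (kab _ _).symm⟩
    · by_cases h2 : u 0 ≤ u 1
      · refine ⟨(b, c), by simp, u 1 - u 0, -u 0, by linarith, ?_, ?_⟩
        · by_contra! h3
          exact h1 ⟨by linarith, by linarith⟩
        · refine (hu u).trans (Eq.trans ?_ (kbc _ _).symm)
          ext i; fin_cases i <;> simp
      · refine ⟨(c, a), by simp, -u 1, u 0 - u 1, ?_, by linarith, ?_⟩
        · by_contra! h3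
          exact h1 ⟨by linarith, by linarith⟩
        · refine (hu u).trans (Eq.trans ?_ (kca _ _).symm)
          ext i; fin_cases i <;> simp
  · rintro p (rfl | rfl | rfl) q (rfl | rfl | rfl) hpq s t s' t' hs ht hs' ht' heq <;>
      first
      | exact hpq rfl
      | (dsimp only at heq
         simp only [kab, kbc, kca] at heq
         obtain ⟨e1, e2⟩ := hext _ _ _ _ heq
         linarith)
  · rintro x (rfl | rfl | rfl)
    · exact ⟨b, by simp⟩
    · exact ⟨c, by simp⟩
    · exact ⟨a, by simp⟩
  · rintro p (rfl | rfl | rfl) <;> simp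
  · rintro x y (h | h | h) <;> rcases Sym2.eq_iff.1 h with ⟨rfl, rfl⟩ | ⟨rfl, rfl⟩ <;>
      simp [hab, hbc, hca, hab.symm, hbc.symm, hca.symm]
  · have nab : pos a ≠ pos b := by
      rw [ha, hb]; intro h; have := (hext _ _ _ _ h).1; norm_num at this
    have nbc : pos b ≠ pos c := by
      rw [hb, hc]; intro h; have := (hext _ _ _ _ h).1; norm_num at this
    have nca : pos c ≠ pos a := by
      rw [hc, ha]; intro h; have := (hext _ _ _ _ h).1; norm_num at this
    rintro x (rfl | rfl | rfl) y (rfl | rfl | rfl) h <;>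
      first
      | rfl | exact absurd h nab | exact absurd h nbc | exact absurd h nca
      | exact absurd h.symm nab | exact absurd h.symm nbc | exact absurd h.symm nca
  · rintro e (rfl | rfl | rfl) u hue rfl
    · obtain ⟨s, t, hs, ht, hst, h⟩ := pab _ hue
      obtain ⟨e1, e2⟩ := hzero _ _ h.symm
      linarith
    · obtain ⟨s, t, hs, ht, hst, h⟩ := pbc _ hue
      obtain ⟨e1, e2⟩ := hzero _ _ h.symm
      linarith
    · obtain ⟨s, t, hs, ht, hst, h⟩ := pca _ hue
      obtain ⟨e1, e2⟩ := hzero _ _ h.symm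
      linarith
  · rintro e (rfl | rfl | rfl) u hue
    · obtain ⟨s, t, hs, ht, hst, rfl⟩ := pab _ hue
      exact (gab s t hs ht).le.trans hst.le
    · obtain ⟨s, t, hs, ht, hst, rfl⟩ := pbc _ hue
      exact (gbc s t hs ht).le.trans hst.le
    · obtain ⟨s, t, hs, ht, hst, rfl⟩ := pca _ hue
      exact (gca s t hs ht).le.trans hst.le
  · rintro e (rfl | rfl | rfl) f (rfl | rfl | rfl) hef u ⟨hue, huf⟩
    · exact absurd rfl hef
    · exact ⟨b, by simp, by simp, iabc u hue huf⟩
    · exact ⟨a, by simp, by simp, icab u huf hue⟩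
    · exact ⟨b, by simp, by simp, iabc u huf hue⟩
    · exact absurd rfl hef
    · exact ⟨c, by simp, by simp, ibca u hue huf⟩
    · exact ⟨a, by simp, by simp, icab u hue huf⟩
    · exact ⟨c, by simp, by simp, ibca u huf hue⟩
    · exact absurd rfl hef
  · have hsum : pos a + pos b + pos c = 0 := by
      rw [ha, hb, hc]; ext i; fin_cases i <;> simp
    have h3 : ∀ x y z : V, pos x + pos y + pos z = 0 →
        pos z = (-1 : ℝ) • pos x + (-1 : ℝ) • pos y := by
      intro x y z h
      have : pos z = (pos x + pos y + pos z) + ((-1 : ℝ) • pos x + (-1 : ℝ) • pos y) := by module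
      rw [this, h, zero_add]
    rintro p (rfl | rfl | rfl) <;> left
    · exact ⟨c, by simp, -1, -1, by norm_num, by norm_num, h3 _ _ _ hsum⟩
    · exact ⟨a, by simp, -1, -1, by norm_num, by norm_num, h3 _ _ _ (by rw [← hsum]; abel)⟩
    · exact ⟨b, by simp, -1, -1, by norm_num, by norm_num, h3 _ _ _ (by rw [← hsum]; abel)⟩

/-- `F` is a family of sets of edges, each of which covers a segment, with union `A`. -/
def SegmentCover (pos : V → Plane) (A : Set (Sym2 V)) (F : Finset (Set (Sym2 V))) : Prop :=
  (∀ S ∈ F, S ⊆ A ∧ CoversSegment pos S) ∧ ∀ e ∈ A, ∃ S ∈ F, e ∈ S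

/-- The edge `x v` is absorbed by the member `S₀` that contains `z x`; only `y v` needs a new
member. -/
theorem SegmentCover.glue {pos pos' : V → Plane} {A A' : Set (Sym2 V)} {F : Finset (Set (Sym2 V))}
    (h : SegmentCover pos A F) (hcongr : ∀ e ∈ A, edgeSeg pos' e = edgeSeg pos e) {x y z v : V}
    (hzA : s(z, x) ∈ A) (hzx : pos' z ≠ pos' x) (hyv : pos' y ≠ pos' v)
    (hx : pos' x ∈ segment ℝ (pos' z) (pos' v))
    (hA' : ∀ e, e ∈ A' ↔ e ∈ A ∨ e = s(x, v) ∨ e = s(y, v)) :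
    ∃ F' : Finset (Set (Sym2 V)), F'.card ≤ F.card + 1 ∧ SegmentCover pos' A' F' := by
  classical
  have hcov : ∀ S ∈ F, CoversSegment pos' S := by
    intro S hS
    obtain ⟨hSA, a, b, hab, h1⟩ := h.1 S hS
    refine ⟨a, b, hab, ?_⟩
    rw [← h1]
    exact Set.iUnion₂_congr fun e he => hcongr e (hSA he)
  obtain ⟨S₀, hS₀, hzS₀⟩ := h.2 _ hzA
  refine ⟨insert {s(y, v)} (F.image fun S => if S = S₀ then insert s(x, v) S else S), ?_, ?_, ?_⟩
  · exact (Finset.card_insert_le _ _).trans (Nat.add_le_add_right Finset.card_image_le 1)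
  · intro S hS
    rcases Finset.mem_insert.1 hS with rfl | hS
    · exact ⟨Set.singleton_subset_iff.2 ((hA' _).2 (Or.inr (Or.inr rfl))),
        CoversSegment.singleton hyv⟩
    · obtain ⟨T, hT, rfl⟩ := Finset.mem_image.1 hS
      have hTA : T ⊆ A' := fun e he => (hA' e).2 (Or.inl ((h.1 T hT).1 he))
      split_ifs with hTS
      · subst hTS
        exact ⟨Set.insert_subset ((hA' _).2 (Or.inr (Or.inl rfl))) hTA,
          (hcov T hT).insert hzx hzS₀ hx⟩
      · exact ⟨hTA, hcov T hT⟩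
  · intro e he
    rcases (hA' e).1 he with he | rfl | rfl
    · obtain ⟨S, hS, heS⟩ := h.2 e he
      refine ⟨_, Finset.mem_insert_of_mem (Finset.mem_image_of_mem _ hS), ?_⟩
      split_ifs
      · exact Or.inr heS
      · exact heS
    · refine ⟨_, Finset.mem_insert_of_mem (Finset.mem_image_of_mem _ hS₀), ?_⟩
      rw [if_pos rfl]
      exact Or.inl rfl
    · exact ⟨_, Finset.mem_insert_self _ _, rfl⟩

/-- A point close to `x` on the extension of the segment from `z` to `x`. -/
theorem exists_extension {x y z : Plane} {a b : ℝ} (hb : b < 0) (hab : a + b < 1)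
    (hz : z = a • x + b • y) : ∃ α β : ℝ, 0 < α ∧ 0 < β ∧ 1 < α + β ∧
      x ∈ segment ℝ z (α • x + β • y) := by
  have h0 : 0 ≤ |1 - a| := abs_nonneg _
  -- The new point is `x + t (x - z)`. This `t` keeps the coefficient `1 + t (1 - a)` of `x`
  -- positive; that of `y` is `-t b > 0`, and they sum to `1 + t (1 - a - b) > 1`.
  set t : ℝ := 1 / (1 + |1 - a|) with ht
  have htpos : 0 < t := by positivity
  have ht1 : t * (1 + |1 - a|) = 1 := by rw [ht]; field_simp
  have h1 : -|1 - a| ≤ 1 - a := neg_abs_le _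
  refine ⟨1 + t * (1 - a), -t * b, ?_, ?_, ?_, ?_⟩
  · nlinarith
  · nlinarith
  · nlinarith
  · refine ⟨t / (1 + t), 1 / (1 + t), by positivity, by positivity, by field_simp; ring, ?_⟩
    rw [hz]
    have : (1 + t) ≠ 0 := by positivity
    match_scalars <;> field_simp <;> ring

theorem Ear.exists_starPolygon [Finite V] {U : Set V} {A : Set (Sym2 V)} {B : Set (V × V)}
    (h : Ear U A B) : ∃ pos g F, StarPolygon U A B pos g ∧ SegmentCover pos A F ∧
      F.card ≤ U.ncard := by
  classical
  induction h with
  | tri a b c hab hbc hca =>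
    let pos : V → Plane := fun v => if v = a then !₂[1, 0] else if v = b then !₂[0, 1] else !₂[-1, -1]
    have hS := starPolygon_triangle hab hbc hca (pos := pos) (by simp [pos])
      (by simp [pos, hab.symm]) (by simp [pos, hca, hbc.symm])
    refine ⟨pos, _, {{s(a, b)}, {s(b, c)}, {s(c, a)}}, hS, ⟨?_, ?_⟩, ?_⟩
    · have key : ∀ x y, s(x, y) ∈ ({s(a, b), s(b, c), s(c, a)} : Set (Sym2 V)) →
          ({s(x, y)} : Set (Sym2 V)) ⊆ {s(a, b), s(b, c), s(c, a)} ∧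
            CoversSegment pos {s(x, y)} := fun x y hxy => by
        obtain ⟨h1, h2, h3⟩ := hS.ends x y hxy
        exact ⟨Set.singleton_subset_iff.2 hxy, CoversSegment.singleton fun h => h3 (hS.inj h1 h2 h)⟩
      intro S hS'
      simp only [Finset.mem_insert, Finset.mem_singleton] at hS'
      rcases hS' with rfl | rfl | rfl
      · exact key _ _ (by simp)
      · exact key _ _ (by simp)
      · exact key _ _ (by simp)
    · rintro e (rfl | rfl | rfl)
      · exact ⟨{s(a, b)}, by simp, rfl⟩
      · exact ⟨{s(b, c)}, by simp, rfl⟩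
      · exact ⟨{s(c, a)}, by simp, rfl⟩
    · have : ({a, b, c} : Set V).ncard = 3 := by
        rw [Set.ncard_eq_three]
        exact ⟨a, b, c, hab, hca.symm, hbc, rfl⟩
      rw [this]
      exact Finset.card_le_three
  | glue U A B x y v _ hxy hv ih =>
    obtain ⟨pos, g, F, hS, hF, hcard⟩ := ih
    have hxU : x ∈ U := (hS.ends _ _ (hS.bdry _ hxy)).1
    have hyU : y ∈ U := (hS.ends _ _ (hS.bdry _ hxy)).2.1
    have hupd : ∀ P, ∀ u ∈ U, Function.update pos v P u = pos u := fun P u hu =>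
      Function.update_of_ne (by rintro rfl; exact hv hu) _ _
    have hncard : (insert v U).ncard = U.ncard + 1 := Set.ncard_insert_of_notMem hv
    have main : ∀ α β : ℝ, 0 < α → 0 < β → 1 < α + β → (∀ pos' : V → Plane,
        (∀ u ∈ U, pos' u = pos u) → pos' v = α • pos x + β • pos y →
        (∀ e ∈ A, edgeSeg pos' e = edgeSeg pos e) → pos' x ≠ pos' v → pos' y ≠ pos' v →
        ∃ F' : Finset (Set (Sym2 V)), F'.card ≤ F.card + 1 ∧
          SegmentCover pos' (A ∪ {s(x, v), s(v, y)}) F') →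
        ∃ pos g F, StarPolygon (insert v U) (A ∪ {s(x, v), s(v, y)})
          (B \ {(x, y)} ∪ {(x, v), (v, y)}) pos g ∧
          SegmentCover pos (A ∪ {s(x, v), s(v, y)}) F ∧ F.card ≤ (insert v U).ncard := by
      intro α β hα hβ hαβ hF'
      have hposv : Function.update pos v (α • pos x + β • pos y) v = α • pos x + β • pos y :=
        Function.update_self _ _ _
      obtain ⟨g', hS'⟩ := hS.glue hxy hv hα hβ hαβ (hupd _) hposv
      have hne : ∀ u ∈ U, Function.update pos v (α • pos x + β • pos y) u ≠
          Function.update pos v (α • pos x + β • pos y) v := fun u hu he => by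
        have := hS'.inj (Or.inr hu) (Or.inl rfl) he
        exact hv (this ▸ hu)
      obtain ⟨F', hc, hF'⟩ := hF' _ (hupd _) hposv
        (fun e he => hS.edgeSeg_congr_of_mem (hupd _) he) (hne x hxU) (hne y hyU)
      exact ⟨_, g', F', hS', hF', by rw [hncard]; omega⟩
    rcases hS.ext _ hxy with ⟨z, hz, a, b, hb, hab, he⟩ | ⟨z, hz, a, b, hb, hab, he⟩
    · obtain ⟨α, β, hα, hβ, hαβ, hx⟩ := exists_extension hb hab he
      obtain ⟨hzU, -, hzx⟩ := hS.ends _ _ hz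
      refine main α β hα hβ hαβ fun pos' hpos' hv' hcongr _ hyv => ?_
      refine hF.glue hcongr hz ?_ hyv ?_ fun e => ?_
      · rw [hpos' z hzU, hpos' x hxU]
        exact fun h => hzx (hS.inj hzU hxU h)
      · rw [hpos' z hzU, hpos' x hxU, hv']
        exact hx
      · rw [Sym2.eq_swap (a := y)]; rfl
    · obtain ⟨α, β, hα, hβ, hαβ, hy⟩ := exists_extension hb hab he
      obtain ⟨hzU, -, hzy⟩ := hS.ends _ _ hz
      -- Here the prolonged edge ends at `y`, so `α` is the coefficient of `pos y` and the two
      -- exchange roles.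
      refine main β α hβ hα (by linarith) fun pos' hpos' hv' hcongr hxv _ => ?_
      refine hF.glue hcongr hz ?_ hxv ?_ fun e => ?_
      · rw [hpos' z hzU, hpos' y hyU]
        exact fun h => hzy (hS.inj hzU hyU h)
      · rw [hpos' z hzU, hpos' y hyU, hv', add_comm]
        exact hy
      · rw [Sym2.eq_swap (a := y), or_comm (a := e = s(v, y))]; rfl

end EarDrawing

/-! ### Faces of a star-shaped drawing, read off from the gauge -/

section StarDrawing

variable {V : Type*} {G : SimpleGraph V} {B : Set (V × V)} {pos : V → Plane} {g : Plane → ℝ}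

namespace StarPolygon

theorem exists_drawing (h : StarPolygon Set.univ G.edgeSet B pos g) :
    ∃ D : Drawing G, D.pos = pos := by
  refine ⟨⟨pos, fun x y hxy => h.inj trivial trivial hxy, fun u v w hvw hu => ?_⟩, rfl⟩
  exact Sym2.mem_iff.1 (h.mem_of_pos_mem trivial (f := s(v, w)) hvw hu)

theorem g_zero {U : Set V} {A : Set (Sym2 V)} (h : StarPolygon U A B pos g) : g 0 = 0 := by
  have := h.g_smul 0 0 le_rfl
  simpa using this

theorem isBounded_g_lt [Finite V] {U : Set V} {A : Set (Sym2 V)} (h : StarPolygon U A B pos g) :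
    Bornology.IsBounded {u | g u < 1} := by
  have := Fintype.ofFinite V
  rw [isBounded_iff_forall_norm_le]
  refine ⟨∑ v, ‖pos v‖, fun u hu => ?_⟩
  obtain ⟨p, hp, a, b, ha, hb, rfl⟩ := h.cover u
  have hu' : g (a • pos p.1 + b • pos p.2) < 1 := hu
  rw [h.g_wedge p hp a b ha hb] at hu'
  have h1 : ∀ v, ‖pos v‖ ≤ ∑ v, ‖pos v‖ := fun v =>
    Finset.single_le_sum (f := fun v => ‖pos v‖) (fun _ _ => norm_nonneg _) (Finset.mem_univ v)
  have h0 : 0 ≤ ∑ v, ‖pos v‖ := (norm_nonneg _).trans (h1 p.1)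
  calc ‖a • pos p.1 + b • pos p.2‖ ≤ a * ‖pos p.1‖ + b * ‖pos p.2‖ := by
        refine (norm_add_le _ _).trans ?_
        rw [norm_smul, norm_smul, Real.norm_of_nonneg ha, Real.norm_of_nonneg hb]
    _ ≤ a * (∑ v, ‖pos v‖) + b * ∑ v, ‖pos v‖ := by gcongr <;> exact h1 _
    _ ≤ 1 * ∑ v, ‖pos v‖ := by rw [← add_mul]; gcongr
    _ = _ := one_mul _

variable {D : Drawing G}

theorem of_mem_carrier (h : StarPolygon Set.univ G.edgeSet B pos g) (hD : D.pos = pos)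
    {u : Plane} (hu : u ∈ D.carrier) : u ≠ 0 ∧ g u ≤ 1 := by
  have key : ∃ e ∈ G.edgeSet, u ∈ edgeSeg pos e := by
    rcases hu with ⟨v, rfl⟩ | hu
    · obtain ⟨y, hy⟩ := h.out v trivial
      exact ⟨_, h.bdry _ hy, by rw [hD]; exact left_mem_segment ℝ _ _⟩
    · obtain ⟨e, he, hue⟩ := Set.mem_iUnion₂.1 hu
      exact ⟨e, he, hD ▸ hue⟩
  obtain ⟨e, he, hue⟩ := key
  exact ⟨h.edge_ne e he u hue, h.edge_le e he u hue⟩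

theorem mem_carrier (h : StarPolygon Set.univ G.edgeSet B pos g) (hD : D.pos = pos)
    {u : Plane} (hu : g u = 1) : u ∈ D.carrier := by
  obtain ⟨p, hp, a, b, ha, hb, rfl⟩ := h.cover u
  rw [h.g_wedge p hp a b ha hb] at hu
  refine Or.inr (Set.mem_iUnion₂.2 ⟨_, h.bdry p hp, ?_⟩)
  rw [D.edgeLine_eq, hD]
  exact ⟨a, b, ha, hb, hu, rfl⟩

/-- By the intermediate value theorem a connected set cannot pass from `g < 1` to `g ≥ 1` without
meeting the level set `g = 1`, which is covered by the drawing. -/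
theorem isBounded_component [Finite V] (h : StarPolygon Set.univ G.edgeSet B pos g)
    (hD : D.pos = pos) {u : Plane} (hu : g u < 1) :
    Bornology.IsBounded (connectedComponentIn D.carrierᶜ u) := by
  refine h.isBounded_g_lt.subset fun v hv => ?_
  by_contra hlt
  have huc : u ∈ D.carrierᶜ := by
    by_contra hc
    rw [connectedComponentIn_eq_empty hc] at hv
    exact hv
  obtain ⟨w, hw, hgw⟩ := (isPreconnected_connectedComponentIn (F := D.carrierᶜ) (x := u)).image g
    h.g_cont.continuousOn |>.Icc_subset (Set.mem_image_of_mem g (mem_connectedComponentIn huc))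
      (Set.mem_image_of_mem g hv) ⟨hu.le, not_lt.1 hlt⟩
  exact connectedComponentIn_subset _ _ hw (h.mem_carrier hD hgw)

/-- The drawing contains the level set `g = 1` and stays within `g ≤ 1`. Points below level 1 are
enclosed; from a point above it the radial ray escapes to infinity. -/
theorem outerFace_eq [Finite V] (h : StarPolygon Set.univ G.edgeSet B pos g)
    (hD : D.pos = pos) : D.outerFace = {u | 1 < g u} := by
  ext u
  constructor
  · rintro ⟨hc, hb⟩
    by_contra hle
    rcases (show g u ≤ 1 from not_lt.1 hle).lt_or_eq with hlt | heq
    · exact hb (h.isBounded_component hD hlt)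
    · exact hc (h.mem_carrier hD heq)
  · intro hu
    have hu : 1 < g u := hu
    have hu0 : u ≠ 0 := by
      rintro rfl
      rw [h.g_zero] at hu
      linarith
    have hray : (fun t : ℝ => t • u) '' Set.Ici 1 ⊆ D.carrierᶜ := by
      rintro _ ⟨t, ht, rfl⟩ hc
      have ht : 1 ≤ t := ht
      have h1 := (h.of_mem_carrier hD hc).2
      simp only at h1
      rw [h.g_smul t u (by linarith)] at h1
      nlinarith
    have hmem : u ∈ (fun t : ℝ => t • u) '' Set.Ici 1 := ⟨1, Set.self_mem_Ici, one_smul _ _⟩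
    refine ⟨hray hmem, fun hb => ?_⟩
    have hpre : IsPreconnected ((fun t : ℝ => t • u) '' Set.Ici 1) :=
      isPreconnected_Ici.image _ (by fun_prop)
    obtain ⟨C, hC⟩ := isBounded_iff_forall_norm_le.1
      (hb.subset (hpre.subset_connectedComponentIn hmem hray))
    have hn : 0 < ‖u‖ := norm_pos_iff.2 hu0
    have hC1 := hC (((|C| + 1) / ‖u‖ + 1) • u) ⟨_, by
      have : 0 ≤ (|C| + 1) / ‖u‖ := by positivity
      simpa using this, rfl⟩
    rw [norm_smul, Real.norm_of_nonneg (by positivity), add_mul, div_mul_cancel₀ _ hn.ne'] at hC1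
    linarith [le_abs_self C]

theorem frontier_outerFace [Finite V] (h : StarPolygon Set.univ G.edgeSet B pos g)
    (hD : D.pos = pos) : frontier D.outerFace = {u | g u = 1} := by
  rw [h.outerFace_eq hD]
  ext u
  constructor
  · intro hu
    exact (frontier_lt_subset_eq continuous_const h.g_cont hu).symm
  · intro hu
    have hu : g u = 1 := hu
    rw [frontier, (isOpen_lt continuous_const h.g_cont).interior_eq]
    refine ⟨?_, fun h' => by rw [Set.mem_ofPred_eq, hu] at h'; exact lt_irrefl _ h'⟩
    have ht : Filter.Tendsto (fun t : ℝ => t • u) (nhdsWithin 1 (Set.Ioi 1)) (nhds u) := by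
      have : Filter.Tendsto (fun t : ℝ => t • u) (nhds 1) (nhds ((1 : ℝ) • u)) :=
        (Continuous.tendsto (by fun_prop) 1)
      rw [one_smul] at this
      exact this.mono_left nhdsWithin_le_nhds
    refine mem_closure_of_tendsto ht ?_
    filter_upwards [self_mem_nhdsWithin] with t ht
    have ht : (1 : ℝ) < t := ht
    rw [h.g_smul t u (by linarith), hu]
    linarith

theorem isOuterplanar [Finite V] (h : StarPolygon Set.univ G.edgeSet B pos g)
    (hD : D.pos = pos) : D.IsOuterplanar := by
  refine ⟨fun e he f hf hef x hx => ?_, fun v => ?_⟩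
  · rw [D.edgeLine_eq, hD] at hx
    rw [hD]
    exact h.plane e he f hf hef x hx
  · rw [h.frontier_outerFace hD, hD]
    obtain ⟨y, hy⟩ := h.out v trivial
    exact h.g_eq_one hy (left_mem_segment ℝ _ _)

/-- By homogeneity `g` takes the value 1 on the ray through `u` exactly at `(g u)⁻¹ • u`; `edge_ne`
keeps the centre off the drawing. -/
theorem isStarShaped [Finite V] (h : StarPolygon Set.univ G.edgeSet B pos g)
    (hD : D.pos = pos) : D.IsStarShaped := by
  refine ⟨0, ⟨fun hc => (h.of_mem_carrier hD hc).1 rfl,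
    h.isBounded_component hD (by rw [h.g_zero]; norm_num)⟩, fun u hu => ?_⟩
  have hg := h.g_pos u hu
  rw [h.frontier_outerFace hD]
  refine ⟨(g u)⁻¹ • u, ⟨⟨(g u)⁻¹, by positivity, by simp⟩, ?_⟩, ?_⟩
  · rw [Set.mem_ofPred_eq, h.g_smul _ _ (by positivity), inv_mul_cancel₀ hg.ne']
  · rintro _ ⟨⟨t, ht, rfl⟩, h1⟩
    rw [Set.mem_ofPred_eq, zero_add, h.g_smul _ _ ht] at h1
    rw [zero_add, eq_inv_of_mul_eq_one_left h1]

end StarPolygon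

theorem SegmentCover.numSegments_le [Finite V] {F : Finset (Set (Sym2 V))} {D : Drawing G}
    (h : SegmentCover D.pos G.edgeSet F) : D.numSegments ≤ F.card :=
  D.numSegments_le F (fun S hS => h.1 S hS) h.2

end StarDrawing

/-! ### Graphs with at most two vertices, and the upper bound -/

section SmallDrawing

variable {V : Type*} {G : SimpleGraph V}

/-- A graph with at most two vertices, drawn on a line. -/
theorem exists_drawing_of_card_le_two [Fintype V] (hV : Fintype.card V ≤ 2) :
    ∃ D : Drawing G, D.IsOuterplanar ∧ D.numSegments ≤ Fintype.card V := by
  classical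
  have htwo : ∀ u v w : V, v ≠ w → u = v ∨ u = w := by
    intro u v w hvw
    by_contra! hu
    have : ({u, v, w} : Finset V).card ≤ Fintype.card V := Finset.card_le_univ _
    rw [Finset.card_eq_three.2 ⟨u, v, w, hu.1, hu.2, hvw, rfl⟩] at this
    omega
  have hedge : ∀ e ∈ G.edgeSet, ∀ f ∈ G.edgeSet, e = f := by
    intro e he f hf
    induction e with | _ x y
    induction f with | _ z w
    have h1 : G.Adj x y := he
    have h2 : G.Adj z w := hf
    rcases htwo z x y h1.ne with rfl | rfl <;> rcases htwo w _ _ h1.ne with rfl | rfl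
    · exact absurd rfl h2.ne
    · rfl
    · exact Sym2.eq_swap
    · exact absurd rfl h2.ne
  let pos : V → Plane := fun v => !₂[((Fintype.equivFin V v : ℕ) : ℝ), 0]
  have hinj : Function.Injective pos := by
    intro x y hxy
    have h0 := congrArg (fun u : Plane => u 0) hxy
    simp only [pos] at h0
    exact (Fintype.equivFin V).injective (Fin.ext (by simpa using h0))
  let D : Drawing G := ⟨pos, hinj, fun u v w hvw _ => htwo u v w hvw.ne⟩
  have hcar : ∀ u ∈ D.carrier, u 1 = 0 := by
    rintro u (⟨v, rfl⟩ | hu)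
    · simp [D, pos]
    · obtain ⟨e, -, hue⟩ := Set.mem_iUnion₂.1 hu
      induction e with | _ x y
      obtain ⟨a, b, -, -, -, rfl⟩ := hue
      simp [D, pos]
  -- The drawing lies on the horizontal axis, so vertical rays in the upper half-plane escape to
  -- infinity; every vertex is a limit of such points.
  have hout : ∀ u : Plane, 0 < u 1 → u ∈ D.outerFace := by
    intro u hu
    have hray : (fun t : ℝ => (!₂[u 0, t * u 1] : Plane)) '' Set.Ici 1 ⊆ D.carrierᶜ := by
      rintro _ ⟨t, ht, rfl⟩ hc
      have ht : (1 : ℝ) ≤ t := ht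
      have := hcar _ hc
      simp only [Matrix.cons_val_one, Matrix.cons_val_zero] at this
      nlinarith
    have hmem : u ∈ (fun t : ℝ => (!₂[u 0, t * u 1] : Plane)) '' Set.Ici 1 :=
      ⟨1, Set.self_mem_Ici, by ext i; fin_cases i <;> simp⟩
    refine ⟨hray hmem, fun hb => ?_⟩
    have hcont : Continuous fun t : ℝ => (!₂[u 0, t * u 1] : Plane) := by fun_prop
    have hpre : IsPreconnected ((fun t : ℝ => (!₂[u 0, t * u 1] : Plane)) '' Set.Ici 1) :=
      isPreconnected_Ici.image _ hcont.continuousOn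
    obtain ⟨C, hC⟩ := isBounded_iff_forall_norm_le.1
      (hb.subset (hpre.subset_connectedComponentIn hmem hray))
    have hC1 := hC (!₂[u 0, ((|C| + 1) / u 1 + 1) * u 1]) ⟨_, by
      have : 0 ≤ (|C| + 1) / u 1 := by positivity
      simpa using this, rfl⟩
    have h2 := (PiLp.norm_apply_le (!₂[u 0, ((|C| + 1) / u 1 + 1) * u 1] : Plane) 1).trans hC1
    simp only [Matrix.cons_val_one, Matrix.cons_val_zero] at h2
    rw [add_mul, div_mul_cancel₀ _ hu.ne', Real.norm_of_nonneg (by positivity)] at h2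
    linarith [le_abs_self C]
  refine ⟨D, ⟨fun e he f hf hef => absurd (hedge e he f hf) hef, fun v => ?_⟩, ?_⟩
  · have hv : D.pos v ∈ D.carrier := Or.inl ⟨v, rfl⟩
    have hv0 : D.pos v 1 = 0 := hcar _ hv
    refine ⟨?_, fun hi => (interior_subset hi).1 hv⟩
    have ht : Filter.Tendsto (fun t : ℝ => (!₂[D.pos v 0, t] : Plane)) (nhdsWithin 0 (Set.Ioi 0))
        (nhds (D.pos v)) := by
      have hcont : Continuous fun t : ℝ => (!₂[D.pos v 0, t] : Plane) := by fun_prop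
      have h1 := hcont.tendsto 0
      have h2 : (!₂[D.pos v 0, 0] : Plane) = D.pos v := by
        ext i; fin_cases i
        · simp
        · simp [hv0]
      rw [h2] at h1
      exact h1.mono_left nhdsWithin_le_nhds
    refine mem_closure_of_tendsto ht ?_
    filter_upwards [self_mem_nhdsWithin] with t ht
    exact hout _ (by simpa using ht)
  · by_cases hE : G.edgeSet.Nonempty
    · obtain ⟨e, he⟩ := hE
      have hpos : 1 ≤ Fintype.card V := by
        induction e with | _ x y
        exact Fintype.card_pos_iff.2 ⟨x⟩
      refine (D.numSegments_le {{e}} ?_ ?_).trans ((Finset.card_singleton _).trans_le hpos)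
      · intro S hS
        rw [Finset.mem_singleton.1 hS]
        induction e with | _ x y
        exact ⟨Set.singleton_subset_iff.2 he, CoversSegment.singleton (D.pos_ne he)⟩
      · intro f hf
        exact ⟨{e}, Finset.mem_singleton_self _, hedge f hf e he⟩
    · refine (D.numSegments_le ∅ (by simp) ?_).trans (by simp)
      intro e he
      exact absurd ⟨e, he⟩ hE

theorem IsMaximalOuterplanar.exists_drawing [Fintype V] (hG : IsMaximalOuterplanar G) :
    ∃ D : Drawing G, D.IsOuterplanar ∧ D.numSegments ≤ Fintype.card V ∧
      (3 ≤ Fintype.card V → D.IsStarShaped) := by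
  by_cases hV : 3 ≤ Fintype.card V
  · obtain ⟨B, hB⟩ := hG.ear hV
    obtain ⟨pos, g, F, hS, hF, hcard⟩ := hB.exists_starPolygon
    obtain ⟨D, rfl⟩ := hS.exists_drawing
    refine ⟨D, hS.isOuterplanar rfl, hF.numSegments_le.trans ?_, fun _ => hS.isStarShaped rfl⟩
    rwa [Set.ncard_univ, Nat.card_eq_fintype_card] at hcard
  · obtain ⟨D, h1, h2⟩ := exists_drawing_of_card_le_two (G := G) (by omega)
    exact ⟨D, h1, h2, fun h => absurd h hV⟩

end SmallDrawing

/-! ### Counting straight passes -/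

section Passes

variable {E : Type*} [AddCommGroup E] [Module ℝ E]

theorem Wbtw.total_of_right {w x y z : E} (h₁ : Wbtw ℝ w x z) (h₂ : Wbtw ℝ w y z) :
    Wbtw ℝ w x y ∨ Wbtw ℝ w y x := by
  by_cases hwz : w = z
  · subst hwz
    rw [wbtw_self_iff] at h₁ h₂
    subst h₁
    subst h₂
    exact Or.inl (wbtw_self_left _ _ _)
  · refine wbtw_total_of_sameRay_vsub_left
      (h₁.sameRay_vsub_left.trans h₂.sameRay_vsub_left.symm fun h => ?_)
    exact absurd (vsub_eq_zero_iff_eq.1 h).symm hwz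

theorem Wbtw.total_of_left {w x y z : E} (h₁ : Wbtw ℝ w x y) (h₂ : Wbtw ℝ w x z) (hwx : w ≠ x) :
    Wbtw ℝ x y z ∨ Wbtw ℝ x z y := by
  refine wbtw_total_of_sameRay_vsub_left
    (h₁.sameRay_vsub.symm.trans h₂.sameRay_vsub fun h => ?_)
  exact absurd (vsub_eq_zero_iff_eq.1 h).symm hwx

/-- The end with the smaller index of the pass of type `t` that ends at `k + 3`. -/
def passLo (k : ℕ) (t : Fin 3) : ℕ := ![k, k, k - 1] t

/-- The middle vertex of the pass of type `t` that ends at `k + 3`. -/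
def passMid (k : ℕ) (t : Fin 3) : ℕ := ![k + 2, k + 1, k + 1] t

/-- The pass of type `t` that ends at `k + 3` is straight. -/
def IsPass (p : ℕ → E) (k : ℕ) (t : Fin 3) : Prop :=
  (t = 2 → 1 ≤ k) ∧ Wbtw ℝ (p (passLo k t)) (p (passMid k t)) (p (k + 3))

open Classical in
/-- In a drawing of the square of a path, the number of straight passes is at most the number of
steps. -/
theorem sum_isPass_le {p : ℕ → E} {N : ℕ} (hinj : ∀ i < N, ∀ j < N, p i = p j → i = j)
    (hp : ∀ i < N, ∀ j < N, ∀ k < N, j ≤ k + 2 → k ≤ j + 2 → Wbtw ℝ (p j) (p i) (p k) →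
      i = j ∨ i = k) (m : ℕ) (hm : m + 3 ≤ N) :
    ∑ k ∈ Finset.range m, ∑ t : Fin 3, (if IsPass p k t then 1 else 0) ≤ m := by
  have noncol : ∀ i j k, i < N → j < N → k < N → i ≠ j → i ≠ k → j ≤ k + 2 → k ≤ j + 2 →
      ¬ Wbtw ℝ (p j) (p i) (p k) := by
    intro i j k hi hj hk h1 h2 h3 h4 h
    rcases hp i hi j hj k hk h3 h4 h with h | h <;> omega
  have hne : ∀ i j, i < N → j < N → i ≠ j → p i ≠ p j := fun i j hi hj hij h =>
    hij (hinj i hi j hj h)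
  -- The three kinds of pass, called A, B and C below, have middle and ends `(k, k + 2, k + 3)`,
  -- `(k, k + 1, k + 3)` and `(k - 1, k + 1, k + 3)`. The guard on C excludes `k = 0`, where `k - 1`
  -- would truncate to 0.
  have step : ∀ k, k + 3 < N → ∑ t : Fin 3, (if IsPass p k t then 1 else 0) =
      (if Wbtw ℝ (p k) (p (k + 2)) (p (k + 3)) then 1 else 0) +
      (if Wbtw ℝ (p k) (p (k + 1)) (p (k + 3)) then 1 else 0) +
      (if 1 ≤ k ∧ Wbtw ℝ (p (k - 1)) (p (k + 1)) (p (k + 3)) then 1 else 0) := by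
    intro k hk
    simp [Fin.sum_univ_three, IsPass, passLo, passMid]
  -- In each of the next three exclusions the passes have common ends, or prolong a common edge in
  -- the same direction. The vertices in which they differ then lie on one line, and some vertex
  -- falls on an edge.
  have hAB : ∀ k, k + 3 < N → Wbtw ℝ (p k) (p (k + 2)) (p (k + 3)) →
      ¬ Wbtw ℝ (p k) (p (k + 1)) (p (k + 3)) := by
    intro k hk hA hB
    rcases hA.total_of_right hB with h | h
    · exact noncol _ _ _ (by omega) (by omega) (by omega) (by omega) (by omega) (by omega)
        (by omega) h
    · exact noncol _ _ _ (by omega) (by omega) (by omega) (by omega) (by omega) (by omega)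
        (by omega) h
  have hBC : ∀ k, k + 3 < N → Wbtw ℝ (p k) (p (k + 1)) (p (k + 3)) → 1 ≤ k →
      ¬ Wbtw ℝ (p (k - 1)) (p (k + 1)) (p (k + 3)) := by
    intro k hk hB h1 hC
    rcases hB.symm.total_of_left hC.symm (hne _ _ (by omega) (by omega) (by omega)) with h | h
    · exact noncol _ _ _ (by omega) (by omega) (by omega) (by omega) (by omega) (by omega)
        (by omega) h
    · exact noncol _ _ _ (by omega) (by omega) (by omega) (by omega) (by omega) (by omega)
        (by omega) h
  have hAC : ∀ k, k + 4 < N → Wbtw ℝ (p k) (p (k + 2)) (p (k + 3)) →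
      ¬ Wbtw ℝ (p k) (p (k + 2)) (p (k + 4)) := by
    intro k hk hA hC
    rcases hA.total_of_left hC (hne _ _ (by omega) (by omega) (by omega)) with h | h
    · exact noncol _ _ _ (by omega) (by omega) (by omega) (by omega) (by omega) (by omega)
        (by omega) h
    · exact noncol _ _ _ (by omega) (by omega) (by omega) (by omega) (by omega) (by omega)
        (by omega) h
  -- The vertices `k`, `k + 2` and `k - 1`, `k + 1` would lie on two lines that both pass through
  -- `q` and `k + 3`. The lines would coincide and put a vertex on an edge.
  have htri : ∀ k q, k + 3 < N → q < N → Wbtw ℝ (p q) (p k) (p (k + 2)) →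
      Wbtw ℝ (p q) (p (k - 1)) (p (k + 1)) → 1 ≤ k → Wbtw ℝ (p k) (p (k + 2)) (p (k + 3)) →
      ¬ Wbtw ℝ (p (k - 1)) (p (k + 1)) (p (k + 3)) := by
    intro k q hk hq h1 h2 hk1 hA hC
    have e1 := h1.trans_expand_right hA (hne _ _ (by omega) (by omega) (by omega))
    have e2 := h2.trans_expand_right hC (hne _ _ (by omega) (by omega) (by omega))
    have e0 := e1.trans_left h1
    rcases e0.total_of_right e2 with a | a
    · rcases e1.total_of_right e2 with b | b
      · exact noncol _ _ _ (by omega) (by omega) (by omega) (by omega) (by omega) (by omega)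
          (by omega) (b.trans_left_right h1)
      · exact noncol _ _ _ (by omega) (by omega) (by omega) (by omega) (by omega) (by omega)
          (by omega) (b.trans_left_right a)
    · exact noncol _ _ _ (by omega) (by omega) (by omega) (by omega) (by omega) (by omega)
          (by omega) (h1.trans_left_right a)
  -- The induction also records the shape of the tight case. Either the last step contributed a pass
  -- of kind A, or the edges from `m + 2` to `m` and from `m + 1` to `m - 1`, prolonged past `m` and
  -- `m - 1`, meet at a vertex `q`, possibly in a degenerate way. Both exclude A and C together in
  -- the next step.
  suffices H : ∑ k ∈ Finset.range m, ∑ t : Fin 3, (if IsPass p k t then 1 else 0) ≤ m ∧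
      (∑ k ∈ Finset.range m, ∑ t : Fin 3, (if IsPass p k t then 1 else 0) = m →
        (1 ≤ m ∧ Wbtw ℝ (p (m - 1)) (p (m + 1)) (p (m + 2))) ∨
        ∃ q < N, Wbtw ℝ (p q) (p m) (p (m + 2)) ∧ Wbtw ℝ (p q) (p (m - 1)) (p (m + 1))) from H.1
  induction m with
  | zero =>
    -- Here `q = 0` and both betweenness relations are degenerate, since `0 - 1` is 0.
    exact ⟨le_rfl, fun _ => Or.inr ⟨0, by omega, wbtw_self_left _ _ _, wbtw_self_left _ _ _⟩⟩
  | succ k ih =>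
    obtain ⟨hle, htight⟩ := ih (by omega)
    rw [Finset.sum_range_succ, step k (by omega)]
    generalize ∑ k ∈ Finset.range k, ∑ t : Fin 3, (if IsPass p k t then 1 else 0) = P at *
    have hAB := hAB k (by omega)
    have hBC := hBC k (by omega)
    rw [show k + 1 + 1 = k + 2 from rfl, show k + 1 + 2 = k + 3 from rfl, Nat.add_sub_cancel]
    by_cases hA : Wbtw ℝ (p k) (p (k + 2)) (p (k + 3))
    · have hB := hAB hA
      rw [if_pos hA, if_neg hB]
      refine ⟨?_, fun _ => Or.inl ⟨by omega, hA⟩⟩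
      split_ifs with hC
      -- A and C together add two passes; this is affordable if the count had slack and impossible
      -- if it was tight.
      · rcases hle.lt_or_eq with hlt | heq
        · omega
        · exfalso
          rcases htight heq with ⟨h1, hA'⟩ | ⟨q, hq, h1, h2⟩
          · obtain ⟨j, rfl⟩ : ∃ j, k = j + 1 := ⟨k - 1, by omega⟩
            exact hAC j (by omega) hA' hC.2
          · exact htri k q (by omega) hq h1 h2 hC.1 hA hC.2
      · omega
    · rw [if_neg hA]
      by_cases hB : Wbtw ℝ (p k) (p (k + 1)) (p (k + 3))
      · rw [if_pos hB, if_neg fun h => hBC hB h.1 h.2]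
        exact ⟨by omega, fun _ => Or.inr ⟨k, by omega, hB, wbtw_self_left _ _ _⟩⟩
      · rw [if_neg hB]
        split_ifs with hC
        · refine ⟨by omega, fun h => ?_⟩
          -- With C alone and a tight count, C prolongs one of the two lines through `q`, so the
          -- same `q` serves for the next step.
          rcases htight (by omega) with ⟨h1, hA'⟩ | ⟨q, hq, h1, h2⟩
          · obtain ⟨j, rfl⟩ : ∃ j, k = j + 1 := ⟨k - 1, by omega⟩
            exact absurd hC.2 (hAC j (by omega) hA')
          · exact Or.inr ⟨q, hq, h2.trans_expand_right hC.2
              (hne _ _ (by omega) (by omega) (by omega)), h1⟩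
        · exact ⟨by omega, fun h => absurd h (by omega)⟩

end Passes

/-! ### Edges that start a segment -/

section InitialEdges

variable {V : Type*} {G : SimpleGraph V}

/-- The functional is the first coordinate plus `t` times the second, where `t` avoids the finitely
many values that identify two vertices. -/
theorem exists_linearMap_injective [Finite V] {pos : V → Plane} (h : Function.Injective pos) :
    ∃ f : Plane →ₗ[ℝ] ℝ, Function.Injective fun v => f (pos v) := by
  obtain ⟨t, ht⟩ := (Set.finite_range fun p : V × V =>
    -(pos p.1 0 - pos p.2 0) / (pos p.1 1 - pos p.2 1)).infinite_compl.nonempty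
  refine ⟨(EuclideanSpace.proj 0 : Plane →L[ℝ] ℝ).toLinearMap +
    t • (EuclideanSpace.proj 1 : Plane →L[ℝ] ℝ).toLinearMap, fun v w hvw => ?_⟩
  have hvw : pos v 0 + t * pos v 1 = pos w 0 + t * pos w 1 := by simpa using hvw
  by_contra hne
  by_cases h1 : pos v 1 - pos w 1 = 0
  · apply hne
    apply h
    have h1' : pos v 1 = pos w 1 := by linarith
    rw [h1'] at hvw
    ext i; fin_cases i
    · simpa using hvw
    · exact h1'
  · apply ht
    refine ⟨(v, w), ?_⟩
    dsimp only
    rw [div_eq_iff h1]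
    linarith

theorem mem_segment_of_lt (f : Plane →ₗ[ℝ] ℝ) {a b x y z : Plane} (hx : x ∈ segment ℝ a b)
    (hy : y ∈ segment ℝ a b) (hz : z ∈ segment ℝ a b) (hxy : f x < f y) (hyz : f y < f z) :
    y ∈ segment ℝ x z := by
  have hxz : x ≠ z := by
    rintro rfl
    exact lt_irrefl _ (hxy.trans hyz)
  obtain ⟨s, t, h⟩ := exists_segment_eq_image hxz hx hz
  rw [h] at hy
  obtain ⟨r, -, rfl⟩ := hy
  have hfr : f (AffineMap.lineMap x z r) = f x + r * (f z - f x) := by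
    rw [AffineMap.lineMap_apply_module, map_add, map_smul, map_smul, smul_eq_mul, smul_eq_mul]
    ring
  rw [hfr] at hxy hyz
  have hpos : 0 < f z - f x := by linarith
  rw [segment_eq_image_lineMap]
  refine ⟨r, ⟨?_, ?_⟩, rfl⟩
  · by_contra! hr
    nlinarith
  · by_contra! hr
    nlinarith

/-- The edges of a drawing, directed by a linear functional, into whose tail no other edge passes
straight. -/
def Drawing.InitialEdge (D : Drawing G) (f : Plane →ₗ[ℝ] ℝ) (p : V × V) : Prop :=
  G.Adj p.1 p.2 ∧ f (D.pos p.1) < f (D.pos p.2) ∧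
    ∀ z, G.Adj z p.1 → f (D.pos z) < f (D.pos p.1) →
      D.pos p.1 ∉ segment ℝ (D.pos z) (D.pos p.2)

/-- Suppose `x'` lies above `x`. Among the edges of `S` with tail below `x'` take one, `z w`, with
highest head. If `w` is below `x'`, an edge of `S` covers the midpoint of `w` and `x'`, and its head
is higher than `w`. If `w = x'`, the edge `z x'` runs straight into `x' y'`, which is not initial.
If `w` is above `x'`, the vertex `x'` lies inside an edge. -/
theorem Drawing.not_lt_of_initialEdge [Finite V] (D : Drawing G) {f : Plane →ₗ[ℝ] ℝ}
    (hf : Function.Injective fun v => f (D.pos v)) {S : Set (Sym2 V)} (hS : D.FormsSegment S)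
    {x y x' y' : V} (hxy : D.InitialEdge f (x, y)) (hxy' : D.InitialEdge f (x', y'))
    (hmem : s(x, y) ∈ S) (hmem' : s(x', y') ∈ S) : ¬ f (D.pos x) < f (D.pos x') := by
  intro hlt
  obtain ⟨hSE, a, b, -, hab⟩ := hS
  rw [D.edgeLine_eq] at hab
  have hl : ∀ {z w}, s(z, w) ∈ S → D.pos z ∈ segment ℝ a b := fun h =>
    edgeSeg_subset hab h (left_mem_segment ℝ _ _)
  have hr : ∀ {z w}, s(z, w) ∈ S → D.pos w ∈ segment ℝ a b := fun h =>
    edgeSeg_subset hab h (right_mem_segment ℝ _ _)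
  let T : Set (V × V) := {p | s(p.1, p.2) ∈ S ∧ f (D.pos p.1) < f (D.pos p.2) ∧
    f (D.pos p.1) < f (D.pos x')}
  obtain ⟨⟨z, w⟩, ⟨hzS, hzw, hzx⟩, hmax⟩ := Set.exists_max_image T (fun p => f (D.pos p.2))
    (Set.toFinite T) ⟨(x, y), hmem, hxy.2.1, hlt⟩
  dsimp only at hzS hzw hzx hmax
  have hadj : G.Adj z w := hSE hzS
  rcases lt_trichotomy (f (D.pos w)) (f (D.pos x')) with hw | hw | hw
  · have hm : (1 / 2 : ℝ) • D.pos w + (1 / 2 : ℝ) • D.pos x' ∈ segment ℝ a b :=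
      convex_segment a b (hr hzS) (hl hmem') (by norm_num) (by norm_num) (by norm_num)
    have hfm : f ((1 / 2 : ℝ) • D.pos w + (1 / 2 : ℝ) • D.pos x') =
        (f (D.pos w) + f (D.pos x')) / 2 := by
      rw [map_add, map_smul, map_smul, smul_eq_mul, smul_eq_mul]; ring
    rw [← hab] at hm
    obtain ⟨e, he, hme⟩ := Set.mem_iUnion₂.1 hm
    have key : ∀ z' w', s(z', w') ∈ S → f (D.pos z') < f (D.pos w') →
        (1 / 2 : ℝ) • D.pos w + (1 / 2 : ℝ) • D.pos x' ∈ edgeSeg D.pos s(z', w') → False := by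
      intro z' w' hS' hlt' hm'
      obtain ⟨s, t, hs, ht, hst, hm'⟩ := hm'
      rw [← hm', map_add, map_smul, map_smul, smul_eq_mul, smul_eq_mul] at hfm
      have hs' : s = 1 - t := by linarith
      rw [hs'] at hfm
      have h1 : f (D.pos z') < f (D.pos x') := by nlinarith
      have h2 := hmax (z', w') ⟨hS', hlt', h1⟩
      dsimp only at h2
      nlinarith
    induction e with | _ z' w'
    have hadj' : G.Adj z' w' := hSE he
    rcases lt_trichotomy (f (D.pos z')) (f (D.pos w')) with h | h | h
    · exact key z' w' he h hme
    · exact hadj'.ne (hf h)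
    · rw [Sym2.eq_swap] at he hme
      exact key w' z' he h hme
  · have : w = x' := hf hw
    subst this
    exact hxy'.2.2 z hadj hzx
      (mem_segment_of_lt f (hl hzS) (hl hmem') (hr hmem') hzx hxy'.2.1)
  · rcases D.eq_or_eq_of_mem x' z w hadj
      (mem_segment_of_lt f (hl hzS) (hl hmem') (hr hzS) hzx hw) with h | h
    · rw [h] at hzx; exact lt_irrefl _ hzx
    · rw [h] at hw; exact lt_irrefl _ hw

/-- The tails agree by `not_lt_of_initialEdge`; of two upward edges with the same tail on one line,
the longer would contain the head of the shorter. -/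
theorem Drawing.initialEdge_unique [Finite V] (D : Drawing G) {f : Plane →ₗ[ℝ] ℝ}
    (hf : Function.Injective fun v => f (D.pos v)) {S : Set (Sym2 V)} (hS : D.FormsSegment S)
    {p q : V × V} (hp : D.InitialEdge f p) (hq : D.InitialEdge f q)
    (hpS : s(p.1, p.2) ∈ S) (hqS : s(q.1, q.2) ∈ S) : p = q := by
  obtain ⟨x, y⟩ := p
  obtain ⟨x', y'⟩ := q
  have hx : x = x' := hf (le_antisymm
    (not_lt.1 (D.not_lt_of_initialEdge hf hS hq hp hqS hpS))
    (not_lt.1 (D.not_lt_of_initialEdge hf hS hp hq hpS hqS)))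
  subst hx
  obtain ⟨hSE, a, b, -, hab⟩ := hS
  rw [D.edgeLine_eq] at hab
  have hx' : D.pos x ∈ segment ℝ a b := edgeSeg_subset hab hpS (left_mem_segment ℝ _ _)
  have hy : D.pos y ∈ segment ℝ a b := edgeSeg_subset hab hpS (right_mem_segment ℝ _ _)
  have hy' : D.pos y' ∈ segment ℝ a b := edgeSeg_subset hab hqS (right_mem_segment ℝ _ _)
  have hxy := hp.2.1
  have hxy' := hq.2.1
  dsimp only at hxy hxy'
  rcases lt_trichotomy (f (D.pos y)) (f (D.pos y')) with h | h | h
  · rcases D.eq_or_eq_of_mem y x y' hq.1 (mem_segment_of_lt f hx' hy hy' hxy h) with e | e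
    · rw [e] at hxy; exact absurd hxy (lt_irrefl _)
    · rw [e]
  · rw [show y = y' from hf h]
  · rcases D.eq_or_eq_of_mem y' x y hp.1 (mem_segment_of_lt f hx' hy' hy hxy' h) with e | e
    · rw [e] at hxy'; exact absurd hxy' (lt_irrefl _)
    · rw [e]

theorem Drawing.ncard_initialEdge_le [Finite V] (D : Drawing G) {f : Plane →ₗ[ℝ] ℝ}
    (hf : Function.Injective fun v => f (D.pos v)) :
    {p | D.InitialEdge f p}.ncard ≤ D.numSegments := by
  have h : ∀ p, D.InitialEdge f p → ∃ S ∈ D.segments, s(p.1, p.2) ∈ S :=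
    fun p hp => D.exists_segment_mem hp.1
  choose! g hg hgp using h
  refine Set.ncard_le_ncard_of_injOn g hg (fun p hp q hq hpq => ?_) D.segments_finite
  exact D.initialEdge_unique hf (hg p hp).1 hp hq (hgp p hp) (hpq ▸ hgp q hq)

theorem Drawing.ncard_edgeSet_le [Finite V] (D : Drawing G) {f : Plane →ₗ[ℝ] ℝ}
    (hf : Function.Injective fun v => f (D.pos v)) :
    Nat.card G.edgeSet ≤ {p : V × V | G.Adj p.1 p.2 ∧ f (D.pos p.1) < f (D.pos p.2)}.ncard := by
  rw [Nat.card_coe_set_eq]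
  refine (Set.ncard_le_ncard (t := (fun p : V × V => s(p.1, p.2)) ''
    {p : V × V | G.Adj p.1 p.2 ∧ f (D.pos p.1) < f (D.pos p.2)}) ?_ (Set.toFinite _)).trans
    (Set.ncard_image_le (Set.toFinite _))
  intro e he
  induction e with | _ x y
  have hadj : G.Adj x y := he
  rcases lt_trichotomy (f (D.pos x)) (f (D.pos y)) with h | h | h
  · exact ⟨(x, y), ⟨hadj, h⟩, rfl⟩
  · exact absurd (hf h) hadj.ne
  · exact ⟨(y, x), ⟨hadj.symm, h⟩, Sym2.eq_swap⟩

end InitialEdges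

/-! ### The square of a path needs at least as many segments as vertices -/

section PathSquare

/-- The square of the path with `n` vertices. -/
def pathSquare (n : ℕ) : SimpleGraph (Fin n) where
  Adj i j := i ≠ j ∧ (i : ℕ) ≤ j + 2 ∧ (j : ℕ) ≤ i + 2
  symm := ⟨fun _ _ h => ⟨h.1.symm, h.2.2, h.2.1⟩⟩
  loopless := ⟨fun _ h => h.1 rfl⟩

variable {n : ℕ}

/-- A non-initial edge `x y` is entered straight from some `z`. As `x` lies between them, `z` and
`y` are not adjacent, so `z`, `x`, `y` is a pass in the sense of `IsPass`. Conversely a pass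
determines the edge: the tail is the middle vertex and the head is the end with the larger value of
`f`. -/
theorem pathSquare_noninitial_le (hn : 3 ≤ n) (D : Drawing (pathSquare n)) (f : Plane →ₗ[ℝ] ℝ) :
    {p : Fin n × Fin n | ((pathSquare n).Adj p.1 p.2 ∧ f (D.pos p.1) < f (D.pos p.2)) ∧
      ¬ D.InitialEdge f p}.ncard ≤ n - 3 := by
  classical
  let p : ℕ → Plane := fun i => if h : i < n then D.pos ⟨i, h⟩ else 0
  have hpp : ∀ i : Fin n, p i = D.pos i := fun i => by simp [p]
  have hpl : ∀ i (h : i < n), p i = D.pos ⟨i, h⟩ := fun i h => by simp [p, h]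
  have hinj : ∀ i < n, ∀ j < n, p i = p j → i = j := by
    intro i hi j hj h
    rw [hpl i hi, hpl j hj] at h
    exact Fin.mk.inj_iff.1 (D.pos_injective h)
  have hsum := sum_isPass_le (p := p) (N := n) hinj (by
    intro i hi j hj k hk hjk hkj h
    rw [hpl i hi, hpl j hj, hpl k hk, ← mem_segment_iff_wbtw] at h
    by_cases hne : j = k
    · subst hne
      rw [segment_same] at h
      exact Or.inl (Fin.mk.inj_iff.1 (D.pos_injective h))
    · rcases D.eq_or_eq_of_mem _ _ _
        (show (pathSquare n).Adj ⟨j, hj⟩ ⟨k, hk⟩ from ⟨by simpa using hne, hjk, hkj⟩) h with e | e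
      · exact Or.inl (Fin.mk.inj_iff.1 e)
      · exact Or.inr (Fin.mk.inj_iff.1 e)) (n - 3) (by omega)
  let F : Finset (ℕ × Fin 3) := (Finset.range (n - 3) ×ˢ Finset.univ).filter
    fun q => IsPass p q.1 q.2
  have hF : F.card ≤ n - 3 := by
    rw [Finset.card_filter, Finset.sum_product]
    exact hsum
  let R : Fin n × Fin n → ℕ × Fin 3 → Prop := fun e q => (e.1 : ℕ) = passMid q.1 q.2 ∧
    (((e.2 : ℕ) = q.1 + 3 ∧ f (p (passLo q.1 q.2)) < f (D.pos e.2)) ∨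
      ((e.2 : ℕ) = passLo q.1 q.2 ∧ f (p (q.1 + 3)) < f (D.pos e.2)))
  have huniq : ∀ e e' q, R e q → R e' q → e = e' := by
    rintro ⟨x, y⟩ ⟨x', y'⟩ q ⟨h1, h2⟩ ⟨h1', h2'⟩
    dsimp only at h1 h2 h1' h2'
    rw [← hpp] at h2 h2'
    have e1 : x = x' := Fin.ext (h1.trans h1'.symm)
    have e2 : y = y' := by
      rcases h2 with ⟨h2, h3⟩ | ⟨h2, h3⟩ <;> rcases h2' with ⟨h2', h3'⟩ | ⟨h2', h3'⟩
      · exact Fin.ext (h2.trans h2'.symm)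
      · rw [h2] at h3
        rw [h2'] at h3'
        exact absurd h3 h3'.not_gt
      · rw [h2] at h3
        rw [h2'] at h3'
        exact absurd h3 h3'.not_gt
      · exact Fin.ext (h2.trans h2'.symm)
    rw [e1, e2]
  have hex : ∀ e ∈ {p : Fin n × Fin n | ((pathSquare n).Adj p.1 p.2 ∧
      f (D.pos p.1) < f (D.pos p.2)) ∧ ¬ D.InitialEdge f p}, ∃ q ∈ F, R e q := by
    rintro ⟨x, y⟩ ⟨⟨hadj, hlt⟩, hnot⟩
    dsimp only at hadj hlt
    have hz : ∃ z, (pathSquare n).Adj z x ∧ f (D.pos z) < f (D.pos x) ∧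
        D.pos x ∈ segment ℝ (D.pos z) (D.pos y) := by
      by_contra! h
      exact hnot ⟨hadj, hlt, h⟩
    obtain ⟨z, hzx, hlt', hmem⟩ := hz
    have hnadj : ¬ (pathSquare n).Adj z y := by
      intro h
      rcases D.eq_or_eq_of_mem x z y h hmem with e | e
      · exact hzx.ne e.symm
      · exact hadj.ne e
    have hzy : (z : ℕ) ≠ y := by
      intro h
      rw [Fin.ext h] at hlt'
      exact lt_irrefl _ (hlt.trans hlt')
    have hfar : (z : ℕ) + 3 ≤ y ∨ (y : ℕ) + 3 ≤ z := by
      by_contra! h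
      exact hnadj ⟨fun h => hzy (congrArg _ h), by omega, by omega⟩
    have hxz : (z : ℕ) ≠ x := fun h => hzx.1 (Fin.ext h)
    have hxy : (x : ℕ) ≠ y := fun h => hadj.1 (Fin.ext h)
    have hzx2 := hzx.2
    have hadj2 := hadj.2
    have hzn := z.2
    have hyn := y.2
    rw [mem_segment_iff_wbtw, ← hpp, ← hpp, ← hpp] at hmem
    have hend := hlt'.trans hlt
    rw [← hpp, ← hpp] at hend
    have key : ∀ a b : ℕ, a + 3 ≤ b → b < n → a < x → (x : ℕ) ≤ a + 2 → (x : ℕ) < b → b ≤ x + 2 →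
        Wbtw ℝ (p a) (p x) (p b) →
        ((y : ℕ) = b ∧ f (p a) < f (p y)) ∨ ((y : ℕ) = a ∧ f (p b) < f (p y)) →
        ∃ q ∈ F, R (x, y) q := by
      intro a b hab hb hax hxa hxb hbx hw hy
      have : ∃ k t, passLo k t = a ∧ passMid k t = x ∧ k + 3 = b ∧ (t = 2 → 1 ≤ k) := by
        -- Ends at distance four give type 2, with `k = a + 1` so that `k - 1 = a`. At distance
        -- three the middle vertex decides between types 0 and 1.
        by_cases h4 : b = a + 4
        · exact ⟨a + 1, 2, rfl, by simp [passMid]; omega, by omega, fun _ => by omega⟩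
        · by_cases hx2 : (x : ℕ) = a + 2
          · exact ⟨a, 0, rfl, by simp [passMid]; omega, by omega, fun h => absurd h (by decide)⟩
          · exact ⟨a, 1, rfl, by simp [passMid]; omega, by omega, fun h => absurd h (by decide)⟩
      obtain ⟨k, t, rfl, hmid, rfl, ht⟩ := this
      refine ⟨(k, t), ?_, hmid.symm, ?_⟩
      · simp only [F, Finset.mem_filter, Finset.mem_product, Finset.mem_range, Finset.mem_univ,
          and_true]
        exact ⟨by omega, ht, by rw [hmid]; exact hw⟩
      · rw [hpp] at hy
        exact hy
    rcases hfar with h | h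
    · exact key z y h hyn (by omega) (by omega) (by omega) (by omega) hmem (Or.inl ⟨rfl, hend⟩)
    · exact key y z h hzn (by omega) (by omega) (by omega) (by omega) hmem.symm
        (Or.inr ⟨rfl, hend⟩)
  choose! g hg hgR using hex
  refine (Set.ncard_le_ncard_of_injOn (t := (F : Set (ℕ × Fin 3))) g hg
    (fun e he e' he' h => huniq _ _ _ (hgR e he) (h ▸ hgR e' he'))).trans ?_
  rw [Set.ncard_coe_finset]
  exact hF

/-- Of at least `2n - 3` edges at most `n - 3` are not initial, and the initial ones lie in
different segments. -/
theorem pathSquare_le_numSegments (hn : 3 ≤ n) (hE : 2 * n ≤ Nat.card (pathSquare n).edgeSet + 3)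
    (D : Drawing (pathSquare n)) : n ≤ D.numSegments := by
  obtain ⟨f, hf⟩ := exists_linearMap_injective D.pos_injective
  have h1 := D.ncard_edgeSet_le hf
  have h2 := D.ncard_initialEdge_le hf
  have h3 := pathSquare_noninitial_le hn D f
  have h4 : {p : Fin n × Fin n | (pathSquare n).Adj p.1 p.2 ∧ f (D.pos p.1) < f (D.pos p.2)} ⊆
      {p | D.InitialEdge f p} ∪ {p : Fin n × Fin n | ((pathSquare n).Adj p.1 p.2 ∧
        f (D.pos p.1) < f (D.pos p.2)) ∧ ¬ D.InitialEdge f p} := by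
    intro p hp
    by_cases h : D.InitialEdge f p
    · exact Or.inl h
    · exact Or.inr ⟨hp, h⟩
  have h5 := (Set.ncard_le_ncard h4 (Set.toFinite _)).trans (Set.ncard_union_le _ _)
  omega

end PathSquare

/-! ### The rotation system of the triangle strip -/

section PathSquareEmbedding

variable {n : ℕ}

/-- Adjacency in the square of the path with `n` vertices. -/
def PathSquareAdj (n a b : ℕ) : Prop := a < n ∧ b < n ∧ a ≠ b ∧ a ≤ b + 2 ∧ b ≤ a + 2

/-- The neighbour of `v` that follows `w` in the rotation at `v`. -/
def pathSquareNext (n v w : ℕ) : ℕ :=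
  if v % 2 = 0 then
    if w + 2 = v then if v + 2 < n then v + 2 else if v + 1 < n then v + 1 else v - 1
    else if w = v + 2 then v + 1
    else if w = v + 1 then if v = 0 then v + 2 else v - 1
    else v - 2
  else
    if w + 2 = v then v - 1
    else if w + 1 = v then if v + 1 < n then v + 1 else v - 2
    else if w = v + 1 then if v + 2 < n then v + 2 else if 2 ≤ v then v - 2 else v - 1
    else if 2 ≤ v then v - 2 else v - 1

/-- The index of the face to the left of the dart from `a` to `b`: the triangle on `i`, `i + 1`
and `i + 2` has index `i`, and the outer face has index `n - 2`. -/
def pathSquareIdx (n a b : ℕ) : ℕ :=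
  min (n - 2)
    (if b = a + 1 then if a % 2 = 0 then a else a - 1
    else if a = b + 1 then if b % 2 = 1 then b else if b = 0 then n - 2 else b - 1
    else if b = a + 2 then if a % 2 = 1 then a else n - 2
    else if b % 2 = 0 then b else n - 2)

theorem pathSquareNext_adj (hn : 3 ≤ n) {v w : ℕ} (h : PathSquareAdj n v w) :
    PathSquareAdj n v (pathSquareNext n v w) := by
  unfold PathSquareAdj pathSquareNext at *
  split_ifs <;> omega

/-- The even vertices lie along one side of the strip and the odd ones along the other. The cyclic
order at an even `v` is `v - 2`, `v + 2`, `v + 1`, `v - 1`, and the reverse at an odd `v`, with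
missing neighbours skipped. The witness is the predecessor of `x` in this order. -/
theorem exists_pathSquareNext_eq (hn : 3 ≤ n) {v x : ℕ} (h : PathSquareAdj n v x) :
    ∃ w, PathSquareAdj n v w ∧ pathSquareNext n v w = x := by
  unfold PathSquareAdj at *
  have hx : x + 2 = v ∨ x + 1 = v ∨ x = v + 1 ∨ x = v + 2 := by omega
  by_cases hv : v % 2 = 0
  · rcases hx with hx | hx | hx | hx
    · exact ⟨v - 1, by omega, by unfold pathSquareNext; split_ifs <;> omega⟩
    · by_cases h1 : v + 1 < n
      · exact ⟨v + 1, by omega, by unfold pathSquareNext; split_ifs <;> omega⟩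
      · exact ⟨v - 2, by omega, by unfold pathSquareNext; split_ifs <;> omega⟩
    · by_cases h1 : v + 2 < n
      · exact ⟨v + 2, by omega, by unfold pathSquareNext; split_ifs <;> omega⟩
      · exact ⟨v - 2, by omega, by unfold pathSquareNext; split_ifs <;> omega⟩
    · by_cases h1 : v = 0
      · exact ⟨v + 1, by omega, by unfold pathSquareNext; split_ifs <;> omega⟩
      · exact ⟨v - 2, by omega, by unfold pathSquareNext; split_ifs <;> omega⟩
  · rcases hx with hx | hx | hx | hx
    · by_cases h1 : v + 2 < n
      · exact ⟨v + 2, by omega, by unfold pathSquareNext; split_ifs <;> omega⟩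
      · by_cases h2 : v + 1 < n
        · exact ⟨v + 1, by omega, by unfold pathSquareNext; split_ifs <;> omega⟩
        · exact ⟨v - 1, by omega, by unfold pathSquareNext; split_ifs <;> omega⟩
    · by_cases h1 : 2 ≤ v
      · exact ⟨v - 2, by omega, by unfold pathSquareNext; split_ifs <;> omega⟩
      · by_cases h2 : v + 2 < n
        · exact ⟨v + 2, by omega, by unfold pathSquareNext; split_ifs <;> omega⟩
        · exact ⟨v + 1, by omega, by unfold pathSquareNext; split_ifs <;> omega⟩
    · exact ⟨v - 1, by omega, by unfold pathSquareNext; split_ifs <;> omega⟩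
    · exact ⟨v + 1, by omega, by unfold pathSquareNext; split_ifs <;> omega⟩

theorem pathSquareIdx_succ_of_even {a b : ℕ} (h : b = a + 1) (ha : a % 2 = 0) :
    pathSquareIdx n a b = min (n - 2) a := by
  unfold pathSquareIdx; rw [if_pos h, if_pos ha]

theorem pathSquareIdx_succ_of_odd {a b : ℕ} (h : b = a + 1) (ha : a % 2 = 1) :
    pathSquareIdx n a b = min (n - 2) (a - 1) := by
  unfold pathSquareIdx; rw [if_pos h, if_neg (by omega)]

theorem pathSquareIdx_pred_of_odd {a b : ℕ} (h : b + 1 = a) (hb : b % 2 = 1) :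
    pathSquareIdx n a b = min (n - 2) b := by
  unfold pathSquareIdx; rw [if_neg (by omega), if_pos h.symm, if_pos hb]

theorem pathSquareIdx_pred_of_even {a b : ℕ} (h : b + 1 = a) (hb : b % 2 = 0) (h0 : b ≠ 0) :
    pathSquareIdx n a b = min (n - 2) (b - 1) := by
  unfold pathSquareIdx; rw [if_neg (by omega), if_pos h.symm, if_neg (by omega), if_neg h0]

theorem pathSquareIdx_one_zero : pathSquareIdx n 1 0 = n - 2 := by
  simp [pathSquareIdx]

theorem pathSquareIdx_add_two_of_odd {a b : ℕ} (h : b = a + 2) (ha : a % 2 = 1) :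
    pathSquareIdx n a b = min (n - 2) a := by
  unfold pathSquareIdx; rw [if_neg (by omega), if_neg (by omega), if_pos h, if_pos ha]

theorem pathSquareIdx_add_two_of_even {a b : ℕ} (h : b = a + 2) (ha : a % 2 = 0) :
    pathSquareIdx n a b = n - 2 := by
  unfold pathSquareIdx
  rw [if_neg (by omega), if_neg (by omega), if_pos h, if_neg (by omega), min_self]

theorem pathSquareIdx_sub_two_of_even {a b : ℕ} (h : b + 2 = a) (hb : b % 2 = 0) :
    pathSquareIdx n a b = min (n - 2) b := by
  unfold pathSquareIdx
  rw [if_neg (by omega), if_neg (by omega), if_neg (by omega), if_pos hb]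

theorem pathSquareIdx_sub_two_of_odd {a b : ℕ} (h : b + 2 = a) (hb : b % 2 = 1) :
    pathSquareIdx n a b = n - 2 := by
  unfold pathSquareIdx
  rw [if_neg (by omega), if_neg (by omega), if_neg (by omega), if_neg (by omega), min_self]

/-- The index is constant along facial walks. Taking the minimum with `n - 2` assigns the triangles
that would lie beyond the end of the strip to the outer face. -/
theorem pathSquareIdx_next (hn : 3 ≤ n) {a b : ℕ} (h : PathSquareAdj n a b) :
    pathSquareIdx n b (pathSquareNext n b a) = pathSquareIdx n a b := by
  unfold PathSquareAdj at h
  have hx : a + 2 = b ∨ a + 1 = b ∨ a = b + 1 ∨ a = b + 2 := by omega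
  by_cases hb : b % 2 = 0
  · rcases hx with hx | hx | hx | hx
    · rw [pathSquareIdx_add_two_of_even hx.symm (by omega)]
      by_cases h1 : b + 2 < n
      · have e : pathSquareNext n b a = b + 2 := by unfold pathSquareNext; split_ifs <;> omega
        rw [pathSquareIdx_add_two_of_even e hb]
      · by_cases h2 : b + 1 < n
        · have e : pathSquareNext n b a = b + 1 := by unfold pathSquareNext; split_ifs <;> omega
          rw [pathSquareIdx_succ_of_even e hb]
          omega
        · have e : pathSquareNext n b a + 1 = b := by unfold pathSquareNext; split_ifs <;> omega
          rw [pathSquareIdx_pred_of_odd e (by omega)]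
          omega
    · have e : pathSquareNext n b a + 2 = b := by unfold pathSquareNext; split_ifs <;> omega
      rw [pathSquareIdx_sub_two_of_even e (by omega), pathSquareIdx_succ_of_odd hx.symm (by omega)]
      omega
    · by_cases h0 : b = 0
      · subst h0
        subst hx
        have e : pathSquareNext n 0 1 = 0 + 2 := by simp [pathSquareNext]
        rw [pathSquareIdx_add_two_of_even e hb, pathSquareIdx_one_zero]
      · have e : pathSquareNext n b a + 1 = b := by unfold pathSquareNext; split_ifs <;> omega
        rw [pathSquareIdx_pred_of_odd e (by omega), pathSquareIdx_pred_of_even hx.symm hb h0]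
        omega
    · have e : pathSquareNext n b a = b + 1 := by unfold pathSquareNext; split_ifs <;> omega
      rw [pathSquareIdx_succ_of_even e hb, pathSquareIdx_sub_two_of_even hx.symm hb]
  · rcases hx with hx | hx | hx | hx
    · have e : pathSquareNext n b a + 1 = b := by unfold pathSquareNext; split_ifs <;> omega
      rw [pathSquareIdx_pred_of_even e (by omega) (by omega),
        pathSquareIdx_add_two_of_odd hx.symm (by omega)]
      omega
    · rw [pathSquareIdx_succ_of_even hx.symm (by omega)]
      by_cases h1 : b + 1 < n
      · have e : pathSquareNext n b a = b + 1 := by unfold pathSquareNext; split_ifs <;> omega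
        rw [pathSquareIdx_succ_of_odd e (by omega)]
        omega
      · have e : pathSquareNext n b a + 2 = b := by unfold pathSquareNext; split_ifs <;> omega
        rw [pathSquareIdx_sub_two_of_odd e (by omega)]
        omega
    · rw [pathSquareIdx_pred_of_odd hx.symm (by omega)]
      by_cases h1 : b + 2 < n
      · have e : pathSquareNext n b a = b + 2 := by unfold pathSquareNext; split_ifs <;> omega
        rw [pathSquareIdx_add_two_of_odd e (by omega)]
      · by_cases h2 : 2 ≤ b
        · have e : pathSquareNext n b a + 2 = b := by unfold pathSquareNext; split_ifs <;> omega
          rw [pathSquareIdx_sub_two_of_odd e (by omega)]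
          omega
        · obtain rfl : b = 1 := by omega
          have e : pathSquareNext n 1 a = 0 := by unfold pathSquareNext; split_ifs <;> omega
          rw [e, pathSquareIdx_one_zero]
          omega
    · rw [pathSquareIdx_sub_two_of_odd hx.symm (by omega)]
      by_cases h2 : 2 ≤ b
      · have e : pathSquareNext n b a + 2 = b := by unfold pathSquareNext; split_ifs <;> omega
        rw [pathSquareIdx_sub_two_of_odd e (by omega)]
      · obtain rfl : b = 1 := by omega
        have e : pathSquareNext n 1 a = 0 := by unfold pathSquareNext; split_ifs <;> omega
        rw [e, pathSquareIdx_one_zero]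

theorem pathSquareIdx_lt (hn : 3 ≤ n) (a b : ℕ) : pathSquareIdx n a b < n - 1 := by
  unfold pathSquareIdx
  omega

theorem pathSquareAdj_of_adj {a b : Fin n} (h : (pathSquare n).Adj a b) : PathSquareAdj n a b :=
  ⟨a.2, b.2, fun e => h.1 (Fin.ext e), h.2⟩

/-- The dart from `a` to `b`. -/
def pathSquareDart {a b : ℕ} (h : PathSquareAdj n a b) : (pathSquare n).Dart :=
  ⟨(⟨a, h.1⟩, ⟨b, h.2.1⟩), fun e => h.2.2.1 (Fin.mk.inj_iff.1 e), h.2.2.2⟩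

theorem exists_eq_pathSquareDart (d : (pathSquare n).Dart) :
    ∃ (a b : ℕ) (h : PathSquareAdj n a b), d = pathSquareDart h :=
  ⟨d.fst, d.snd, pathSquareAdj_of_adj d.adj, rfl⟩

/-- The rotation at the vertices of the square of a path. -/
noncomputable def pathSquareRot (hn : 3 ≤ n) : Equiv.Perm (pathSquare n).Dart :=
  Equiv.ofBijective
    (fun d => pathSquareDart (pathSquareNext_adj hn (pathSquareAdj_of_adj d.adj)))
    (Finite.surjective_iff_bijective.1 (by
      intro d
      obtain ⟨a, b, h, rfl⟩ := exists_eq_pathSquareDart d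
      obtain ⟨w, hw, rfl⟩ := exists_pathSquareNext_eq hn h
      exact ⟨pathSquareDart hw, rfl⟩))

theorem pathSquareRot_step (hn : 3 ≤ n) {v w w' : ℕ} (h : PathSquareAdj n v w)
    (h' : PathSquareAdj n v w') (he : pathSquareNext n v w = w') :
    (pathSquareRot hn).SameCycle (pathSquareDart h) (pathSquareDart h') := by
  subst he
  exact ⟨1, rfl⟩

theorem pathSquareRot_sameCycle (hn : 3 ≤ n) {v w w' : ℕ} (h : PathSquareAdj n v w)
    (h' : PathSquareAdj n v w') :
    (pathSquareRot hn).SameCycle (pathSquareDart h) (pathSquareDart h') := by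
  -- All darts at `v` are led by rotation steps to one dart, chosen according to the parity of `v`
  -- and to which of `v + 1` and `v + 2` exist.
  have key : ∃ (c : ℕ) (hc : PathSquareAdj n v c), ∀ w (h : PathSquareAdj n v w),
      (pathSquareRot hn).SameCycle (pathSquareDart h) (pathSquareDart hc) := by
    have h0 := h
    unfold PathSquareAdj at h0
    have one : ∀ {w x c : ℕ} (hx : PathSquareAdj n v x) (hc : PathSquareAdj n v c),
        (pathSquareRot hn).SameCycle (pathSquareDart hx) (pathSquareDart hc) →
        ∀ (h : PathSquareAdj n v w), pathSquareNext n v w = x →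
        (pathSquareRot hn).SameCycle (pathSquareDart h) (pathSquareDart hc) :=
      fun hx hc h1 h h2 => (pathSquareRot_step hn h hx h2).trans h1
    have hcases : ∀ w, PathSquareAdj n v w → w + 2 = v ∨ w + 1 = v ∨ w = v + 1 ∨ w = v + 2 := by
      intro w hw
      unfold PathSquareAdj at hw
      omega
    by_cases hv : v % 2 = 0
    · by_cases h2 : v + 2 < n
      · have h1 : PathSquareAdj n v (v + 1) := by unfold PathSquareAdj; omega
        have h2' : PathSquareAdj n v (v + 2) := by unfold PathSquareAdj; omega
        have e2 := pathSquareRot_step hn h2' h1 (by unfold pathSquareNext; split_ifs <;> omega)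
        have em : ∀ w (hw : PathSquareAdj n v w), w + 2 = v →
            (pathSquareRot hn).SameCycle (pathSquareDart hw) (pathSquareDart h1) :=
          fun w hw e => one h2' h1 e2 hw (by simp [pathSquareNext, hv, e, h2])
        refine ⟨v + 1, h1, fun w hw => ?_⟩
        rcases hcases w hw with e | e | e | e
        · exact em w hw e
        · have h3 : PathSquareAdj n v (v - 2) := by unfold PathSquareAdj; omega
          exact one h3 h1 (em _ h3 (by omega)) hw (by unfold pathSquareNext; split_ifs <;> omega)
        · subst e; exact Equiv.Perm.SameCycle.refl _ _
        · subst e; exact e2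
      · by_cases h1 : v + 1 < n
        · have h1' : PathSquareAdj n v (v + 1) := by unfold PathSquareAdj; omega
          have em : ∀ w (hw : PathSquareAdj n v w), w + 2 = v →
              (pathSquareRot hn).SameCycle (pathSquareDart hw) (pathSquareDart h1') :=
            fun w hw e => pathSquareRot_step hn hw h1' (by simp [pathSquareNext, hv, e, h2, h1])
          refine ⟨v + 1, h1', fun w hw => ?_⟩
          rcases hcases w hw with e | e | e | e
          · exact em w hw e
          · have h3 : PathSquareAdj n v (v - 2) := by unfold PathSquareAdj; omega
            exact one h3 h1' (em _ h3 (by omega)) hw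
              (by unfold pathSquareNext; split_ifs <;> omega)
          · subst e; exact Equiv.Perm.SameCycle.refl _ _
          · have := hw.2.1; omega
        · have h1' : PathSquareAdj n v (v - 1) := by unfold PathSquareAdj; omega
          refine ⟨v - 1, h1', fun w hw => ?_⟩
          have := hw.2.1
          rcases hcases w hw with e | e | e | e
          · exact pathSquareRot_step hn hw h1' (by simp [pathSquareNext, hv, e, h2, h1])
          · obtain rfl : w = v - 1 := by omega
            exact Equiv.Perm.SameCycle.refl _ _
          · omega
          · omega
    · by_cases h2 : v + 2 < n
      · have h1 : PathSquareAdj n v (v + 1) := by unfold PathSquareAdj; omega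
        have h2' : PathSquareAdj n v (v + 2) := by unfold PathSquareAdj; omega
        have e1 := pathSquareRot_step hn h1 h2' (by unfold pathSquareNext; split_ifs <;> omega)
        have em : ∀ w (hw : PathSquareAdj n v w), w + 1 = v →
            (pathSquareRot hn).SameCycle (pathSquareDart hw) (pathSquareDart h2') :=
          fun w hw e => one h1 h2' e1 hw (by unfold pathSquareNext; split_ifs <;> omega)
        refine ⟨v + 2, h2', fun w hw => ?_⟩
        rcases hcases w hw with e | e | e | e
        · have h3 : PathSquareAdj n v (v - 1) := by unfold PathSquareAdj; omega
          exact one h3 h2' (em _ h3 (by omega)) hw (by simp [pathSquareNext, hv, e])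
        · exact em w hw e
        · subst e; exact e1
        · subst e; exact Equiv.Perm.SameCycle.refl _ _
      · by_cases h1 : v + 1 < n
        · have h1' : PathSquareAdj n v (v + 1) := by unfold PathSquareAdj; omega
          have em : ∀ w (hw : PathSquareAdj n v w), w + 1 = v →
              (pathSquareRot hn).SameCycle (pathSquareDart hw) (pathSquareDart h1') :=
            fun w hw e => pathSquareRot_step hn hw h1'
              (by unfold pathSquareNext; split_ifs <;> omega)
          refine ⟨v + 1, h1', fun w hw => ?_⟩
          rcases hcases w hw with e | e | e | e
          · have h3 : PathSquareAdj n v (v - 1) := by unfold PathSquareAdj; omega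
            exact one h3 h1' (em _ h3 (by omega)) hw (by simp [pathSquareNext, hv, e])
          · exact em w hw e
          · subst e; exact Equiv.Perm.SameCycle.refl _ _
          · have := hw.2.1; omega
        · have h1' : PathSquareAdj n v (v - 2) := by unfold PathSquareAdj; omega
          refine ⟨v - 2, h1', fun w hw => ?_⟩
          have := hw.2.1
          rcases hcases w hw with e | e | e | e
          · obtain rfl : w = v - 2 := by omega
            exact Equiv.Perm.SameCycle.refl _ _
          · exact pathSquareRot_step hn hw h1' (by unfold pathSquareNext; split_ifs <;> omega)
          · omega
          · omega
  obtain ⟨c, hc, H⟩ := key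
  exact (H w h).trans (H w' h').symm

/-- The planar embedding of the square of a path as a strip of triangles. -/
noncomputable def pathSquareSystem (hn : 3 ≤ n) : RotationSystem (pathSquare n) where
  rot := pathSquareRot hn
  fst_rot _ := rfl
  sameCycle_of_fst_eq d e hde := by
    obtain ⟨a, b, h, rfl⟩ := exists_eq_pathSquareDart d
    obtain ⟨a', b', h', rfl⟩ := exists_eq_pathSquareDart e
    have : a = a' := Fin.mk.inj_iff.1 hde
    subst this
    exact pathSquareRot_sameCycle hn h h'

theorem PathSquareAdj.symm {a b : ℕ} (h : PathSquareAdj n a b) : PathSquareAdj n b a :=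
  ⟨h.2.1, h.1, h.2.2.1.symm, h.2.2.2.2, h.2.2.2.1⟩

theorem pathSquare_face_step (hn : 3 ≤ n) {a b c : ℕ} (h : PathSquareAdj n a b)
    (h' : PathSquareAdj n b c) (he : pathSquareNext n b a = c) :
    (pathSquareSystem hn).facePerm.SameCycle (pathSquareDart h) (pathSquareDart h') := by
  subst he
  exact ⟨1, rfl⟩

end PathSquareEmbedding

/-! ### Faces, weak dual and maximality of the triangle strip -/

section PathSquareFaces

variable {n : ℕ}

theorem pathSquareIdx_cases {a b : ℕ} (h : PathSquareAdj n a b) :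
    (a + 1 = b ∧ a % 2 = 0 ∧ pathSquareIdx n a b = min (n - 2) a) ∨
    (a + 1 = b ∧ a % 2 = 1 ∧ pathSquareIdx n a b = min (n - 2) (a - 1)) ∨
    (b + 1 = a ∧ b % 2 = 1 ∧ pathSquareIdx n a b = min (n - 2) b) ∨
    (b + 1 = a ∧ b % 2 = 0 ∧ b ≠ 0 ∧ pathSquareIdx n a b = min (n - 2) (b - 1)) ∨
    (a = 1 ∧ b = 0 ∧ pathSquareIdx n a b = n - 2) ∨
    (a + 2 = b ∧ a % 2 = 1 ∧ pathSquareIdx n a b = a) ∨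
    (a + 2 = b ∧ a % 2 = 0 ∧ pathSquareIdx n a b = n - 2) ∨
    (b + 2 = a ∧ b % 2 = 0 ∧ pathSquareIdx n a b = b) ∨
    (b + 2 = a ∧ b % 2 = 1 ∧ pathSquareIdx n a b = n - 2) := by
  unfold PathSquareAdj at h
  have hx : a + 1 = b ∨ b + 1 = a ∨ a + 2 = b ∨ b + 2 = a := by omega
  rcases hx with hx | hx | hx | hx
  · rcases Nat.mod_two_eq_zero_or_one a with ha | ha
    · exact Or.inl ⟨hx, ha, pathSquareIdx_succ_of_even hx.symm ha⟩
    · exact Or.inr (Or.inl ⟨hx, ha, pathSquareIdx_succ_of_odd hx.symm ha⟩)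
  · rcases Nat.mod_two_eq_zero_or_one b with hb | hb
    · by_cases h0 : b = 0
      · subst h0
        subst hx
        exact Or.inr (Or.inr (Or.inr (Or.inr (Or.inl ⟨rfl, rfl, pathSquareIdx_one_zero⟩))))
      · exact Or.inr (Or.inr (Or.inr (Or.inl
          ⟨hx, hb, h0, pathSquareIdx_pred_of_even hx hb h0⟩)))
    · exact Or.inr (Or.inr (Or.inl ⟨hx, hb, pathSquareIdx_pred_of_odd hx hb⟩))
  · rcases Nat.mod_two_eq_zero_or_one a with ha | ha
    · exact Or.inr (Or.inr (Or.inr (Or.inr (Or.inr (Or.inr (Or.inl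
        ⟨hx, ha, pathSquareIdx_add_two_of_even hx.symm ha⟩))))))
    · refine Or.inr (Or.inr (Or.inr (Or.inr (Or.inr (Or.inl ⟨hx, ha, ?_⟩)))))
      rw [pathSquareIdx_add_two_of_odd hx.symm ha]
      omega
  · rcases Nat.mod_two_eq_zero_or_one b with hb | hb
    · refine Or.inr (Or.inr (Or.inr (Or.inr (Or.inr (Or.inr (Or.inr (Or.inl ⟨hx, hb, ?_⟩)))))))
      rw [pathSquareIdx_sub_two_of_even hx hb]
      omega
    · exact Or.inr (Or.inr (Or.inr (Or.inr (Or.inr (Or.inr (Or.inr (Or.inr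
        ⟨hx, hb, pathSquareIdx_sub_two_of_odd hx hb⟩)))))))

theorem pathSquareAdj_one_zero (hn : 3 ≤ n) : PathSquareAdj n 1 0 := by
  unfold PathSquareAdj; omega

/-- The outer walk takes the dart from 1 to 0, climbs along the even vertices, crosses over at the
end of the strip and descends along the odd ones. -/
theorem pathSquare_outer_even (hn : 3 ≤ n) {a b : ℕ} (h : PathSquareAdj n a b) (hab : a + 2 = b)
    (ha : a % 2 = 0) : (pathSquareSystem hn).facePerm.SameCycle
      (pathSquareDart (pathSquareAdj_one_zero hn)) (pathSquareDart h) := by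
  induction a using Nat.strong_induction_on generalizing b with
  | _ a ih =>
    by_cases h0 : a = 0
    · subst h0
      subst hab
      exact pathSquare_face_step hn _ _ (by simp [pathSquareNext])
    · have h1 := h.2.1
      have h' : PathSquareAdj n (a - 2) a := by unfold PathSquareAdj; omega
      refine (ih (a - 2) (by omega) h' (by omega) (by omega)).trans
        (pathSquare_face_step hn h' h ?_)
      unfold pathSquareNext; split_ifs <;> omega

theorem pathSquare_outer_odd (hn : 3 ≤ n) {a b : ℕ} (h : PathSquareAdj n a b) (hab : b + 2 = a)
    (hb : b % 2 = 1) : (pathSquareSystem hn).facePerm.SameCycle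
      (pathSquareDart h) (pathSquareDart (pathSquareAdj_one_zero hn)) := by
  induction b using Nat.strong_induction_on generalizing a with
  | _ b ih =>
    have h1 := h.1
    by_cases h0 : b = 1
    · subst h0
      subst hab
      exact pathSquare_face_step hn _ _ (by simp [pathSquareNext])
    · have h' : PathSquareAdj n b (b - 2) := by unfold PathSquareAdj; omega
      refine (pathSquare_face_step hn h h' ?_).trans (ih (b - 2) (by omega) h' (by omega) (by omega))
      unfold pathSquareNext; split_ifs <;> omega

theorem pathSquare_outer_sameCycle (hn : 3 ≤ n) {a b : ℕ} (h : PathSquareAdj n a b)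
    (hi : pathSquareIdx n a b = n - 2) : (pathSquareSystem hn).facePerm.SameCycle
      (pathSquareDart h) (pathSquareDart (pathSquareAdj_one_zero hn)) := by
  have ha := h.1
  have hb := h.2.1
  rcases pathSquareIdx_cases h with ⟨h1, h2, h3⟩ | ⟨h1, h2, h3⟩ | ⟨h1, h2, h3⟩ |
    ⟨h1, h2, h0, h3⟩ | ⟨h1, h2, h3⟩ | ⟨h1, h2, h3⟩ | ⟨h1, h2, h3⟩ | ⟨h1, h2, h3⟩ | ⟨h1, h2, h3⟩
  · have h' : PathSquareAdj n (a - 2) a := by unfold PathSquareAdj; omega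
    exact ((pathSquare_outer_even hn h' (by omega) (by omega)).trans (pathSquare_face_step hn h' h
      (by unfold pathSquareNext; split_ifs <;> omega))).symm
  · omega
  · by_cases hb1 : b = 1
    · subst hb1
      exact pathSquare_face_step hn h (pathSquareAdj_one_zero hn)
        (by unfold pathSquareNext; split_ifs <;> omega)
    · have h' : PathSquareAdj n b (b - 2) := by unfold PathSquareAdj; omega
      exact (pathSquare_face_step hn h h' (by unfold pathSquareNext; split_ifs <;> omega)).trans
        (pathSquare_outer_odd hn h' (by omega) (by omega))
  · omega
  · subst h1
    subst h2
    exact Equiv.Perm.SameCycle.refl _ _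
  · omega
  · exact (pathSquare_outer_even hn h h1 h2).symm
  · omega
  · exact pathSquare_outer_odd hn h h1 h2

theorem pathSquareAdj_succ (i : ℕ) (hi : i < n - 2) : PathSquareAdj n (i + 1) (i + 2) := by
  unfold PathSquareAdj; omega

theorem pathSquareAdj_succ' (i : ℕ) (hi : i < n - 2) : PathSquareAdj n (i + 2) (i + 1) := by
  unfold PathSquareAdj; omega

theorem pathSquare_inner_even (hn : 3 ≤ n) {a b i : ℕ} (hi : i < n - 2) (hi2 : i % 2 = 0)
    (h : PathSquareAdj n a b) (hab : pathSquareIdx n a b = i) :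
    (pathSquareSystem hn).facePerm.SameCycle (pathSquareDart h)
      (pathSquareDart (pathSquareAdj_succ i hi)) := by
  have h01 : PathSquareAdj n i (i + 1) := by unfold PathSquareAdj; omega
  have h20 : PathSquareAdj n (i + 2) i := by unfold PathSquareAdj; omega
  have e1 := pathSquare_face_step hn h01 (pathSquareAdj_succ i hi)
    (by unfold pathSquareNext; split_ifs <;> omega)
  have e2 := pathSquare_face_step hn h20 h01 (by unfold pathSquareNext; split_ifs <;> omega)
  rcases pathSquareIdx_cases h with ⟨h1, h2, h3⟩ | ⟨h1, h2, h3⟩ | ⟨h1, h2, h3⟩ |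
    ⟨h1, h2, h0, h3⟩ | ⟨h1, h2, h3⟩ | ⟨h1, h2, h3⟩ | ⟨h1, h2, h3⟩ | ⟨h1, h2, h3⟩ | ⟨h1, h2, h3⟩
  · obtain rfl : a = i := by omega
    subst h1
    exact e1
  · obtain rfl : a = i + 1 := by omega
    subst h1
    exact Equiv.Perm.SameCycle.refl _ _
  · omega
  · omega
  · omega
  · omega
  · omega
  · obtain rfl : b = i := by omega
    subst h1
    exact e2.trans e1
  · omega

theorem pathSquare_inner_odd (hn : 3 ≤ n) {a b i : ℕ} (hi : i < n - 2) (hi2 : i % 2 = 1)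
    (h : PathSquareAdj n a b) (hab : pathSquareIdx n a b = i) :
    (pathSquareSystem hn).facePerm.SameCycle (pathSquareDart h)
      (pathSquareDart (pathSquareAdj_succ' i hi)) := by
  have h10 : PathSquareAdj n (i + 1) i := by unfold PathSquareAdj; omega
  have h02 : PathSquareAdj n i (i + 2) := by unfold PathSquareAdj; omega
  have e1 := pathSquare_face_step hn h02 (pathSquareAdj_succ' i hi)
    (by unfold pathSquareNext; split_ifs <;> omega)
  have e2 := pathSquare_face_step hn h10 h02 (by unfold pathSquareNext; split_ifs <;> omega)
  rcases pathSquareIdx_cases h with ⟨h1, h2, h3⟩ | ⟨h1, h2, h3⟩ | ⟨h1, h2, h3⟩ |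
    ⟨h1, h2, h0, h3⟩ | ⟨h1, h2, h3⟩ | ⟨h1, h2, h3⟩ | ⟨h1, h2, h3⟩ | ⟨h1, h2, h3⟩ | ⟨h1, h2, h3⟩
  · omega
  · omega
  · obtain rfl : b = i := by omega
    subst h1
    exact e2.trans e1
  · obtain rfl : b = i + 1 := by omega
    subst h1
    exact Equiv.Perm.SameCycle.refl _ _
  · omega
  · obtain rfl : a = i := by omega
    subst h1
    exact e1
  · omega
  · omega
  · omega

/-- The index of the face through a dart. -/
def pathSquareFaceIdx (d : (pathSquare n).Dart) : ℕ := pathSquareIdx n d.fst d.snd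

theorem pathSquareFaceIdx_facePerm (hn : 3 ≤ n) (d : (pathSquare n).Dart) :
    pathSquareFaceIdx ((pathSquareSystem hn).facePerm d) = pathSquareFaceIdx d := by
  obtain ⟨a, b, h, rfl⟩ := exists_eq_pathSquareDart d
  exact pathSquareIdx_next hn h

/-- The index is a complete invariant of faces: for each value, all darts with that index are walked
to one reference dart. -/
theorem pathSquare_sameCycle_iff (hn : 3 ≤ n) {d e : (pathSquare n).Dart} :
    (pathSquareSystem hn).facePerm.SameCycle d e ↔ pathSquareFaceIdx d = pathSquareFaceIdx e := by
  refine ⟨fun h => apply_eq_of_sameCycle _ (pathSquareFaceIdx_facePerm hn) h, fun h => ?_⟩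
  obtain ⟨a, b, hd, rfl⟩ := exists_eq_pathSquareDart d
  obtain ⟨a', b', he, rfl⟩ := exists_eq_pathSquareDart e
  change pathSquareIdx n a b = pathSquareIdx n a' b' at h
  by_cases hi : pathSquareIdx n a b = n - 2
  · exact (pathSquare_outer_sameCycle hn hd hi).trans
      (pathSquare_outer_sameCycle hn he (h.symm.trans hi)).symm
  · have hlt : pathSquareIdx n a b < n - 2 := by
      have := pathSquareIdx_lt hn a b
      omega
    rcases Nat.mod_two_eq_zero_or_one (pathSquareIdx n a b) with hp | hp
    · exact (pathSquare_inner_even hn hlt hp hd rfl).trans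
        (pathSquare_inner_even hn hlt hp he h.symm).symm
    · exact (pathSquare_inner_odd hn hlt hp hd rfl).trans
        (pathSquare_inner_odd hn hlt hp he h.symm).symm

theorem exists_pathSquareFaceIdx (hn : 3 ≤ n) (i : ℕ) (hi : i < n - 1) :
    ∃ d : (pathSquare n).Dart, pathSquareFaceIdx d = i := by
  by_cases hi' : i = n - 2
  · exact ⟨pathSquareDart (pathSquareAdj_one_zero hn), pathSquareIdx_one_zero.trans hi'.symm⟩
  · have hlt : i < n - 2 := by omega
    rcases Nat.mod_two_eq_zero_or_one i with hp | hp
    · refine ⟨pathSquareDart (pathSquareAdj_succ i hlt), ?_⟩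
      refine (pathSquareIdx_succ_of_odd (a := i + 1) rfl (by omega)).trans ?_
      omega
    · refine ⟨pathSquareDart (pathSquareAdj_succ' i hlt), ?_⟩
      refine (pathSquareIdx_pred_of_even (b := i + 1) rfl (by omega) (by omega)).trans ?_
      omega

theorem card_pathSquare_face (hn : 3 ≤ n) : Nat.card (pathSquareSystem hn).Face = n - 1 := by
  rw [RotationSystem.card_face, numCycles_eq_card (Y := Fin (n - 1))
    (fun d => ⟨pathSquareFaceIdx d, pathSquareIdx_lt hn _ _⟩)]
  · exact Nat.card_fin _
  · intro i
    obtain ⟨d, hd⟩ := exists_pathSquareFaceIdx hn i i.2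
    exact ⟨d, Fin.ext hd⟩
  · exact fun d => Fin.ext (pathSquareFaceIdx_facePerm hn d)
  · exact fun d e h => (pathSquare_sameCycle_iff hn).2 (Fin.mk.inj_iff.1 h)

theorem card_pathSquare_edgeSet (hn : 3 ≤ n) : Nat.card (pathSquare n).edgeSet = 2 * n - 3 := by
  let f : Fin (n - 1) ⊕ Fin (n - 2) → Sym2 (Fin n) := Sum.elim
    (fun i => s(⟨i, by omega⟩, ⟨i + 1, by omega⟩)) (fun i => s(⟨i, by omega⟩, ⟨i + 2, by omega⟩))
  have hinj : Function.Injective f := by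
    rintro (i | i) (j | j) h <;> simp [f] at h <;> first
      | (exfalso; omega)
      | (congr 1; omega)
  have hrange : Set.range f = (pathSquare n).edgeSet := by
    ext e
    induction e with | _ a b
    constructor
    · rintro ⟨i | i, hi⟩
      · rw [← hi]
        exact ⟨by simp, by simp; omega, by simp⟩
      · rw [← hi]
        exact ⟨by simp, by simp; omega, by simp⟩
    · intro h
      obtain ⟨h1, h2, h3, h4, h5⟩ :=
        pathSquareAdj_of_adj (show (pathSquare n).Adj a b from h)
      have hx : (a : ℕ) + 1 = b ∨ (b : ℕ) + 1 = a ∨ (a : ℕ) + 2 = b ∨ (b : ℕ) + 2 = a := by omega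
      rcases hx with hx | hx | hx | hx
      · exact ⟨Sum.inl ⟨a, by omega⟩, by simp [f, hx]⟩
      · exact ⟨Sum.inl ⟨b, by omega⟩, by simp [f, hx]⟩
      · exact ⟨Sum.inr ⟨a, by omega⟩, by simp [f, hx]⟩
      · exact ⟨Sum.inr ⟨b, by omega⟩, by simp [f, hx]⟩
  rw [← hrange, Nat.card_range_of_injective hinj, Nat.card_sum, Nat.card_fin, Nat.card_fin]
  omega

theorem pathSquare_connected (hn : 3 ≤ n) : (pathSquare n).Connected := by
  have h : ∀ i (hi : i < n), (pathSquare n).Reachable ⟨0, by omega⟩ ⟨i, hi⟩ := by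
    intro i
    induction i with
    | zero => exact fun _ => SimpleGraph.Reachable.refl _
    | succ i ih =>
      intro hi
      refine (ih (by omega)).trans (SimpleGraph.Adj.reachable ?_)
      exact ⟨by simp, by simp; omega, by simp⟩
  have : Nonempty (Fin n) := ⟨⟨0, by omega⟩⟩
  exact ⟨fun v w => (h v v.2).symm.trans (h w w.2)⟩

/-- The outer face of the embedding of the square of a path. -/
def pathSquareOuter (hn : 3 ≤ n) : Set (pathSquareSystem hn).Face :=
  {(pathSquareSystem hn).faceOf (pathSquareDart (pathSquareAdj_one_zero hn))}

theorem mem_pathSquareOuter (hn : 3 ≤ n) {d : (pathSquare n).Dart} :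
    (pathSquareSystem hn).faceOf d ∈ pathSquareOuter hn ↔ pathSquareFaceIdx d = n - 2 := by
  rw [pathSquareOuter, Set.mem_singleton_iff, RotationSystem.faceOf_eq,
    pathSquare_sameCycle_iff hn]
  rw [show pathSquareFaceIdx (pathSquareDart (pathSquareAdj_one_zero hn)) = n - 2 from
    pathSquareIdx_one_zero]

theorem pathSquare_exists_adj (hn : 3 ≤ n) (v : Fin n) :
    ∃ d : (pathSquare n).Dart, d.fst = v ∧ pathSquareFaceIdx d = n - 2 := by
  have hv := v.2
  have key : ∀ (b : ℕ) (h : PathSquareAdj n v b), pathSquareIdx n v b = n - 2 →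
      ∃ d : (pathSquare n).Dart, d.fst = v ∧ pathSquareFaceIdx d = n - 2 :=
    fun b h hb => ⟨pathSquareDart h, rfl, hb⟩
  rcases Nat.mod_two_eq_zero_or_one (v : ℕ) with hp | hp
  · by_cases h2 : (v : ℕ) + 2 < n
    · exact key (v + 2) (by unfold PathSquareAdj; omega) (pathSquareIdx_add_two_of_even rfl hp)
    · by_cases h1 : (v : ℕ) + 1 < n
      · refine key (v + 1) (by unfold PathSquareAdj; omega)
          ((pathSquareIdx_succ_of_even rfl hp).trans ?_)
        omega
      · refine key (v - 1) (by unfold PathSquareAdj; omega)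
          ((pathSquareIdx_pred_of_odd (by omega) (by omega)).trans ?_)
        omega
  · by_cases h1 : (v : ℕ) = 1
    · refine key 0 (by unfold PathSquareAdj; omega) ?_
      rw [h1]
      exact pathSquareIdx_one_zero
    · exact key (v - 2) (by unfold PathSquareAdj; omega)
        (pathSquareIdx_sub_two_of_odd (by omega) (by omega))

theorem pathSquare_isPlanar (hn : 3 ≤ n) : (pathSquareSystem hn).IsPlanar := by
  have h0 : Nat.card {v : Fin n // ∀ w, ¬ (pathSquare n).Adj v w} = 0 := by
    have : IsEmpty {v : Fin n // ∀ w, ¬ (pathSquare n).Adj v w} := by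
      refine ⟨fun v => ?_⟩
      obtain ⟨d, hd, -⟩ := pathSquare_exists_adj hn v.1
      exact v.2 d.snd (hd ▸ d.adj)
    exact Nat.card_of_isEmpty
  rw [RotationSystem.IsPlanar, h0, card_pathSquare_face hn, card_pathSquare_edgeSet hn,
    card_connectedComponent_of_connected (pathSquare_connected hn), Nat.card_fin]
  omega

theorem pathSquare_isOuter (hn : 3 ≤ n) : (pathSquareSystem hn).IsOuter (pathSquareOuter hn) := by
  refine ⟨fun d e hd he _ => hd.trans he.symm, fun v _ _ => ?_⟩
  obtain ⟨d, hd, hi⟩ := pathSquare_exists_adj hn v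
  exact ⟨d, hd, (mem_pathSquareOuter hn).2 hi⟩

theorem pathSquareFaceIdx_symm {d : (pathSquare n).Dart} (h1 : pathSquareFaceIdx d ≠ n - 2)
    (h2 : pathSquareFaceIdx d.symm ≠ n - 2) :
    pathSquareFaceIdx d + 1 = pathSquareFaceIdx d.symm ∨
      pathSquareFaceIdx d.symm + 1 = pathSquareFaceIdx d := by
  obtain ⟨a, b, h, rfl⟩ := exists_eq_pathSquareDart d
  change pathSquareIdx n a b ≠ n - 2 at h1
  change pathSquareIdx n b a ≠ n - 2 at h2
  change pathSquareIdx n a b + 1 = pathSquareIdx n b a ∨ pathSquareIdx n b a + 1 = pathSquareIdx n a b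
  have e1 := pathSquareIdx_cases h
  have e2 := pathSquareIdx_cases h.symm
  generalize pathSquareIdx n a b = p at *
  generalize pathSquareIdx n b a = q at *
  rcases e1 with h | h | h | h | h | h | h | h | h <;>
    rcases e2 with h' | h' | h' | h' | h' | h' | h' | h' | h' <;> omega

theorem exists_pathSquareFaceIdx_symm {i : ℕ} (hi : i + 1 < n - 2) :
    ∃ d : (pathSquare n).Dart, pathSquareFaceIdx d = i ∧ pathSquareFaceIdx d.symm = i + 1 := by
  rcases Nat.mod_two_eq_zero_or_one i with hp | hp
  · refine ⟨pathSquareDart (pathSquareAdj_succ i (by omega)),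
      (pathSquareIdx_succ_of_odd (a := i + 1) rfl (by omega)).trans ?_,
      (pathSquareIdx_pred_of_odd (b := i + 1) rfl (by omega)).trans ?_⟩ <;> omega
  · refine ⟨pathSquareDart (pathSquareAdj_succ' i (by omega)),
      (pathSquareIdx_pred_of_even (b := i + 1) rfl (by omega) (by omega)).trans ?_,
      (pathSquareIdx_succ_of_even (a := i + 1) rfl (by omega)).trans ?_⟩ <;> omega

theorem pathSquare_hasPathWeakDual (hn : 3 ≤ n) : HasPathWeakDual (pathSquare n) := by
  -- The strip has `n - 2 = k + 1` triangles, indexed in the order in which they share edges.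
  obtain ⟨k, rfl⟩ : ∃ k, n = k + 3 := ⟨n - 3, by omega⟩
  refine ⟨pathSquareSystem hn, pathSquareOuter hn, pathSquare_isPlanar hn, pathSquare_isOuter hn,
    k, ?_⟩
  have hrep : ∀ i : Fin (k + 1), ∃ d : (pathSquare (k + 3)).Dart, pathSquareFaceIdx d = i :=
    fun i => exists_pathSquareFaceIdx hn i (by omega)
  choose r hr using hrep
  have hout : ∀ i, (pathSquareSystem hn).faceOf (r i) ∉ pathSquareOuter hn := by
    intro i h
    rw [mem_pathSquareOuter, hr] at h
    omega
  have hface : ∀ d e, (pathSquareSystem hn).faceOf d = (pathSquareSystem hn).faceOf e ↔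
      pathSquareFaceIdx d = pathSquareFaceIdx e := fun d e => by
    rw [RotationSystem.faceOf_eq, pathSquare_sameCycle_iff hn]
  let e : Fin (k + 1) ≃ {f : (pathSquareSystem hn).Face // f ∉ pathSquareOuter hn} :=
    Equiv.ofBijective (fun i => ⟨_, hout i⟩) ⟨fun i j h => by
      have h1 := (hface _ _).1 (Subtype.mk.inj h)
      rw [hr, hr] at h1
      exact Fin.ext h1, by
      rintro ⟨f, hf⟩
      induction f using Quotient.inductionOn with | _ d
      have h1 : pathSquareFaceIdx d ≠ k + 3 - 2 := fun h => hf ((mem_pathSquareOuter hn).2 h)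
      have h2 : pathSquareFaceIdx d < k + 3 - 1 := pathSquareIdx_lt hn _ _
      refine ⟨⟨pathSquareFaceIdx d, by omega⟩, Subtype.ext ?_⟩
      exact (hface _ _).2 (hr _)⟩
  refine ⟨(RelIso.symm ⟨e, ?_⟩)⟩
  intro i j
  rw [SimpleGraph.pathGraph_adj]
  constructor
  · rintro ⟨hne, d, h1, h2⟩
    have h1' := (hface _ _).1 h1
    have h2' := (hface _ _).1 h2
    rw [hr] at h1' h2'
    have := pathSquareFaceIdx_symm (d := d) (by omega) (by omega)
    omega
  · intro hij
    refine ⟨fun h => ?_, ?_⟩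
    · have := e.injective h
      subst this
      omega
    · rcases hij with hij | hij
      · obtain ⟨d, h1, h2⟩ := exists_pathSquareFaceIdx_symm (n := k + 3) (i := i) (by omega)
        exact ⟨d, (hface _ _).2 (h1.trans (hr i).symm),
          (hface _ _).2 (h2.trans (hij.trans (hr j).symm))⟩
      · obtain ⟨d, h1, h2⟩ := exists_pathSquareFaceIdx_symm (n := k + 3) (i := j) (by omega)
        refine ⟨d.symm, (hface _ _).2 (h2.trans (hij.trans (hr i).symm)), ?_⟩
        rw [SimpleGraph.Dart.symm_symm]
        exact (hface _ _).2 (h1.trans (hr j).symm)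

/-- The graph already has `2n - 3` edges, the most that `OuterMap.card_le` permits for a connected
outerplanar graph. -/
theorem pathSquare_isMaximalOuterplanar (hn : 3 ≤ n) : IsMaximalOuterplanar (pathSquare n) := by
  classical
  refine ⟨⟨_, _, pathSquare_isPlanar hn, pathSquare_isOuter hn⟩, fun v w hvw hadj => ?_⟩
  rintro ⟨R, O, hP, hO⟩
  have hconn : (pathSquare n ⊔ SimpleGraph.edge v w).Connected :=
    (pathSquare_connected hn).mono le_sup_left
  obtain ⟨M, -⟩ := exists_outerMap (by rwa [Fintype.card_fin]) hconn R O hP hO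
  have hle := OuterMap.card_le M
  rw [← Nat.card_eq_fintype_card, ← two_mul_card_edgeSet, Fintype.card_fin] at hle
  have hsub : insert s(v, w) (pathSquare n).edgeSet ⊆
      (pathSquare n ⊔ SimpleGraph.edge v w).edgeSet := by
    rintro e (rfl | he)
    · exact Or.inr (by simp [SimpleGraph.edge_adj, hvw])
    · exact SimpleGraph.edgeSet_mono le_sup_left he
  have hcard := Set.ncard_le_ncard hsub (Set.toFinite _)
  rw [Set.ncard_insert_of_notMem (show s(v, w) ∉ (pathSquare n).edgeSet from hadj) (Set.toFinite _), ← Nat.card_coe_set_eq,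
    ← Nat.card_coe_set_eq, card_pathSquare_edgeSet hn] at hcard
  omega

theorem pathSquare_ncard_neighborSet_le (v : Fin n) :
    ((pathSquare n).neighborSet v).ncard ≤ 4 := by
  have h : ((pathSquare n).neighborSet v).ncard ≤
      (({(v : ℕ) - 2, (v : ℕ) - 1, (v : ℕ) + 1, (v : ℕ) + 2} : Finset ℕ) : Set ℕ).ncard := by
    refine Set.ncard_le_ncard_of_injOn (fun w : Fin n => (w : ℕ)) (fun w hw => ?_)
      (fun _ _ _ _ h => Fin.ext h) (Finset.finite_toSet _)
    obtain ⟨h1, h2, h3, h4, h5⟩ := pathSquareAdj_of_adj hw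
    simp only [Finset.coe_insert, Finset.coe_singleton, Set.mem_insert_iff, Set.mem_singleton_iff]
    omega
  rw [Set.ncard_coe_finset] at h
  exact h.trans Finset.card_le_four

end PathSquareFaces

theorem mainTheorem6 :
    (∀ (V : Type*) [Fintype V] (G : SimpleGraph V), IsMaximalOuterplanar G →
      ∃ D : Drawing G, D.IsOuterplanar ∧ D.numSegments ≤ Fintype.card V ∧
        (3 ≤ Fintype.card V → D.IsStarShaped)) ∧
    (∀ n : ℕ, 3 ≤ n →
      ∃ G : SimpleGraph (Fin n), IsMaximalOuterplanar G ∧ HasPathWeakDual G ∧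
        (∀ v : Fin n, (G.neighborSet v).ncard ≤ 4) ∧
        ∀ D : Drawing G, n ≤ D.numSegments) :=
  ⟨fun _ _ _ hG => hG.exists_drawing, fun n hn => ⟨pathSquare n,
    pathSquare_isMaximalOuterplanar hn, pathSquare_hasPathWeakDual hn,
    pathSquare_ncard_neighborSet_le,
    pathSquare_le_numSegments hn (by rw [card_pathSquare_edgeSet hn]; omega)⟩⟩
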